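/- Let $R$ be a quasi-Frobenius ring (right artinian and injective as a right module over itself) and let $\mathcal C$ be an $R$-coring, with comultiplication $\Delta(c)=c_{(1)}\otimes_R c_{(2)}$ and counit $\varepsilon$, that is locally projective (for instance projective) as a left and as a right $R$-module; here a module is locally projective if every finite subset of it has a finite dual basis. Let ${}^*\mathcal C={}_R\mathrm{Hom}(\mathcal C,R)$ be the left dual ring, with product $(f\#g)(c)=g(c_{(1)}f(c_{(2)}))$ and unit $\varepsilon$; $R$ acts on right ${}^*\mathcal C$-modules through the ring morphism $R\to{}^*\mathcal C$, $r\mapsto(c\mapsto\varepsilon(c)r)$. For a right ${}^*\mathcal C$-module $X$ let $\mathrm{Rat}^{\mathcal C}(X)$ be its rational part: the submodule of all $x\in X$ for which there is $\sum_i x_i\otimes c_i\in X\otimes_R\mathcal C$ with $x\cdot f=\sum_i x_i f(c_i)$ for all $f\in{}^*\mathcal C$. The module $X$ is called rational if $\mathrm{Rat}^{\mathcal C}(X)=X$. For a left $\mathcal C$-comodule $M$ with coaction $m\mapsto m_{[-1]}\otimes_R m_{[0]}$, the dual ${}^*M={}_R\mathrm{Hom}(M,R)$ is a right ${}^*\mathcal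 C$-module via $(f\cdot\alpha)(m)=\alpha(m_{[-1]}f(m_{[0]}))$. Density refers to the finite topology, whose basic open sets are the sets $\{g : g(x)=f(x)\text{ for all }x\in F\}$ with $F$ finite. Then the following nine conditions are equivalent: 1. the functor $\mathrm{Rat}^{\mathcal C}$ on right ${}^*\mathcal C$-modules is exact; 2. $\mathrm{Rat}^{\mathcal C}({}^*\mathcal C)$ is dense in ${}^*\mathcal C$; 3. $\mathrm{Rat}^{\mathcal C}({}^*M)$ is dense in ${}^*M$ for every left $\mathcal C$-comodule $M$; 4. $\mathrm{Rat}^{\mathcal C}({}^*Q)$ is dense in ${}^*Q$ for every injective left $\mathcal C$-comodule $Q$; 5. $\mathrm{Rat}^{\mathcal C}({}^*Q)$ is dense in ${}^*Q$ for every injective indecomposable left $\mathcal C$-comodule $Q$; 6. ${}^*Q$ is a rational ${}^*\mathcal C$-module for every injective indecomposable left $\mathcal C$-comodule $Q$; 7. the injective hull $E(S)$ of every simple left $\mathcal C$-comodule $S$ is finitely generated; 8. every simple right $\mathcal C$-comodule has a finitely generated projective cover; 9. $\mathcal C$ is right semiperfect, that is, $\mathcal C$ is locally projective as a left $R$-module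 and every simple right $\mathcal C$-comodule has a projective cover. -/

import Mathlib

open MulOpposite
open scoped TensorProduct

universe u v w x y z

/-! A right module over a ring `R` is a module over `Rᵐᵒᵖ`, so that `op r • m` is `m · r`.
Mathlib has the tensor product over commutative rings only; here is the balanced one. -/

/-- The subgroup of `M ⊗_ℤ N` generated by all `m r ⊗ n - m ⊗ r n`. -/
def balancedRelations (R : Type u) [Ring R] (M : Type v) (N : Type w) [AddCommGroup M]
    [Module Rᵐᵒᵖ M] [AddCommGroup N] [Module R N] : Submodule ℤ (M ⊗[ℤ] N) :=
  Submodule.span ℤ {t | ∃ (m : M) (r : R) (n : N), t = (op r • m) ⊗ₜ[ℤ] n - m ⊗ₜ[ℤ] (r • n)}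

/-- The tensor product `M ⊗_R N` of a right `R`-module `M` and a left `R`-module `N`. -/
def BTensor (R : Type u) [Ring R] (M : Type v) (N : Type w) [AddCommGroup M] [Module Rᵐᵒᵖ M]
    [AddCommGroup N] [Module R N] : Type (max v w) :=
  (M ⊗[ℤ] N) ⧸ balancedRelations R M N

namespace BTensor

section Basic

variable {R : Type u} [Ring R] {M : Type v} {N : Type w} [AddCommGroup M] [Module Rᵐᵒᵖ M]
  [AddCommGroup N] [Module R N]

instance instAddCommGroup : AddCommGroup (BTensor R M N) :=
  inferInstanceAs (AddCommGroup ((M ⊗[ℤ] N) ⧸ balancedRelations R M N))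

/-- The pure tensor `m ⊗ n`. -/
def tmul (R : Type u) [Ring R] {M : Type v} {N : Type w} [AddCommGroup M] [Module Rᵐᵒᵖ M]
    [AddCommGroup N] [Module R N] (m : M) (n : N) : BTensor R M N :=
  (balancedRelations R M N).mkQ (m ⊗ₜ[ℤ] n)

theorem add_tmul (m m' : M) (n : N) : tmul R (m + m') n = tmul R m n + tmul R m' n := by
  unfold tmul
  rw [TensorProduct.add_tmul]
  exact map_add _ _ _

theorem tmul_add (m : M) (n n' : N) : tmul R m (n + n') = tmul R m n + tmul R m n' := by
  unfold tmul
  rw [TensorProduct.tmul_add]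
  exact map_add _ _ _

theorem zero_tmul (n : N) : tmul R (0 : M) n = 0 := by
  unfold tmul
  rw [TensorProduct.zero_tmul]
  exact map_zero _

theorem tmul_zero (m : M) : tmul R m (0 : N) = 0 := by
  unfold tmul
  rw [TensorProduct.tmul_zero]
  exact map_zero _

theorem smul_tmul (m : M) (r : R) (n : N) : tmul R (op r • m) n = tmul R m (r • n) := by
  refine (Submodule.Quotient.eq _).2 (Submodule.subset_span ⟨m, r, n, rfl⟩)

@[elab_as_elim]
theorem induction_on {p : BTensor R M N → Prop} (t : BTensor R M N) (zero : p 0)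
    (tmul : ∀ m n, p (tmul R m n)) (add : ∀ s t, p s → p t → p (s + t)) : p t := by
  obtain ⟨t, rfl⟩ := (balancedRelations R M N).mkQ_surjective t
  induction t using TensorProduct.induction_on with
  | zero => exact zero
  | tmul m n => exact tmul m n
  | add a b ha hb =>
    rw [map_add]
    exact add _ _ ha hb

/-- The universal property: a biadditive balanced map factors through `M ⊗_R N`. -/
def lift {P : Type x} [AddCommGroup P] (f : M →+ N →+ P)
    (hf : ∀ m (r : R) n, f (op r • m) n = f m (r • n)) : BTensor R M N →+ P :=
  ((balancedRelations R M N).liftQ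
    (TensorProduct.liftAddHom f (fun z m n => by simp)).toIntLinearMap (by
      refine Submodule.span_le.2 ?_
      rintro _ ⟨m, r, n, rfl⟩
      simp [hf])).toAddMonoidHom

@[simp]
theorem lift_tmul {P : Type x} [AddCommGroup P] (f : M →+ N →+ P)
    (hf : ∀ m (r : R) n, f (op r • m) n = f m (r • n)) (m : M) (n : N) :
    lift f hf (tmul R m n) = f m n := rfl

theorem addHom_ext {P : Type x} [AddCommGroup P] {f g : BTensor R M N →+ P}
    (h : ∀ m n, f (tmul R m n) = g (tmul R m n)) : f = g := by
  ext t
  induction t using BTensor.induction_on with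
  | zero => simp
  | tmul m n => exact h m n
  | add a b ha hb => simp [ha, hb]

/-- `tmul` as a biadditive map. -/
def mk (R : Type u) [Ring R] (M : Type v) (N : Type w) [AddCommGroup M] [Module Rᵐᵒᵖ M]
    [AddCommGroup N] [Module R N] : M →+ N →+ BTensor R M N :=
  AddMonoidHom.mk' (fun m => AddMonoidHom.mk' (fun n => tmul R m n) (tmul_add m))
    (fun m m' => by ext n; exact add_tmul m m' n)

@[simp]
theorem mk_apply (m : M) (n : N) : mk R M N m n = tmul R m n := rfl

/-- `f ⊗ g` for a right linear map `f` and a left linear map `g`. -/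
def map {M' : Type x} {N' : Type y} [AddCommGroup M'] [Module Rᵐᵒᵖ M'] [AddCommGroup N']
    [Module R N'] (f : M →ₗ[Rᵐᵒᵖ] M') (g : N →ₗ[R] N') : BTensor R M N →+ BTensor R M' N' :=
  lift (((mk R M' N').comp f.toAddMonoidHom).compl₂ g.toAddMonoidHom)
    (fun m r n => by simp [smul_tmul])

@[simp]
theorem map_tmul {M' : Type x} {N' : Type y} [AddCommGroup M'] [Module Rᵐᵒᵖ M']
    [AddCommGroup N'] [Module R N'] (f : M →ₗ[Rᵐᵒᵖ] M') (g : N →ₗ[R] N') (m : M) (n : N) :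
    map f g (tmul R m n) = tmul R (f m) (g n) := rfl

/-- `m ⊗ n ↦ m · f n`, that is `M ⊗ f` followed by the identification `M ⊗_R R = M`. -/
def contractRight (M : Type v) [AddCommGroup M] [Module Rᵐᵒᵖ M] (f : N →ₗ[R] R) :
    BTensor R M N →+ M :=
  lift (AddMonoidHom.mk' (fun m => AddMonoidHom.mk' (fun n => op (f n) • m)
      (fun n n' => by simp [add_smul])) (fun m m' => by ext n; simp))
    (fun m r n => by simp [mul_smul])

@[simp]
theorem contractRight_tmul (f : N →ₗ[R] R) (m : M) (n : N) :
    contractRight M f (tmul R m n) = op (f n) • m := rfl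

theorem contractRight_add (f g : N →ₗ[R] R) (t : BTensor R M N) :
    contractRight M (f + g) t = contractRight M f t + contractRight M g t := by
  induction t using BTensor.induction_on with
  | zero => simp
  | tmul m n => simp [add_smul]
  | add a b ha hb =>
    simp only [map_add, ha, hb]
    abel

theorem contractRight_zero (t : BTensor R M N) : contractRight M (0 : N →ₗ[R] R) t = 0 := by
  induction t using BTensor.induction_on with
  | zero => simp
  | tmul m n => simp
  | add a b ha hb => simp [ha, hb]

/-- `m ⊗ n ↦ f m · n`, that is `f ⊗ N` followed by the identification `R ⊗_R N = N`. -/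
def contractLeft (N : Type w) [AddCommGroup N] [Module R N] (f : M →ₗ[Rᵐᵒᵖ] R) :
    BTensor R M N →+ N :=
  lift (AddMonoidHom.mk' (fun m => AddMonoidHom.mk' (fun n => f m • n)
      (fun n n' => by simp)) (fun m m' => by ext n; simp [add_smul]))
    (fun m r n => by simp [mul_smul])

@[simp]
theorem contractLeft_tmul (f : M →ₗ[Rᵐᵒᵖ] R) (m : M) (n : N) :
    contractLeft N f (tmul R m n) = f m • n := rfl

end Basic

section Actions

variable {R : Type u} [Ring R] {M : Type v} {N : Type w} [AddCommGroup M] [Module Rᵐᵒᵖ M]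
  [AddCommGroup N] [Module R N]

/-- If `M` is a bimodule, then `M ⊗_R N` is a left module: `r (m ⊗ n) = r m ⊗ n`. -/
instance instSMulLeft [Module R M] [SMulCommClass R Rᵐᵒᵖ M] : SMul R (BTensor R M N) where
  smul r t := lift ((mk R M N).comp (DistribSMul.toAddMonoidHom M r))
    (fun m s n => by simp [smul_comm r (op s) m, smul_tmul]) t

@[simp]
theorem smul_left_tmul [Module R M] [SMulCommClass R Rᵐᵒᵖ M] (r : R) (m : M) (n : N) :
    r • tmul R m n = tmul R (r • m) n := rfl

instance instModuleLeft [Module R M] [SMulCommClass R Rᵐᵒᵖ M] : Module R (BTensor R M N) :=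
  have hz : ∀ r : R, r • (0 : BTensor R M N) = 0 := fun r => map_zero (lift _ _)
  have ha : ∀ (r : R) (s t : BTensor R M N), r • (s + t) = r • s + r • t :=
    fun r => map_add (lift _ _)
  { smul_zero := hz
    smul_add := ha
    one_smul := fun t => by
      induction t using BTensor.induction_on with
      | zero => exact hz 1
      | tmul m n => simp
      | add s t hs ht => rw [ha, hs, ht]
    mul_smul := fun a b t => by
      induction t using BTensor.induction_on with
      | zero => simp only [hz]
      | tmul m n => simp [mul_smul]
      | add s t hs ht => simp only [ha, hs, ht]
    add_smul := fun a b t => by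
      induction t using BTensor.induction_on with
      | zero => simp only [hz, add_zero]
      | tmul m n => simp [add_smul, add_tmul]
      | add s t hs ht =>
        simp only [ha, hs, ht]
        abel
    zero_smul := fun t => by
      induction t using BTensor.induction_on with
      | zero => exact hz 0
      | tmul m n => simp [zero_tmul]
      | add s t hs ht => simp only [ha, hs, ht, add_zero] }

/-- If `N` is a bimodule, then `M ⊗_R N` is a right module: `(m ⊗ n) r = m ⊗ n r`. -/
instance instSMulRight [Module Rᵐᵒᵖ N] [SMulCommClass R Rᵐᵒᵖ N] :
    SMul Rᵐᵒᵖ (BTensor R M N) where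
  smul r t := lift ((mk R M N).compl₂ (DistribSMul.toAddMonoidHom N r))
    (fun m s n => by simp [← smul_comm s r n, smul_tmul]) t

@[simp]
theorem smul_right_tmul [Module Rᵐᵒᵖ N] [SMulCommClass R Rᵐᵒᵖ N] (r : Rᵐᵒᵖ) (m : M) (n : N) :
    r • tmul R m n = tmul R m (r • n) := rfl

instance instModuleRight [Module Rᵐᵒᵖ N] [SMulCommClass R Rᵐᵒᵖ N] :
    Module Rᵐᵒᵖ (BTensor R M N) :=
  have hz : ∀ r : Rᵐᵒᵖ, r • (0 : BTensor R M N) = 0 := fun r => map_zero (lift _ _)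
  have ha : ∀ (r : Rᵐᵒᵖ) (s t : BTensor R M N), r • (s + t) = r • s + r • t :=
    fun r => map_add (lift _ _)
  { smul_zero := hz
    smul_add := ha
    one_smul := fun t => by
      induction t using BTensor.induction_on with
      | zero => exact hz 1
      | tmul m n => simp
      | add s t hs ht => rw [ha, hs, ht]
    mul_smul := fun a b t => by
      induction t using BTensor.induction_on with
      | zero => simp only [hz]
      | tmul m n => simp [mul_smul]
      | add s t hs ht => simp only [ha, hs, ht]
    add_smul := fun a b t => by
      induction t using BTensor.induction_on with
      | zero => simp only [hz, add_zero]
      | tmul m n => simp [add_smul, tmul_add]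
      | add s t hs ht =>
        simp only [ha, hs, ht]
        abel
    zero_smul := fun t => by
      induction t using BTensor.induction_on with
      | zero => exact hz 0
      | tmul m n => simp [tmul_zero]
      | add s t hs ht => simp only [ha, hs, ht, add_zero] }

theorem contractRight_smul [Module R M] [SMulCommClass R Rᵐᵒᵖ M] (f : N →ₗ[R] R) (r : R)
    (t : BTensor R M N) : contractRight M f (r • t) = r • contractRight M f t := by
  induction t using BTensor.induction_on with
  | zero => simp
  | tmul m n => simp [smul_comm r]
  | add a b ha hb => simp [ha, hb]

end Actions

/-- `l ⊗ m ↦ (n ↦ l ⊗ (m ⊗ n))`. -/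
def assocAux (R : Type u) [Ring R] (L : Type v) (M : Type w) (N : Type x) [AddCommGroup L]
    [Module Rᵐᵒᵖ L] [AddCommGroup M] [Module R M] [Module Rᵐᵒᵖ M] [SMulCommClass R Rᵐᵒᵖ M]
    [AddCommGroup N] [Module R N] :
    BTensor R L M →+ N →+ BTensor R L (BTensor R M N) :=
  lift
    (AddMonoidHom.mk'
      (fun l => (AddMonoidHom.compHom (mk R L (BTensor R M N) l)).comp (mk R M N))
      (fun l l' => by ext m n; simp))
    (fun l r m => by ext n; simp [smul_tmul])

theorem assocAux_tmul (R : Type u) [Ring R] (L : Type v) (M : Type w) (N : Type x) [AddCommGroup L]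
    [Module Rᵐᵒᵖ L] [AddCommGroup M] [Module R M] [Module Rᵐᵒᵖ M] [SMulCommClass R Rᵐᵒᵖ M]
    [AddCommGroup N] [Module R N] (l : L) (m : M) (n : N) :
    assocAux R L M N (tmul R l m) n = tmul R l (tmul R m n) := rfl

/-- The canonical isomorphism `(L ⊗_R M) ⊗_R N → L ⊗_R (M ⊗_R N)`, as an additive map. -/
def assoc (R : Type u) [Ring R] (L : Type v) (M : Type w) (N : Type x) [AddCommGroup L]
    [Module Rᵐᵒᵖ L] [AddCommGroup M] [Module R M] [Module Rᵐᵒᵖ M] [SMulCommClass R Rᵐᵒᵖ M]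
    [AddCommGroup N] [Module R N] :
    BTensor R (BTensor R L M) N →+ BTensor R L (BTensor R M N) :=
  lift (assocAux R L M N) (fun t r n => by
    induction t using BTensor.induction_on with
    | zero => simp
    | tmul l m => simp [assocAux_tmul, smul_tmul]
    | add a b ha hb => simp [ha, hb])

@[simp]
theorem assoc_tmul (R : Type u) [Ring R] (L : Type v) (M : Type w) (N : Type x) [AddCommGroup L]
    [Module Rᵐᵒᵖ L] [AddCommGroup M] [Module R M] [Module Rᵐᵒᵖ M] [SMulCommClass R Rᵐᵒᵖ M]
    [AddCommGroup N] [Module R N] (l : L) (m : M) (n : N) :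
    assoc R L M N (tmul R (tmul R l m) n) = tmul R l (tmul R m n) := rfl

end BTensor

/-- An `R`-coring structure on the `R`-bimodule `C`: a comultiplication `Δ : C → C ⊗_R C` and a
counit `ε : C → R`, bimodule maps that are coassociative and counital. -/
class Coring (R : Type u) (C : Type v) [Ring R] [AddCommGroup C] [Module R C] [Module Rᵐᵒᵖ C]
    [SMulCommClass R Rᵐᵒᵖ C] where
  /-- the comultiplication as a left linear map -/
  comul : C →ₗ[R] BTensor R C C
  /-- the comultiplication as a right linear map -/
  comulR : C →ₗ[Rᵐᵒᵖ] BTensor R C C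
  /-- the counit as a left linear map -/
  counit : C →ₗ[R] R
  /-- the counit as a right linear map -/
  counitR : C →ₗ[Rᵐᵒᵖ] R
  comulR_apply : ∀ c, comulR c = comul c
  counitR_apply : ∀ c, counitR c = counit c
  coassoc : ∀ c, BTensor.assoc R C C C (BTensor.map comulR LinearMap.id (comul c)) =
    BTensor.map LinearMap.id comul (comul c)
  counit_left : ∀ c, BTensor.contractLeft C counitR (comul c) = c
  counit_right : ∀ c, BTensor.contractRight C counit (comul c) = c

section Comodules

variable (R C : Type u) [Ring R] [AddCommGroup C] [Module R C] [Module Rᵐᵒᵖ C]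
  [SMulCommClass R Rᵐᵒᵖ C] [Coring R C]

/-- A left `C`-comodule: a left `R`-module with a coassociative and counital left `R`-linear
coaction `M → C ⊗_R M`. -/
structure LeftComodule where
  /-- the underlying type -/
  carrier : Type u
  [addCommGroup : AddCommGroup carrier]
  [module : Module R carrier]
  /-- the coaction -/
  coact : carrier →ₗ[R] BTensor R C carrier
  coassoc : ∀ m, BTensor.assoc R C C carrier
      (BTensor.map (Coring.comulR (R := R)) LinearMap.id (coact m)) =
    BTensor.map LinearMap.id coact (coact m)
  counit : ∀ m, BTensor.contractLeft carrier (Coring.counitR (R := R)) (coact m) = m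

/-- A right `C`-comodule: a right `R`-module with a coassociative and counital right `R`-linear
coaction `M → M ⊗_R C`. -/
structure RightComodule where
  /-- the underlying type -/
  carrier : Type u
  [addCommGroup : AddCommGroup carrier]
  [module : Module Rᵐᵒᵖ carrier]
  /-- the coaction -/
  coact : carrier →ₗ[Rᵐᵒᵖ] BTensor R carrier C
  coassoc : ∀ m, BTensor.assoc R carrier C C (BTensor.map coact LinearMap.id (coact m)) =
    BTensor.map LinearMap.id (Coring.comul (R := R)) (coact m)
  counit : ∀ m, BTensor.contractRight carrier (Coring.counit (R := R)) (coact m) = m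

end Comodules

attribute [instance] LeftComodule.addCommGroup LeftComodule.module
  RightComodule.addCommGroup RightComodule.module

namespace LeftComodule

variable {R C : Type u} [Ring R] [AddCommGroup C] [Module R C] [Module Rᵐᵒᵖ C]
  [SMulCommClass R Rᵐᵒᵖ C] [Coring R C]

instance instCoeSort : CoeSort (LeftComodule R C) (Type u) := ⟨LeftComodule.carrier⟩

/-- Morphisms of left comodules: the left `R`-linear maps that preserve the coaction. -/
def IsColinear {M N : LeftComodule R C} (f : M →ₗ[R] N) : Prop :=
  ∀ m, N.coact (f m) = BTensor.map LinearMap.id f (M.coact m)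

/-- Subcomodules of `M`: the submodules `N` whose coaction lands in (the image of) `C ⊗_R N`. -/
def IsSubcomodule (M : LeftComodule R C) (N : Submodule R M) : Prop :=
  ∀ n ∈ N, M.coact n ∈
    (BTensor.map (LinearMap.id : C →ₗ[Rᵐᵒᵖ] C) N.subtype).range

/-- Finitely generated as a comodule: the only subcomodule that contains some fixed finite set is
the whole of `M`. -/
def IsFG (M : LeftComodule R C) : Prop :=
  ∃ F : Finset M, ∀ N : Submodule R M, M.IsSubcomodule N → (F : Set M) ⊆ N → N = ⊤

/-- Simple comodules. -/
def IsSimple (M : LeftComodule R C) : Prop :=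
  Nontrivial M ∧ ∀ N : Submodule R M, M.IsSubcomodule N → N = ⊥ ∨ N = ⊤

/-- Indecomposable comodules: nonzero, and not the direct sum of two nonzero subcomodules. -/
def IsIndecomposable (M : LeftComodule R C) : Prop :=
  Nontrivial M ∧ ∀ N N' : Submodule R M, M.IsSubcomodule N → M.IsSubcomodule N' →
    IsCompl N N' → N = ⊥ ∨ N' = ⊥

/-- Injective objects of the category of left comodules. -/
def IsInjective (Q : LeftComodule R C) : Prop :=
  ∀ (X Y : LeftComodule R C) (i : X →ₗ[R] Y) (g : X →ₗ[R] Q), IsColinear i →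
    Function.Injective i → IsColinear g → ∃ h : Y →ₗ[R] Q, IsColinear h ∧ h ∘ₗ i = g

/-- `i : S → E` is an injective hull: an essential monomorphism into an injective comodule. -/
def IsInjectiveHull {S E : LeftComodule R C} (i : S →ₗ[R] E) : Prop :=
  IsColinear i ∧ Function.Injective i ∧ E.IsInjective ∧
    ∀ N : Submodule R E, E.IsSubcomodule N → N ⊓ LinearMap.range i = ⊥ → N = ⊥

end LeftComodule

namespace RightComodule

variable {R C : Type u} [Ring R] [AddCommGroup C] [Module R C] [Module Rᵐᵒᵖ C]
  [SMulCommClass R Rᵐᵒᵖ C] [Coring R C]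

instance instCoeSort : CoeSort (RightComodule R C) (Type u) := ⟨RightComodule.carrier⟩

/-- Morphisms of right comodules: the right `R`-linear maps that preserve the coaction. -/
def IsColinear {M N : RightComodule R C} (f : M →ₗ[Rᵐᵒᵖ] N) : Prop :=
  ∀ m, N.coact (f m) = BTensor.map f LinearMap.id (M.coact m)

/-- Subcomodules of `M`: the submodules `N` whose coaction lands in (the image of) `N ⊗_R C`. -/
def IsSubcomodule (M : RightComodule R C) (N : Submodule Rᵐᵒᵖ M) : Prop :=
  ∀ n ∈ N, M.coact n ∈ (BTensor.map N.subtype (LinearMap.id : C →ₗ[R] C)).range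

/-- Finitely generated as a comodule: the only subcomodule that contains some fixed finite set is
the whole of `M`. -/
def IsFG (M : RightComodule R C) : Prop :=
  ∃ F : Finset M, ∀ N : Submodule Rᵐᵒᵖ M, M.IsSubcomodule N → (F : Set M) ⊆ N → N = ⊤

/-- Simple comodules. -/
def IsSimple (M : RightComodule R C) : Prop :=
  Nontrivial M ∧ ∀ N : Submodule Rᵐᵒᵖ M, M.IsSubcomodule N → N = ⊥ ∨ N = ⊤

/-- Projective objects of the category of right comodules. -/
def IsProjective (P : RightComodule R C) : Prop :=
  ∀ (X Y : RightComodule R C) (p : X →ₗ[Rᵐᵒᵖ] Y) (g : P →ₗ[Rᵐᵒᵖ] Y), IsColinear p →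
    Function.Surjective p → IsColinear g → ∃ h : P →ₗ[Rᵐᵒᵖ] X, IsColinear h ∧ p ∘ₗ h = g

/-- `f : P → M` is a projective cover: an epimorphism with superfluous kernel from a projective
comodule. -/
def IsProjectiveCover {P M : RightComodule R C} (f : P →ₗ[Rᵐᵒᵖ] M) : Prop :=
  IsColinear f ∧ Function.Surjective f ∧ P.IsProjective ∧
    ∀ N : Submodule Rᵐᵒᵖ P, P.IsSubcomodule N → LinearMap.ker f ⊔ N = ⊤ → N = ⊤

end RightComodule

/-- Locally projective modules: every finite subset has a finite dual basis. For right
`R`-modules take `A = Rᵐᵒᵖ`. Every projective module is locally projective. -/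
def IsLocallyProjective (A : Type u) [Ring A] (M : Type v) [AddCommGroup M] [Module A M] : Prop :=
  ∀ F : Finset M, ∃ (n : ℕ) (f : Fin n → M →ₗ[A] A) (m : Fin n → M),
    ∀ c ∈ F, c = ∑ i, f i c • m i

/-- Quasi-Frobenius rings: right artinian and injective as a right module over themselves. -/
def IsQuasiFrobenius (R : Type u) [Ring R] : Prop :=
  IsArtinian Rᵐᵒᵖ R ∧ Module.Injective Rᵐᵒᵖ R

/-- A coring is right semiperfect if it is locally projective as a left module and every simple
right comodule has a projective cover. -/
def IsRightSemiperfect (R C : Type u) [Ring R] [AddCommGroup C] [Module R C] [Module Rᵐᵒᵖ C]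
    [SMulCommClass R Rᵐᵒᵖ C] [Coring R C] : Prop :=
  IsLocallyProjective R C ∧ ∀ T : RightComodule R C, T.IsSimple →
    ∃ (P : RightComodule R C) (f : P →ₗ[Rᵐᵒᵖ] T), RightComodule.IsProjectiveCover f

/-- The finite topology on `Hom_R(M, R)`, with the basic open sets
`{g | g x = f x for all x ∈ F}` for `F` finite. -/
@[reducible] def finiteTopology (R : Type u) [Ring R] (M : Type v) [AddCommGroup M] [Module R M] :
    TopologicalSpace (M →ₗ[R] R) :=
  TopologicalSpace.generateFrom
    {U | ∃ (f : M →ₗ[R] R) (F : Finset M), U = {g | ∀ a ∈ F, g a = f a}}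

/-- Density in the finite topology. -/
def IsFinitelyDense {R : Type u} [Ring R] {M : Type v} [AddCommGroup M] [Module R M]
    (S : Set (M →ₗ[R] R)) : Prop :=
  @Dense _ (finiteTopology R M) S

section Dual

variable (R C : Type u) [Ring R] [AddCommGroup C] [Module R C] [Module Rᵐᵒᵖ C]
  [SMulCommClass R Rᵐᵒᵖ C]

/-- The left dual `*C = Hom_R(C, R)` of the coring `C`, the left linear maps `C → R`. -/
def LeftDual : Type u := C →ₗ[R] R

instance LeftDual.instAddCommGroup : AddCommGroup (LeftDual R C) :=
  inferInstanceAs (AddCommGroup (C →ₗ[R] R))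

instance LeftDual.instFunLike : FunLike (LeftDual R C) C R :=
  inferInstanceAs (FunLike (C →ₗ[R] R) C R)

variable {R C}

/-- For a coaction `ρ : M → C ⊗_R M`, `f : M → R` and `a ∈ *C`, the map
`m ↦ a (m₍₋₁₎ · f m₍₀₎)`. -/
def coactDual {M : Type u} [AddCommGroup M] [Module R M] (ρ : M →ₗ[R] BTensor R C M)
    (f : M →ₗ[R] R) (a : C →ₗ[R] R) : M →ₗ[R] R where
  toFun m := a (BTensor.contractRight C f (ρ m))
  map_add' m m' := by simp
  map_smul' r m := by simp [BTensor.contractRight_smul]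

theorem coactDual_apply {M : Type u} [AddCommGroup M] [Module R M] (ρ : M →ₗ[R] BTensor R C M)
    (f : M →ₗ[R] R) (a : C →ₗ[R] R) (m : M) :
    coactDual ρ f a m = a (BTensor.contractRight C f (ρ m)) := rfl

variable [Coring R C]

theorem coactDual_add {M : Type u} [AddCommGroup M] [Module R M] (ρ : M →ₗ[R] BTensor R C M)
    (f g : M →ₗ[R] R) (a : C →ₗ[R] R) :
    coactDual ρ (f + g) a = coactDual ρ f a + coactDual ρ g a := by
  ext m
  simp [coactDual_apply, BTensor.contractRight_add]

theorem coactDual_zero {M : Type u} [AddCommGroup M] [Module R M] (ρ : M →ₗ[R] BTensor R C M)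
    (a : C →ₗ[R] R) : coactDual ρ 0 a = 0 := by
  ext m
  simp [coactDual_apply, BTensor.contractRight_zero]

theorem coactDual_coactDual {M : Type u} [AddCommGroup M] [Module R M]
    (ρ : M →ₗ[R] BTensor R C M)
    (hρ : ∀ m, BTensor.assoc R C C M
        (BTensor.map (Coring.comulR (R := R)) LinearMap.id (ρ m)) =
      BTensor.map LinearMap.id ρ (ρ m))
    (f : M →ₗ[R] R) (a b : C →ₗ[R] R) :
    coactDual ρ (coactDual ρ f a) b = coactDual ρ f (coactDual Coring.comul a b) := by
  ext m
  simp only [coactDual_apply]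
  congr 1
  let φ : BTensor R C M →ₗ[R] R :=
    { toFun := fun t => a (BTensor.contractRight C f t)
      map_add' := fun s t => by simp
      map_smul' := fun r t => by simp [BTensor.contractRight_smul] }
  have h := congrArg (BTensor.contractRight C φ) (hρ m)
  have h1 : ∀ t : BTensor R C M, BTensor.contractRight C φ (BTensor.map LinearMap.id ρ t) =
      BTensor.contractRight C (coactDual ρ f a) t := by
    intro t
    induction t using BTensor.induction_on with
    | zero => simp
    | tmul c m => rfl
    | add s t hs ht => simp [hs, ht]
  have h3 : ∀ (s : BTensor R C C) (m : M), BTensor.contractRight C φ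
      (BTensor.assoc R C C M (BTensor.tmul R s m)) =
      BTensor.contractRight C a (op (f m) • s) := by
    intro s m
    induction s using BTensor.induction_on with
    | zero =>
      simp [BTensor.zero_tmul]
    | tmul c d => rfl
    | add s t hs ht => simp [BTensor.add_tmul, hs, ht]
  have h2 : ∀ t : BTensor R C M, BTensor.contractRight C φ (BTensor.assoc R C C M
      (BTensor.map (Coring.comulR (R := R)) LinearMap.id t)) =
      BTensor.contractRight C a (Coring.comul (BTensor.contractRight C f t)) := by
    intro t
    induction t using BTensor.induction_on with
    | zero => simp
    | tmul c m =>
      rw [BTensor.map_tmul, h3, BTensor.contractRight_tmul, ← Coring.comulR_apply, map_smul Coring.comulR]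
      rfl
    | add s t hs ht => simp [hs, ht]
  rw [h1, h2] at h
  exact h.symm

theorem coactDual_counit {M : Type u} [AddCommGroup M] [Module R M]
    (ρ : M →ₗ[R] BTensor R C M)
    (hρ : ∀ m, BTensor.contractLeft M (Coring.counitR (R := R)) (ρ m) = m)
    (f : M →ₗ[R] R) : coactDual ρ f Coring.counit = f := by
  ext m
  rw [coactDual_apply]
  conv_rhs => rw [← hρ m]
  induction ρ m using BTensor.induction_on with
  | zero => simp
  | tmul c m =>
    rw [BTensor.contractRight_tmul, BTensor.contractLeft_tmul, ← Coring.counitR_apply]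
    simp
  | add s t hs ht => simp [hs, ht]

/-- The ring structure of `*C`: `(f # g) c = g (c₍₁₎ · f c₍₂₎)`, with the counit as its unit. -/
instance LeftDual.instRing : Ring (LeftDual R C) :=
  { LeftDual.instAddCommGroup R C with
    mul := fun f g => coactDual (R := R) (C := C) Coring.comul f g
    one := (Coring.counit : C →ₗ[R] R)
    left_distrib := fun f g h => LinearMap.ext fun c => rfl
    right_distrib := fun f g h => coactDual_add (R := R) (C := C) Coring.comul f g h
    zero_mul := fun f => coactDual_zero (R := R) (C := C) Coring.comul f
    mul_zero := fun f => LinearMap.ext fun c => rfl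
    mul_assoc := fun f g h => coactDual_coactDual (R := R) (C := C) Coring.comul Coring.coassoc f g h
    one_mul := fun f => LinearMap.ext fun c => congrArg f (Coring.counit_right c)
    mul_one := fun f => coactDual_counit (R := R) (C := C) Coring.comul Coring.counit_left f }

/-- The image in `*C` of `r ∈ R` under the ring morphism `R → *C`, `c ↦ ε c · r`. -/
def LeftDual.ofBase (R C : Type u) [Ring R] [AddCommGroup C] [Module R C] [Module Rᵐᵒᵖ C]
    [SMulCommClass R Rᵐᵒᵖ C] [Coring R C] (r : R) : LeftDual R C :=
  (LinearMap.toSpanSingleton R R r).comp (Coring.counit : C →ₗ[R] R)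

theorem LeftDual.mul_apply (f g : LeftDual R C) (c : C) :
    (f * g) c = g (BTensor.contractRight C (f : C →ₗ[R] R) (Coring.comul c)) := rfl

theorem LeftDual.ofBase_apply (r : R) (c : C) :
    LeftDual.ofBase R C r c = Coring.counit (R := R) c * r := rfl

/-- The dual `*M = Hom_R(M, R)` of a left comodule `M`. -/
def LeftComodule.Dual (M : LeftComodule R C) : Type u := M →ₗ[R] R

instance LeftComodule.Dual.instAddCommGroup (M : LeftComodule R C) : AddCommGroup M.Dual :=
  inferInstanceAs (AddCommGroup (M →ₗ[R] R))

/-- The dual of a left comodule is a right `*C`-module: `(f · a) m = a (m₍₋₁₎ · f m₍₀₎)`. -/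
instance LeftComodule.Dual.instModule (M : LeftComodule R C) :
    Module (LeftDual R C)ᵐᵒᵖ M.Dual where
  smul a f := coactDual M.coact f a.unop
  one_smul f := coactDual_counit M.coact M.counit f
  mul_smul a b f := (coactDual_coactDual M.coact M.coassoc f b.unop a.unop).symm
  smul_zero a := coactDual_zero M.coact a.unop
  smul_add a f g := coactDual_add M.coact f g a.unop
  add_smul a b f := LinearMap.ext fun m => rfl
  zero_smul f := LinearMap.ext fun m => rfl

theorem LeftComodule.Dual.smul_def (M : LeftComodule R C) (a : LeftDual R C) (f : M.Dual) :
    op a • f = coactDual M.coact (f : M →ₗ[R] R) a := rfl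

end Dual

section Rational

variable (R C : Type u) [Ring R] [AddCommGroup C] [Module R C] [Module Rᵐᵒᵖ C]
  [SMulCommClass R Rᵐᵒᵖ C] [Coring R C]

/-- The rational part `Rat^C(X)` of a right `*C`-module `X`: the elements `a` for which there is
`∑ i, x i ⊗ c i` in `X ⊗_R C` with `a · f = ∑ i, x i · f (c i)` for all `f ∈ *C`. Here `R` acts on
`X` through `R → *C`. -/
def ratPart (X : Type u) [AddCommGroup X] [Module (LeftDual R C)ᵐᵒᵖ X] :
    Submodule (LeftDual R C)ᵐᵒᵖ X where
  carrier := {a | ∃ (n : ℕ) (x : Fin n → X) (c : Fin n → C), ∀ f : LeftDual R C,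
    op f • a = ∑ i, op (LeftDual.ofBase R C (f (c i))) • x i}
  zero_mem' := ⟨0, Fin.elim0, Fin.elim0, fun f => by simp⟩
  add_mem' := by
    rintro a b ⟨n, x, c, h⟩ ⟨n', x', c', h'⟩
    refine ⟨n + n', Fin.append x x', Fin.append c c', fun f => ?_⟩
    simp [Fin.sum_univ_add, smul_add, h, h']
  smul_mem' := by
    rintro g a ⟨n, x, c, h⟩
    refine ⟨n, x, fun i => BTensor.contractRight C (g.unop : C →ₗ[R] R) (Coring.comul (c i)),
      fun f => ?_⟩
    rw [smul_smul, ← op_unop g, ← op_mul, h]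
    rfl

/-- A right `*C`-module is rational if it is its own rational part. -/
def IsRational (X : Type u) [AddCommGroup X] [Module (LeftDual R C)ᵐᵒᵖ X] : Prop :=
  ratPart R C X = ⊤

variable {R C}

/-- The functor `Rat^C` on morphisms: the restriction to the rational parts. -/
def ratMap {X Y : Type u} [AddCommGroup X] [Module (LeftDual R C)ᵐᵒᵖ X] [AddCommGroup Y]
    [Module (LeftDual R C)ᵐᵒᵖ Y] (g : X →ₗ[(LeftDual R C)ᵐᵒᵖ] Y) :
    ratPart R C X →ₗ[(LeftDual R C)ᵐᵒᵖ] ratPart R C Y :=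
  g.restrict (by
    rintro a ⟨n, x, c, h⟩
    exact ⟨n, fun i => g (x i), c, fun f => by rw [← map_smul, h, map_sum]; simp⟩)

variable (R C)

/-- `Rat^C` is exact: it maps short exact sequences of right `*C`-modules to short exact
sequences. -/
def RatIsExact : Prop :=
  ∀ (X Y Z : Type u) [AddCommGroup X] [AddCommGroup Y] [AddCommGroup Z]
    [Module (LeftDual R C)ᵐᵒᵖ X] [Module (LeftDual R C)ᵐᵒᵖ Y] [Module (LeftDual R C)ᵐᵒᵖ Z]
    (f : X →ₗ[(LeftDual R C)ᵐᵒᵖ] Y) (g : Y →ₗ[(LeftDual R C)ᵐᵒᵖ] Z),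
    Function.Injective f → Function.Exact f g → Function.Surjective g →
      Function.Injective (ratMap f) ∧ Function.Exact (ratMap f) (ratMap g) ∧
        Function.Surjective (ratMap g)

end Rational

/-!
Everything passes through rational local units: elements of `Rat(*C)` that agree with the counit
on a given finite subset of `C`. An element of a rational module involves only finitely many
elements of `C`, so a local unit for these fixes it; this makes `Rat` exact, and multiplication by
local units makes `Rat(*M)` dense in `*M` for every left comodule `M`. Conversely, density of
`Rat(*C)` near the counit gives local units. If `Rat` is exact, then for `c₁, …, cₙ` in `C` the
cyclic quotient of `*C` generated by `(c₁, …, cₙ)` is rational because `C` is locally projective,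
and a rational preimage of its generator is a local unit (`RatIsExact.hasRationalLocalUnits`).

The other conditions concern the injective hulls `E(S)` of the simple left comodules `S`. The
ring-theoretic input is that a right artinian and right self-injective ring `R` is left artinian,
left self-injective and a left cogenerator, and that a right submodule of the dual of a finitely
generated left module `M` that separates the points of `M` from zero is the whole dual
(`QuasiFrobenius.eq_top_of_separating`). The one step that is not a formal annihilator computation
is that simple right modules embed into `R`. It holds since sending a two-sided ideal `K` above
the radical to the right annihilator of the part of the right socle that is killed by `K` is an
injective self-map of a finite set, hence surjective. Now `C` is an injective left comodule, as
colinear maps `M → C` are the same as functionals on `M`, and a functional on `E(S)` that does not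
vanish on `S` embeds `E(S)` into `C`, as a direct summand.

* If `Rat(*E(S))` is dense in `*E(S)`, then there is a rational functional that does not vanish on
  `S`. It embeds `E(S)` into `C` and involves only finitely many functionals, which embed `E(S)`
  into a finitely generated free module (`finite_of_mem_ratPart`). Conversely, every injective
  indecomposable comodule is some `E(S)`, and duals of finitely generated comodules are rational.
* If all `E(S)` are finitely generated, then the functionals that factor through some colinear map
  `C → E(S)` are rational, and by the double annihilator property their span is dense
  (`LeftComodule.HasFGHulls.exists_mem_span`). In particular one of them acts nontrivially on a given simple
  right comodule `T`, which yields an epimorphism from the right comodule `*E(S)` to `T`. It is a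
  projective cover, since `*E(S)` is a direct summand of `*C` and its proper subcomodules vanish
  on `S`.
* If the simple right comodule `*S` has a projective cover `P`, then `P` is cyclic, so it has
  finite length. It maps onto the dual of every finitely generated comodule between `S` and `E(S)`
  (`LeftComodule.IsInjectiveHull.exists_surjective_dual`), so that the lengths of these are bounded, and `E(S)`
  is finitely generated.
-/

/-! ### Annihilators in right self-injective rings -/

namespace QuasiFrobenius

section Annihilators

variable {R : Type u} [Ring R]

/-- The left annihilator of a subset of a ring, a left ideal. -/
def leftAnn (s : Set R) : Ideal R where
  carrier := {a | ∀ x ∈ s, a * x = 0}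
  zero_mem' := by simp
  add_mem' := by
    intro a b ha hb x hx
    rw [add_mul, ha x hx, hb x hx, add_zero]
  smul_mem' := by
    intro r a ha x hx
    rw [smul_eq_mul, mul_assoc, ha x hx, mul_zero]

/-- The right annihilator of a subset of a ring, a right ideal. -/
def rightAnn (s : Set R) : Submodule Rᵐᵒᵖ R where
  carrier := {x | ∀ a ∈ s, a * x = 0}
  zero_mem' := by simp
  add_mem' := by
    intro x y hx hy a ha
    rw [mul_add, hx a ha, hy a ha, add_zero]
  smul_mem' := by
    intro r x hx a ha
    rw [← op_unop r, op_smul_eq_mul, ← mul_assoc, hx a ha, zero_mul]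

theorem mem_rightAnn {s : Set R} {x : R} : x ∈ rightAnn s ↔ ∀ a ∈ s, a * x = 0 := Iff.rfl

theorem mul_mem_right' (I : Submodule Rᵐᵒᵖ R) {x : R} (hx : x ∈ I) (r : R) : x * r ∈ I := by
  have := I.smul_mem (op r) hx
  rwa [op_smul_eq_mul] at this

theorem le_leftAnn_rightAnn (L : Ideal R) : L ≤ leftAnn (rightAnn (L : Set R) : Set R) :=
  fun a ha _ hx => hx a ha

theorem map_eq_map_one_mul (h : R →ₗ[Rᵐᵒᵖ] R) (x : R) : h x = h 1 * x := by
  have := h.map_smul (op x) 1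
  rwa [op_smul_eq_mul, one_mul, op_smul_eq_mul] at this

/-- Left multiplication by an element, as a map of right modules. -/
def leftMul (a : R) : R →ₗ[Rᵐᵒᵖ] R := DistribSMul.toLinearMap Rᵐᵒᵖ R a

theorem leftMul_apply (a x : R) : leftMul a x = a * x := rfl

end Annihilators

section SelfInjective

variable {R : Type u} [Ring R] [Module.Injective Rᵐᵒᵖ R]

/-- Left annihilators turn intersections of right ideals into sums: the functional given by an
annihilator of `I ⊓ I'` on `R / (I ⊓ I')` extends to `R / I × R / I'`. -/
theorem leftAnn_inf_le (I I' : Submodule Rᵐᵒᵖ R) :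
    leftAnn ((I ⊓ I' : Submodule Rᵐᵒᵖ R) : Set R) ≤ leftAnn (I : Set R) ⊔ leftAnn (I' : Set R) := by
  intro a ha
  let f : (R ⧸ (I ⊓ I')) →ₗ[Rᵐᵒᵖ] (R ⧸ I) × (R ⧸ I') :=
    (I ⊓ I').liftQ (I.mkQ.prod I'.mkQ) (by simp [LinearMap.ker_prod])
  have hf : Function.Injective f := by
    rw [← LinearMap.ker_eq_bot]
    refine Submodule.ker_liftQ_eq_bot _ _ _ ?_
    simp [LinearMap.ker_prod]
  let g : (R ⧸ (I ⊓ I')) →ₗ[Rᵐᵒᵖ] R := (I ⊓ I').liftQ (leftMul a) (fun x hx => ha x hx)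
  obtain ⟨h, hh⟩ := Module.Injective.out f hf g
  let h1 : R →ₗ[Rᵐᵒᵖ] R := (h.comp (LinearMap.inl Rᵐᵒᵖ _ _)).comp I.mkQ
  let h2 : R →ₗ[Rᵐᵒᵖ] R := (h.comp (LinearMap.inr Rᵐᵒᵖ _ _)).comp I'.mkQ
  have key : a = h1 1 + h2 1 := by
    have e : h (f ((I ⊓ I').mkQ 1)) = g ((I ⊓ I').mkQ 1) := hh _
    have e1 : g ((I ⊓ I').mkQ 1) = a := mul_one a
    have e2 : f ((I ⊓ I').mkQ 1) = (I.mkQ 1, 0) + (0, I'.mkQ 1) := by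
      simp [f]
    rw [e1, e2, map_add] at e
    exact e.symm
  rw [key]
  refine Submodule.add_mem_sup (fun x hx => ?_) (fun x hx => ?_)
  · rw [← map_eq_map_one_mul]
    have : I.mkQ x = 0 := by simpa using hx
    simp only [h1, LinearMap.comp_apply, this, map_zero]
  · rw [← map_eq_map_one_mul]
    have : I'.mkQ x = 0 := by simpa using hx
    simp only [h2, LinearMap.comp_apply, this, map_zero]

/-- A functional on a cyclic right ideal extends to the ring. If all `s` with `x * s ∈ I` satisfy
`a * s = 0`, the functional `x * s ↦ a * s` on `(x R + I) / I` extends to `R / I`. -/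
theorem exists_mul_eq_of_forall (I : Submodule Rᵐᵒᵖ R) (x a : R)
    (h : ∀ s, x * s ∈ I → a * s = 0) : ∃ b ∈ leftAnn (I : Set R), b * x = a := by
  let K : Submodule Rᵐᵒᵖ R := I.comap (leftMul x)
  let f : (R ⧸ K) →ₗ[Rᵐᵒᵖ] R ⧸ I := K.mapQ I (leftMul x) le_rfl
  have hf : Function.Injective f := by
    rw [← LinearMap.ker_eq_bot]
    have : f = K.liftQ (I.mkQ.comp (leftMul x)) (by
      intro s hs; simpa [K] using hs) := rfl
    rw [this]
    refine Submodule.ker_liftQ_eq_bot _ _ _ ?_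
    intro s hs
    simpa [K] using hs
  let g : (R ⧸ K) →ₗ[Rᵐᵒᵖ] R := K.liftQ (leftMul a) (fun s hs => h s hs)
  obtain ⟨k, hk⟩ := Module.Injective.out f hf g
  let k1 : R →ₗ[Rᵐᵒᵖ] R := k.comp I.mkQ
  refine ⟨k1 1, fun y hy => ?_, ?_⟩
  · rw [← map_eq_map_one_mul]
    have : I.mkQ y = 0 := by simpa using hy
    simp only [k1, LinearMap.comp_apply, this, map_zero]
  · rw [← map_eq_map_one_mul]
    have e : k (f (K.mkQ 1)) = g (K.mkQ 1) := hk _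
    have e1 : g (K.mkQ 1) = a := mul_one a
    have e2 : f (K.mkQ 1) = I.mkQ x := by
      simp [f, leftMul_apply]
    rw [e1, e2] at e
    exact e

/-- Finitely generated left ideals are left annihilators. -/
theorem leftAnn_rightAnn_of_fg {L : Ideal R} (hL : L.FG) :
    leftAnn (rightAnn (L : Set R) : Set R) = L := by
  refine le_antisymm ?_ (le_leftAnn_rightAnn L)
  induction L, hL using Submodule.fg_induction with
  | singleton x =>
    intro a ha
    obtain ⟨b, -, hb⟩ := exists_mul_eq_of_forall ⊥ x a (fun s hs => ha s (by
      intro c hc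
      obtain ⟨d, rfl⟩ := Submodule.mem_span_singleton.1 hc
      rw [smul_eq_mul, mul_assoc, (Submodule.mem_bot _).1 hs, mul_zero]))
    exact hb ▸ Submodule.smul_mem _ b (Submodule.mem_span_singleton_self x)
  | sup L₁ L₂ _ _ h₁ h₂ =>
    intro a ha
    have : a ∈ leftAnn ((rightAnn (L₁ : Set R) ⊓ rightAnn (L₂ : Set R) :
        Submodule Rᵐᵒᵖ R) : Set R) := by
      intro x hx
      refine ha x fun c hc => ?_
      obtain ⟨c₁, h₁, c₂, h₂, rfl⟩ := Submodule.mem_sup.1 hc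
      rw [add_mul, hx.1 c₁ h₁, hx.2 c₂ h₂, add_zero]
    exact sup_le_sup h₁ h₂ (leftAnn_inf_le _ _ this)

theorem isNoetherianRing_left [IsArtinian Rᵐᵒᵖ R] : IsNoetherianRing R := by
  refine ⟨fun L => ?_⟩
  obtain ⟨_, ⟨F, hF, rfl⟩, hmin⟩ := IsArtinian.set_has_minimal
    {I : Submodule Rᵐᵒᵖ R | ∃ F : Finset R, (F : Set R) ⊆ L ∧ rightAnn (F : Set R) = I}
    ⟨_, ∅, by simp, rfl⟩
  classical
  refine ⟨F, le_antisymm (Submodule.span_le.2 hF) fun a ha => ?_⟩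
  rw [← leftAnn_rightAnn_of_fg (L := Submodule.span R (F : Set R)) ⟨F, rfl⟩]
  intro x hx
  have h := hmin _ ⟨insert a F, by simpa [Set.insert_subset_iff] using ⟨ha, hF⟩, rfl⟩
  have hle : rightAnn ((insert a F : Finset R) : Set R) ≤ rightAnn (F : Set R) :=
    fun y hy b hb => hy b (by simp at hb ⊢; exact Or.inr hb)
  have hx' : x ∈ rightAnn (F : Set R) := fun b hb => hx b (Submodule.subset_span hb)
  rw [← hle.eq_of_not_lt h] at hx'
  exact hx' a (by simp)

end SelfInjective

section QF

variable {R : Type u} [Ring R] [Module.Injective Rᵐᵒᵖ R] [IsArtinian Rᵐᵒᵖ R]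

/-- A ring and its opposite, as right modules. -/
def opEquiv (R : Type u) [Ring R] : R ≃ₗ[Rᵐᵒᵖ] Rᵐᵒᵖ where
  __ := opAddEquiv
  map_smul' r x := by
    simp only [AddEquiv.toEquiv_eq_coe, Equiv.toFun_as_coe, EquivLike.coe_coe, opAddEquiv_apply,
      RingHom.id_apply, smul_eq_mul]
    rw [← op_unop r, op_smul_eq_mul, op_mul]

omit [Module.Injective Rᵐᵒᵖ R] in
theorem isNoetherian_right : IsNoetherian Rᵐᵒᵖ R := by
  have : IsArtinianRing Rᵐᵒᵖ := isArtinian_of_linearEquiv (opEquiv R)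
  exact isNoetherian_of_linearEquiv (opEquiv R).symm

theorem leftAnn_rightAnn (L : Ideal R) : leftAnn (rightAnn (L : Set R) : Set R) = L :=
  leftAnn_rightAnn_of_fg (isNoetherianRing_left.noetherian L)

theorem isArtinianRing_left : IsArtinianRing R := by
  have := isNoetherian_right (R := R)
  have : StrictAnti fun L : Ideal R => rightAnn (L : Set R) := by
    refine Antitone.strictAnti_of_injective (fun L L' h x hx a ha => hx a (h ha)) ?_
    intro L L' h
    rw [← leftAnn_rightAnn L, ← leftAnn_rightAnn L']
    exact congrArg (fun I : Submodule Rᵐᵒᵖ R => leftAnn (I : Set R)) h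
  exact this.wellFoundedLT

end QF

end QuasiFrobenius

/-! ### Quasi-Frobenius rings are left self-injective cogenerators -/

namespace QuasiFrobenius

/-- A ring with semisimple quotient `R / J` has only finitely many two-sided ideals above the
Jacobson radical `J`. -/
theorem finite_twoSided_ge_jacobson (R : Type u) [Ring R] [IsSemiprimaryRing R] :
    Finite {K : Ideal R // K.IsTwoSided ∧ Ring.jacobson R ≤ K} := by
  let B := R ⧸ Ring.jacobson R
  have : IsSemisimpleRing B := IsSemiprimaryRing.isSemisimpleRing
  have hfin : Finite {I : Ideal B // I.IsTwoSided} := by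
    refine Finite.of_injective (fun I => OrderIso.setIsotypicComponents.symm
      (⟨I.1, isFullyInvariant_iff_isTwoSided.2 I.2⟩ : fullyInvariantSubmodule B B)) ?_
    intro I I' h
    have := OrderIso.setIsotypicComponents.symm.injective h
    exact Subtype.ext (Subtype.mk.inj this)
  have hs : Function.Surjective (Ideal.Quotient.mk (Ring.jacobson R)) :=
    Ideal.Quotient.mk_surjective
  refine Finite.of_injective (β := {I : Ideal B // I.IsTwoSided})
    (fun K => ⟨K.1.map (Ideal.Quotient.mk (Ring.jacobson R)), ⟨?_⟩⟩) ?_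
  · intro a b ha
    obtain ⟨b, rfl⟩ := hs b
    rw [Ideal.mem_map_iff_of_surjective _ hs] at ha ⊢
    obtain ⟨x, hx, rfl⟩ := ha
    have := K.2.1
    exact ⟨x * b, K.1.mul_mem_right b hx, map_mul _ _ _⟩
  · rintro ⟨K, hK, hJ⟩ ⟨K', hK', hJ'⟩ h
    have h' : K.map (Ideal.Quotient.mk (Ring.jacobson R)) =
      K'.map (Ideal.Quotient.mk (Ring.jacobson R)) := congrArg Subtype.val h
    have key : ∀ L : Ideal R, Ring.jacobson R ≤ L →
        (L.map (Ideal.Quotient.mk (Ring.jacobson R))).comap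
          (Ideal.Quotient.mk (Ring.jacobson R)) = L := by
      intro L hL
      ext y
      rw [Ideal.mem_comap, Ideal.mem_map_iff_of_surjective _ hs]
      refine ⟨?_, fun hy => ⟨y, hy, rfl⟩⟩
      rintro ⟨x, hx, hxy⟩
      have := hL (Ideal.Quotient.eq.1 hxy)
      simpa using L.sub_mem hx this
    refine Subtype.ext ?_
    change K = K'
    rw [← key K hJ, ← key K' hJ', h']

/-- In a right ideal of a ring with nilpotent Jacobson radical `J`, every nonzero element has a
nonzero multiple that is killed by `J` from the right. -/
theorem exists_mul_jacobson_eq_zero {R : Type u} [Ring R] [IsSemiprimaryRing R]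
    (I : Submodule Rᵐᵒᵖ R) (hI : I ≠ ⊥) :
    ∃ y ∈ I, y ≠ 0 ∧ ∀ j ∈ Ring.jacobson R, y * j = 0 := by
  obtain ⟨n, hn⟩ := IsSemiprimaryRing.isNilpotent (R := R)
  have key : ∀ n : ℕ, ∀ x ∈ I, x ≠ 0 → (∀ j ∈ Ring.jacobson R ^ n, x * j = 0) →
      ∃ y ∈ I, y ≠ 0 ∧ ∀ j ∈ Ring.jacobson R, y * j = 0 := by
    intro n
    induction n with
    | zero =>
      intro x _ hx0 h
      exact absurd (by simpa using h 1 (by rw [Submodule.pow_zero, Ideal.one_eq_top]; trivial)) hx0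
    | succ n ih =>
      intro x hx hx0 h
      by_cases hj : ∀ j ∈ Ring.jacobson R, x * j = 0
      · exact ⟨x, hx, hx0, hj⟩
      · push Not at hj
        obtain ⟨j, hj, hxj⟩ := hj
        refine ih (x * j) (mul_mem_right' I hx j) hxj fun k hk => ?_
        rw [mul_assoc]
        refine h _ ?_
        rw [Ideal.IsTwoSided.pow_succ]
        exact Ideal.mul_mem_mul hj hk
  obtain ⟨x, hx, hx0⟩ := I.exists_mem_ne_zero_of_ne_bot hI
  refine key n x hx hx0 fun j hj => ?_
  rw [hn] at hj
  rw [(Submodule.mem_bot R).1 hj, mul_zero]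

section QF

variable {R : Type u} [Ring R] [Module.Injective Rᵐᵒᵖ R] [IsArtinian Rᵐᵒᵖ R]

/-- The elements killed by the Jacobson radical from the right (the right socle) and by `K` from
the left. -/
def socleAnn (K : Ideal R) : Submodule Rᵐᵒᵖ R where
  carrier := {x | (∀ j ∈ Ring.jacobson R, x * j = 0) ∧ ∀ k ∈ K, k * x = 0}
  zero_mem' := by simp
  add_mem' := by
    rintro x y ⟨hx, hx'⟩ ⟨hy, hy'⟩
    exact ⟨fun j hj => by rw [add_mul, hx j hj, hy j hj, add_zero],
      fun j hj => by rw [mul_add, hx' j hj, hy' j hj, add_zero]⟩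
  smul_mem' := by
    rintro r x ⟨hx, hx'⟩
    rw [← op_unop r, op_smul_eq_mul]
    refine ⟨fun j hj => ?_, fun k hk => ?_⟩
    · rw [mul_assoc]
      exact hx _ (Ideal.mul_mem_left _ _ hj)
    · rw [← mul_assoc, hx' k hk, zero_mul]

omit [Module.Injective Rᵐᵒᵖ R] [IsArtinian Rᵐᵒᵖ R] in
theorem mem_socleAnn {K : Ideal R} {x : R} :
    x ∈ socleAnn K ↔ (∀ j ∈ Ring.jacobson R, x * j = 0) ∧ ∀ k ∈ K, k * x = 0 := Iff.rfl

/-- The left annihilator of the right socle is contained in the Jacobson radical, since the right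
socle meets every nonzero right ideal. -/
theorem leftAnn_socle_le :
    leftAnn (socleAnn (⊥ : Ideal R) : Set R) ≤ Ring.jacobson R := by
  have := isArtinianRing_left (R := R)
  have hunit : ∀ y ∈ leftAnn (socleAnn (⊥ : Ideal R) : Set R), Ideal.span {1 - y} = ⊤ := by
    intro y hy
    have h0 : rightAnn (Ideal.span {1 - y} : Set R) = ⊥ := by
      by_contra hne
      obtain ⟨z, hz, hz0, hzJ⟩ := exists_mul_jacobson_eq_zero _ hne
      have h1 := hz (1 - y) (Ideal.subset_span rfl)
      have h2 : y * z = 0 := hy z ⟨hzJ, fun k hk => by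
        rw [(Submodule.mem_bot R).1 hk, zero_mul]⟩
      rw [sub_mul, one_mul, h2, sub_zero] at h1
      exact hz0 h1
    rw [← leftAnn_rightAnn (Ideal.span {1 - y}), h0]
    refine eq_top_iff.2 fun a _ x hx => ?_
    rw [(Submodule.mem_bot _).1 hx, mul_zero]
  rw [Ring.jacobson_eq_sInf_isMaximal]
  refine le_sInf fun M hM x hx => ?_
  by_contra hxM
  have htop : M ⊔ Ideal.span {x} = ⊤ := (Ideal.isMaximal_def.1 hM).2 _ (left_lt_sup.2 fun h =>
    hxM (h (Ideal.subset_span rfl)))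
  obtain ⟨m, hm, c, hc, hmc⟩ := Submodule.mem_sup.1 (htop ▸ Submodule.mem_top (x := (1 : R)))
  obtain ⟨a, rfl⟩ := Submodule.mem_span_singleton.1 hc
  refine hM.ne_top (top_le_iff.1 ?_)
  rw [← hunit _ (Submodule.smul_mem _ a hx), Ideal.span_le, Set.singleton_subset_iff]
  rwa [← hmc, add_sub_cancel_right]

/-- `socleAnn K` is the intersection of the right socle with the right annihilator of `K`, so its
left annihilator is the sum of `K` and the left annihilator of the right socle. -/
theorem leftAnn_socleAnn (K : Ideal R) (hJ : Ring.jacobson R ≤ K) :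
    leftAnn (socleAnn K : Set R) = K := by
  refine le_antisymm ?_ fun k hk x hx => hx.2 k hk
  have h : socleAnn K = socleAnn (⊥ : Ideal R) ⊓ rightAnn (K : Set R) := by
    ext x
    simp only [mem_socleAnn, Submodule.mem_inf, mem_rightAnn, Submodule.mem_bot, SetLike.mem_coe]
    simp
  rw [h]
  refine (leftAnn_inf_le _ _).trans ?_
  rw [leftAnn_rightAnn]
  exact sup_le (leftAnn_socle_le.trans hJ) le_rfl

/-- The right annihilator of `socleAnn K`, as a left ideal. -/
def annSocleAnn (K : Ideal R) : Ideal R where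
  carrier := {y | ∀ x ∈ socleAnn K, x * y = 0}
  zero_mem' := by simp
  add_mem' := by
    intro y z hy hz x hx
    rw [mul_add, hy x hx, hz x hx, add_zero]
  smul_mem' := by
    intro r y hy x hx
    rw [smul_eq_mul, ← mul_assoc]
    exact hy _ (mul_mem_right' _ hx r)

/-- Every two-sided ideal above the Jacobson radical is of the form `annSocleAnn K`: passing from
`K` to the right annihilator of `socleAnn K` is injective on the finite set of these ideals, hence
surjective. -/
theorem exists_annSocleAnn_eq (Q : Ideal R) (hQ : Q.IsTwoSided) (hJ : Ring.jacobson R ≤ Q) :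
    ∃ K : Ideal R, annSocleAnn K = Q := by
  have := isArtinianRing_left (R := R)
  have := finite_twoSided_ge_jacobson R
  let τ : {K : Ideal R // K.IsTwoSided ∧ Ring.jacobson R ≤ K} →
      {K : Ideal R // K.IsTwoSided ∧ Ring.jacobson R ≤ K} := fun K =>
    ⟨annSocleAnn K.1, ⟨fun {a} b ha x hx => by rw [← mul_assoc, ha x hx, zero_mul]⟩,
      fun j hj x hx => hx.1 j hj⟩
  have hτ : Function.Injective τ := by
    rintro ⟨K, hK, hKJ⟩ ⟨K', hK', hKJ'⟩ h
    have h' : annSocleAnn K = annSocleAnn K' := congrArg Subtype.val h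
    have key : ∀ L : Ideal R, L.IsTwoSided →
        (socleAnn L : Set R) = {x | ∀ y ∈ annSocleAnn L, x * y = 0} := by
      intro L hL
      let W : Ideal R :=
        { carrier := socleAnn L
          zero_mem' := (socleAnn L).zero_mem
          add_mem' := (socleAnn L).add_mem
          smul_mem' := fun r x hx => ⟨fun j hj => by
            rw [smul_eq_mul, mul_assoc, hx.1 j hj, mul_zero], fun k hk => by
            rw [smul_eq_mul, ← mul_assoc]
            exact hx.2 _ (L.mul_mem_right r hk)⟩ }
      exact (congrArg (fun I : Ideal R => (I : Set R)) (leftAnn_rightAnn W)).symm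
    have hW : (socleAnn K : Set R) = socleAnn K' := by rw [key K hK, key K' hK', h']
    refine Subtype.ext ?_
    change K = K'
    rw [← leftAnn_socleAnn K hKJ, ← leftAnn_socleAnn K' hKJ', hW]
  obtain ⟨K, hK⟩ := Finite.injective_iff_surjective.1 hτ ⟨Q, hQ, hJ⟩
  exact ⟨K.1, congrArg Subtype.val hK⟩

/-- Every simple right module embeds into the ring: maximal right ideals have a nonzero left
annihilator. -/
theorem exists_leftAnn_ne_zero_of_isCoatom (M : Submodule Rᵐᵒᵖ R) (hM : IsCoatom M) :
    ∃ a ∈ leftAnn (M : Set R), a ≠ 0 := by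
  have := isArtinianRing_left (R := R)
  -- `Q` is the annihilator of the simple right module `R / M`.
  let Q : Ideal R :=
    { carrier := {y | ∀ r, r * y ∈ M}
      zero_mem' := by simp
      add_mem' := fun {a b} ha hb r => by rw [mul_add]; exact M.add_mem (ha r) (hb r)
      smul_mem' := fun s y hy r => by rw [smul_eq_mul, ← mul_assoc]; exact hy _ }
  have hQ : Q.IsTwoSided := ⟨fun {a} b ha r => by
    rw [← mul_assoc]; exact mul_mem_right' M (ha r) b⟩
  have hJM : ∀ j ∈ Ring.jacobson R, j ∈ M := by
    intro j hj
    by_contra hjM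
    have htop : M ⊔ Submodule.span Rᵐᵒᵖ {j} = ⊤ := hM.2 _ (left_lt_sup.2 fun h =>
      hjM (h (Submodule.subset_span rfl)))
    obtain ⟨m, hm, c, hc, hmc⟩ := Submodule.mem_sup.1 (htop ▸ Submodule.mem_top (x := (1 : R)))
    obtain ⟨s, rfl⟩ := Submodule.mem_span_singleton.1 hc
    rw [← op_unop s, op_smul_eq_mul] at hmc
    have hnil : IsNilpotent (j * unop s) := by
      obtain ⟨n, hn⟩ := IsSemiprimaryRing.isNilpotent (R := R)
      refine ⟨n, ?_⟩
      have := Ideal.pow_mem_pow (Ideal.mul_mem_right (unop s) _ hj) n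
      rw [hn] at this
      exact (Submodule.mem_bot R).1 this
    have hu : IsUnit m := by
      have := hnil.isUnit_one_sub
      rwa [← hmc, add_sub_cancel_right] at this
    obtain ⟨v, hv⟩ := hu.exists_right_inv
    refine hM.1 (eq_top_iff.2 fun x _ => ?_)
    have := mul_mem_right' M hm (v * x)
    rwa [← mul_assoc, hv, one_mul] at this
  have hJ : Ring.jacobson R ≤ Q := fun j hj r => hJM _ (Ideal.mul_mem_left _ r hj)
  obtain ⟨K, hK⟩ := exists_annSocleAnn_eq Q hQ hJ
  have h1 : (1 : R) ∉ Q := fun h => hM.1 (eq_top_iff.2 fun x _ => by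
    have := mul_mem_right' M (h 1) x
    simpa using this)
  obtain ⟨w, hw, hw0⟩ : ∃ w, (∀ y ∈ Q, w * y = 0) ∧ w ≠ 0 := by
    by_contra hcon
    push Not at hcon
    refine h1 ?_
    rw [← hK]
    intro x hx
    rw [mul_one]
    refine hcon x fun y hy => ?_
    rw [← hK] at hy
    exact hy x hx
  -- `Q` is the intersection of finitely many of the right ideals `{y | r * y ∈ M}`.
  let N : R → Submodule Rᵐᵒᵖ R := fun r => M.comap (leftMul r)
  obtain ⟨_, ⟨F, rfl⟩, hmin⟩ := IsArtinian.set_has_minimal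
    {I : Submodule Rᵐᵒᵖ R | ∃ F : Finset R, F.inf N = I} ⟨_, ∅, rfl⟩
  classical
  have hFQ : ∀ y ∈ F.inf N, y ∈ Q := by
    intro y hy r
    have h := hmin _ ⟨insert r F, rfl⟩
    rw [Finset.inf_insert] at h
    rw [← inf_le_right.eq_of_not_lt h] at hy
    exact hy.1
  have hfin : ∀ F : Finset R, (∃ a ∈ leftAnn ((F.inf N : Submodule Rᵐᵒᵖ R) : Set R), a ≠ 0) →
      ∃ r, ∃ a ∈ leftAnn (N r : Set R), a ≠ 0 := by
    intro F
    induction F using Finset.induction_on with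
    | empty =>
      rintro ⟨a, ha, ha0⟩
      exact absurd (by simpa using ha 1 (by simp)) ha0
    | insert r F _ ih =>
      rintro ⟨a, ha, ha0⟩
      rw [Finset.inf_insert] at ha
      obtain ⟨b, hb, c, hc, rfl⟩ := Submodule.mem_sup.1 (leftAnn_inf_le _ _ ha)
      by_cases hb0 : b = 0
      · exact ih ⟨c, hc, fun h => ha0 (by rw [hb0, h, add_zero])⟩
      · exact ⟨r, b, hb, hb0⟩
  obtain ⟨r, b, hb, hb0⟩ := hfin F ⟨w, fun y hy => hw y (hFQ y hy), hw0⟩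
  -- `R / {y | r * y ∈ M}` is isomorphic to `R / M`, by left multiplication with `r`.
  have hr : r ∉ M := fun h => hb0 (by
    simpa using hb 1 (show leftMul r 1 ∈ M by simpa [leftMul_apply] using h))
  have htop : M ⊔ Submodule.span Rᵐᵒᵖ {r} = ⊤ := hM.2 _ (left_lt_sup.2 fun h =>
    hr (h (Submodule.subset_span rfl)))
  obtain ⟨m, hm, c, hc, hmc⟩ := Submodule.mem_sup.1 (htop ▸ Submodule.mem_top (x := (1 : R)))
  obtain ⟨s, rfl⟩ := Submodule.mem_span_singleton.1 hc
  rw [← op_unop s, op_smul_eq_mul] at hmc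
  obtain ⟨s, rfl⟩ := op_surjective s
  rw [unop_op] at hmc
  have hm' : m = 1 - r * s := by rw [← hmc, add_sub_cancel_right]
  refine ⟨b * s, fun x hx => ?_, fun hbs => hb0 ?_⟩
  · rw [mul_assoc]
    refine hb _ ?_
    change r * (s * x) ∈ M
    have : r * (s * x) = x - m * x := by
      rw [hm', sub_mul, one_mul, sub_sub_cancel, mul_assoc]
    rw [this]
    exact M.sub_mem hx (mul_mem_right' M hm x)
  · have h2 : b * (1 - s * r) = 0 := hb _ (by
      change r * (1 - s * r) ∈ M
      have : r * (1 - s * r) = m * r := by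
        rw [hm', mul_sub, sub_mul, mul_one, one_mul, mul_assoc]
      rw [this]
      exact mul_mem_right' M hm r)
    rw [mul_sub, mul_one, ← mul_assoc, hbs, zero_mul, sub_zero] at h2
    exact h2

/-- Right ideals are right annihilators: an element outside of a right ideal is separated from it
by left multiplication with some element. -/
theorem exists_mul_ne_zero_of_notMem (I : Submodule Rᵐᵒᵖ R) {y : R} (hy : y ∉ I) :
    ∃ a ∈ leftAnn (I : Set R), a * y ≠ 0 := by
  have := isNoetherian_right (R := R)
  have hne : I.comap (leftMul y) ≠ ⊤ := fun h => hy (by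
    have : (1 : R) ∈ I.comap (leftMul y) := h ▸ Submodule.mem_top
    simpa [leftMul_apply] using this)
  obtain ⟨M, hM, hle⟩ := (eq_top_or_exists_le_coatom _).resolve_left hne
  obtain ⟨a, ha, ha0⟩ := exists_leftAnn_ne_zero_of_isCoatom M hM
  obtain ⟨b, hb, hba⟩ := exists_mul_eq_of_forall I y a (fun s hs => ha s (hle hs))
  exact ⟨b, hb, hba ▸ ha0⟩

theorem rightAnn_inf_le (L L' : Ideal R) :
    rightAnn ((L ⊓ L' : Ideal R) : Set R) ≤ rightAnn (L : Set R) ⊔ rightAnn (L' : Set R) := by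
  intro x hx
  by_contra hcon
  obtain ⟨a, ha, hax⟩ := exists_mul_ne_zero_of_notMem _ hcon
  refine hax (hx a ⟨?_, ?_⟩)
  · rw [SetLike.mem_coe, ← leftAnn_rightAnn L]
    exact fun y hy => ha y (Submodule.mem_sup_left hy)
  · rw [SetLike.mem_coe, ← leftAnn_rightAnn L']
    exact fun y hy => ha y (Submodule.mem_sup_right hy)

/-- Functionals on left ideals are right multiplications, by induction on the number of
generators (Ikeda and Nakayama). -/
theorem exists_eq_mul (L : Ideal R) (g : L →ₗ[R] R) : ∃ b, ∀ x : L, g x = x * b := by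
  have hL : L.FG := isNoetherianRing_left.noetherian L
  induction L, hL using Submodule.fg_induction with
  | singleton x =>
    let x' : Submodule.span R {x} := ⟨x, Submodule.mem_span_singleton_self x⟩
    have hmem : g x' ∈ Submodule.span Rᵐᵒᵖ {x} := by
      by_contra hcon
      obtain ⟨a, ha, hax⟩ := exists_mul_ne_zero_of_notMem _ hcon
      refine hax ?_
      have : a • x' = 0 := Subtype.ext (ha x (Submodule.mem_span_singleton_self x))
      rw [← smul_eq_mul, ← map_smul, this, map_zero]
    obtain ⟨b, hb⟩ := Submodule.mem_span_singleton.1 hmem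
    rw [← op_unop b, op_smul_eq_mul] at hb
    refine ⟨unop b, ?_⟩
    rintro ⟨c, hc⟩
    obtain ⟨d, rfl⟩ := Submodule.mem_span_singleton.1 hc
    have : (⟨d • x, hc⟩ : Submodule.span R {x}) = d • x' := rfl
    rw [this, map_smul, ← hb, smul_eq_mul, ← mul_assoc]
    rfl
  | sup L₁ L₂ _ _ h₁ h₂ =>
    obtain ⟨b₁, hb₁⟩ := h₁ (g.comp (Submodule.inclusion le_sup_left))
    obtain ⟨b₂, hb₂⟩ := h₂ (g.comp (Submodule.inclusion le_sup_right))
    have hb₁' : ∀ x (hx : x ∈ L₁), g ⟨x, Submodule.mem_sup_left hx⟩ = x * b₁ :=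
      fun x hx => hb₁ ⟨x, hx⟩
    have hb₂' : ∀ x (hx : x ∈ L₂), g ⟨x, Submodule.mem_sup_right hx⟩ = x * b₂ :=
      fun x hx => hb₂ ⟨x, hx⟩
    have hmem : b₁ - b₂ ∈ rightAnn ((L₁ ⊓ L₂ : Ideal R) : Set R) := by
      intro x hx
      rw [mul_sub, ← hb₁' x hx.1, ← hb₂' x hx.2, sub_self]
    obtain ⟨u, hu, v, hv, huv⟩ := Submodule.mem_sup.1 (rightAnn_inf_le _ _ hmem)
    refine ⟨b₁ - u, ?_⟩
    rintro ⟨x, hx⟩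
    obtain ⟨x₁, hx₁, x₂, hx₂, rfl⟩ := Submodule.mem_sup.1 hx
    have hsum : (⟨x₁ + x₂, hx⟩ : (L₁ ⊔ L₂ : Ideal R)) =
      ⟨x₁, Submodule.mem_sup_left hx₁⟩ + ⟨x₂, Submodule.mem_sup_right hx₂⟩ := rfl
    have h2 : b₁ - u = b₂ + v := by
      rw [sub_eq_iff_eq_add, add_assoc, add_comm v u, huv]
      abel
    rw [hsum, map_add, hb₁' x₁ hx₁, hb₂' x₂ hx₂]
    change _ = (x₁ + x₂) * _
    rw [add_mul]
    congr 1
    · rw [mul_sub, hu x₁ hx₁, sub_zero]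
    · rw [h2, mul_add, hv x₂ hx₂, add_zero]

theorem injective_left : Module.Injective R R := by
  refine Module.Baer.injective fun L g => ?_
  obtain ⟨b, hb⟩ := exists_eq_mul L g
  exact ⟨LinearMap.toSpanSingleton R R b, fun x hx => (hb ⟨x, hx⟩).symm⟩

/-- The ring cogenerates the left modules. -/
theorem exists_functional_ne_zero {M : Type u} [AddCommGroup M] [Module R M] {m : M}
    (hm : m ≠ 0) : ∃ f : M →ₗ[R] R, f m ≠ 0 := by
  let I : Ideal R := LinearMap.ker (LinearMap.toSpanSingleton R M m)
  obtain ⟨x, hx, hx0⟩ : ∃ x ∈ rightAnn (I : Set R), x ≠ 0 := by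
    by_contra hcon
    push Not at hcon
    have : (1 : R) ∈ I := by
      rw [← leftAnn_rightAnn I]
      intro x hx
      rw [hcon x hx, mul_zero]
    exact hm (by simpa [I] using this)
  have := injective_left (R := R)
  let f : (R ⧸ I) →ₗ[R] M := I.liftQ (LinearMap.toSpanSingleton R M m) le_rfl
  have hf : Function.Injective f := by
    rw [← LinearMap.ker_eq_bot]
    exact Submodule.ker_liftQ_eq_bot _ _ _ le_rfl
  let g : (R ⧸ I) →ₗ[R] R := I.liftQ (LinearMap.toSpanSingleton R R x) (fun a ha => hx a ha)
  obtain ⟨h, hh⟩ := Module.Injective.out f hf g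
  refine ⟨h, ?_⟩
  have e : h (f (I.mkQ 1)) = g (I.mkQ 1) := hh _
  have e1 : f (I.mkQ 1) = m := one_smul R m
  have e2 : g (I.mkQ 1) = x := one_smul R x
  rw [e1, e2] at e
  rwa [e]

/-- The evaluation of functionals at finitely many points. -/
def evalFin {M : Type u} [AddCommGroup M] [Module R M] {n : ℕ} (m : Fin n → M) :
    (M →ₗ[R] R) →ₗ[Rᵐᵒᵖ] (Fin n → R) where
  toFun f i := f (m i)
  map_add' _ _ := rfl
  map_smul' _ _ := rfl

omit [Module.Injective Rᵐᵒᵖ R] in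
theorem isNoetherian_dual (M : Type u) [AddCommGroup M] [Module R M] [Module.Finite R M] :
    IsNoetherian Rᵐᵒᵖ (M →ₗ[R] R) := by
  have := isNoetherian_right (R := R)
  obtain ⟨n, m, hm⟩ := Module.Finite.exists_fin (R := R) (M := M)
  refine isNoetherian_of_injective (evalFin m) fun f g h => ?_
  exact LinearMap.ext_on_range hm fun i => congrFun h i

/-- The double annihilator property: a right submodule of the dual of a finitely generated left
module that separates points from zero is everything. If `g₁, …, gₙ` generate it, they embed `M`
into `R ^ n`, and any functional on `M` extends to `R ^ n`. -/
theorem eq_top_of_separating {M : Type u} [AddCommGroup M] [Module R M] [Module.Finite R M]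
    (V : Submodule Rᵐᵒᵖ (M →ₗ[R] R)) (hV : ∀ m, (∀ f ∈ V, f m = 0) → m = 0) : V = ⊤ := by
  have := isNoetherian_dual (R := R) M
  obtain ⟨n, g, hg⟩ := Submodule.fg_iff_exists_fin_generating_family.1
    (IsNoetherian.noetherian V)
  have hgV : ∀ i, g i ∈ V := fun i => hg ▸ Submodule.subset_span ⟨i, rfl⟩
  let e : M →ₗ[R] (Fin n → R) := LinearMap.pi g
  have he : Function.Injective e := by
    rw [injective_iff_map_eq_zero]
    intro m hm
    refine hV m fun f hf => ?_
    rw [← hg] at hf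
    induction hf using Submodule.span_induction with
    | mem f hf =>
      obtain ⟨i, rfl⟩ := hf
      exact congrFun hm i
    | zero => rfl
    | add f f' _ _ h h' => rw [LinearMap.add_apply, h, h', add_zero]
    | smul r f _ h => rw [LinearMap.smul_apply, h, smul_zero]
  have := injective_left (R := R)
  refine eq_top_iff.2 fun f _ => ?_
  obtain ⟨h, hh⟩ := Module.Injective.out e he f
  have : f = ∑ i, op (h (Pi.single i 1)) • g i := by
    ext m
    rw [← hh m, LinearMap.pi_apply_eq_sum_univ h (e m), LinearMap.sum_apply]
    refine Finset.sum_congr rfl fun i _ => ?_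
    rw [LinearMap.smul_apply, op_smul_eq_mul, smul_eq_mul]
    congr 2
    ext j
    simp [Pi.single_apply, eq_comm]
  rw [this]
  exact V.sum_mem fun i _ => V.smul_mem _ (hgV i)

end QF

end QuasiFrobenius

/-! ### Tensor products with locally projective bimodules -/

namespace BTensor

section General

variable {R : Type u} [Ring R] {M : Type v} {N : Type w} [AddCommGroup M] [Module Rᵐᵒᵖ M]
  [AddCommGroup N] [Module R N]

theorem tmul_sum {ι : Type*} (s : Finset ι) (m : M) (n : ι → N) :
    tmul R m (∑ i ∈ s, n i) = ∑ i ∈ s, tmul R m (n i) :=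
  map_sum (mk R M N m) n s

theorem sum_tmul {ι : Type*} (s : Finset ι) (m : ι → M) (n : N) :
    tmul R (∑ i ∈ s, m i) n = ∑ i ∈ s, tmul R (m i) n :=
  map_sum ((mk R M N).flip n) m s

theorem exists_eq_sum (t : BTensor R M N) :
    ∃ (n : ℕ) (a : Fin n → M) (b : Fin n → N), t = ∑ i, tmul R (a i) (b i) := by
  induction t using BTensor.induction_on with
  | zero => exact ⟨0, Fin.elim0, Fin.elim0, by simp⟩
  | tmul m n => exact ⟨1, fun _ => m, fun _ => n, by simp⟩
  | add s t hs ht =>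
    obtain ⟨n, a, b, rfl⟩ := hs
    obtain ⟨n', a', b', rfl⟩ := ht
    exact ⟨n + n', Fin.append a a', Fin.append b b', by simp [Fin.sum_univ_add]⟩

theorem map_map {M' M'' N' N'' : Type*} [AddCommGroup M'] [Module Rᵐᵒᵖ M'] [AddCommGroup M'']
    [Module Rᵐᵒᵖ M''] [AddCommGroup N'] [Module R N'] [AddCommGroup N''] [Module R N'']
    (f : M →ₗ[Rᵐᵒᵖ] M') (f' : M' →ₗ[Rᵐᵒᵖ] M'') (g : N →ₗ[R] N') (g' : N' →ₗ[R] N'')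
    (t : BTensor R M N) : map f' g' (map f g t) = map (f' ∘ₗ f) (g' ∘ₗ g) t := by
  induction t using BTensor.induction_on with
  | zero => simp
  | tmul m n => rfl
  | add s t hs ht => simp [hs, ht]

theorem map_id_id (t : BTensor R M N) :
    map (LinearMap.id : M →ₗ[Rᵐᵒᵖ] M) (LinearMap.id : N →ₗ[R] N) t = t := by
  induction t using BTensor.induction_on with
  | zero => simp
  | tmul m n => rfl
  | add s t hs ht => simp [hs, ht]

theorem map_zero_right {N' : Type*} [AddCommGroup N'] [Module R N'] (t : BTensor R M N) :
    map (LinearMap.id : M →ₗ[Rᵐᵒᵖ] M) (0 : N →ₗ[R] N') t = 0 := by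
  induction t using BTensor.induction_on with
  | zero => simp
  | tmul m n => simp [tmul_zero]
  | add s t hs ht => simp [hs, ht]

theorem contractLeft_map {N' : Type*} [AddCommGroup N'] [Module R N'] (φ : M →ₗ[Rᵐᵒᵖ] R)
    (g : N →ₗ[R] N') (t : BTensor R M N) :
    contractLeft N' φ (map LinearMap.id g t) = g (contractLeft N φ t) := by
  induction t using BTensor.induction_on with
  | zero => simp
  | tmul m n => simp
  | add s t hs ht => simp [hs, ht]

theorem contractRight_map {M' : Type*} [AddCommGroup M'] [Module Rᵐᵒᵖ M'] (f : N →ₗ[R] R)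
    (g : M →ₗ[Rᵐᵒᵖ] M') (t : BTensor R M N) :
    contractRight M' f (map g LinearMap.id t) = g (contractRight M f t) := by
  induction t using BTensor.induction_on with
  | zero => simp
  | tmul m n => simp
  | add s t hs ht => simp [hs, ht]

theorem contractRight_map_right {N' : Type*} [AddCommGroup N'] [Module R N'] (f : N' →ₗ[R] R)
    (g : N →ₗ[R] N') (t : BTensor R M N) :
    contractRight M f (map LinearMap.id g t) = contractRight M (f ∘ₗ g) t := by
  induction t using BTensor.induction_on with
  | zero => simp
  | tmul m n => simp
  | add s t hs ht => simp [hs, ht]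

theorem contractRight_op_smul (f : N →ₗ[R] R) (r : R) (t : BTensor R M N) :
    contractRight M (op r • f) t = op r • contractRight M f t := by
  induction t using BTensor.induction_on with
  | zero => simp
  | tmul m n =>
    rw [contractRight_tmul, contractRight_tmul, LinearMap.smul_apply, smul_smul, op_smul_eq_mul,
      op_mul]
  | add s t hs ht => simp [hs, ht]

/-- The functional `f` contracts the two sides of a tensor in `M ⊗_R N` compatibly. -/
theorem apply_contractLeft (φ : M →ₗ[Rᵐᵒᵖ] R) (f : N →ₗ[R] R) (t : BTensor R M N) :
    f (contractLeft N φ t) = φ (contractRight M f t) := by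
  induction t using BTensor.induction_on with
  | zero => simp
  | tmul m n =>
    rw [contractLeft_tmul, contractRight_tmul, map_smul, map_smul, op_smul_eq_mul, smul_eq_mul]
  | add s t hs ht => simp [hs, ht]

theorem contractLeft_op_smul [Module R M] [SMulCommClass R Rᵐᵒᵖ M]
    [Module Rᵐᵒᵖ N] [SMulCommClass R Rᵐᵒᵖ N] (φ : M →ₗ[Rᵐᵒᵖ] R) (r : Rᵐᵒᵖ) (t : BTensor R M N) :
    contractLeft N φ (r • t) = r • contractLeft N φ t := by
  induction t using BTensor.induction_on with
  | zero => simp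
  | tmul m n => simp [smul_comm (φ m) r n]
  | add s t hs ht => simp [hs, ht]

end General

section Bimodule

variable {R : Type u} [Ring R] {C : Type v} [AddCommGroup C] [Module R C] [Module Rᵐᵒᵖ C]
  [SMulCommClass R Rᵐᵒᵖ C] {M : Type w} [AddCommGroup M] [Module Rᵐᵒᵖ M]
  {N : Type x} {N' : Type y} [AddCommGroup N] [Module R N] [AddCommGroup N'] [Module R N']

/-- `C ⊗ g` as a left linear map, for a bimodule `C`. -/
def mapLinear (C : Type v) [AddCommGroup C] [Module R C] [Module Rᵐᵒᵖ C]
    [SMulCommClass R Rᵐᵒᵖ C] (g : N →ₗ[R] N') : BTensor R C N →ₗ[R] BTensor R C N' where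
  toFun := map LinearMap.id g
  map_add' := map_add _
  map_smul' r t := by
    induction t using BTensor.induction_on with
    | zero => simp
    | tmul m n => simp
    | add s t hs ht =>
      rw [smul_add, map_add, hs, ht, map_add, smul_add]

theorem mapLinear_apply (g : N →ₗ[R] N') (t : BTensor R C N) :
    mapLinear C g t = map LinearMap.id g t := rfl

/-- `c ⊗ n ↦ c · f n` as a left linear map, for a bimodule `C`. -/
def contractRightLinear (C : Type v) [AddCommGroup C] [Module R C] [Module Rᵐᵒᵖ C]
    [SMulCommClass R Rᵐᵒᵖ C] (f : N →ₗ[R] R) : BTensor R C N →ₗ[R] C where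
  toFun := contractRight C f
  map_add' := map_add _
  map_smul' r t := contractRight_smul f r t

theorem contractLeft_smul (φ : C →ₗ[Rᵐᵒᵖ] R) (r : R) (t : BTensor R C N) :
    contractLeft N φ (r • t) =
      contractLeft N (φ ∘ₗ DistribSMul.toLinearMap Rᵐᵒᵖ C r) t := by
  induction t using BTensor.induction_on with
  | zero => simp
  | tmul m n => simp
  | add s t hs ht => simp [hs, ht]

/-- The insertion `c ↦ c ⊗ n`. -/
def insertRight (C : Type v) [AddCommGroup C] [Module R C] [Module Rᵐᵒᵖ C]
    [SMulCommClass R Rᵐᵒᵖ C] (n : N) : C →ₗ[R] BTensor R C N where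
  toFun c := tmul R c n
  map_add' c c' := add_tmul c c' n
  map_smul' _ _ := rfl

omit [Module Rᵐᵒᵖ C] [SMulCommClass R Rᵐᵒᵖ C] in
/-- The tensors in `M ⊗_R C` expand in any dual basis of finitely many elements of `C`. -/
theorem exists_finset_expansion_right (t : BTensor R M C) :
    ∃ s : Finset C, ∀ (n : ℕ) (h : Fin n → C →ₗ[R] R) (e : Fin n → C),
      (∀ c ∈ s, c = ∑ i, h i c • e i) → t = ∑ i, tmul R (contractRight M (h i) t) (e i) := by
  classical
  induction t using BTensor.induction_on with
  | zero => exact ⟨∅, fun n h e _ => by simp [zero_tmul]⟩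
  | tmul m c =>
    refine ⟨{c}, fun n h e hc => ?_⟩
    conv_lhs => rw [hc c (by simp), tmul_sum]
    simp [smul_tmul]
  | add a b ha hb =>
    obtain ⟨s, hs⟩ := ha
    obtain ⟨s', hs'⟩ := hb
    refine ⟨s ∪ s', fun n h e hc => ?_⟩
    conv_lhs => rw [hs n h e fun c hc' => hc c (Finset.mem_union_left _ hc'),
      hs' n h e fun c hc' => hc c (Finset.mem_union_right _ hc')]
    simp [add_tmul, Finset.sum_add_distrib]

omit [Module Rᵐᵒᵖ C] [SMulCommClass R Rᵐᵒᵖ C] in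
theorem exists_expansion_right (hl : IsLocallyProjective R C) (t : BTensor R M C) :
    ∃ (n : ℕ) (h : Fin n → C →ₗ[R] R) (e : Fin n → C),
      t = ∑ i, tmul R (contractRight M (h i) t) (e i) := by
  obtain ⟨s, hs⟩ := exists_finset_expansion_right t
  obtain ⟨n, h, e, hc⟩ := hl s
  exact ⟨n, h, e, hs n h e hc⟩

omit [Module Rᵐᵒᵖ C] [SMulCommClass R Rᵐᵒᵖ C] in
/-- The tensors in `M ⊗_R C` are determined by their contractions with functionals on `C`. -/
theorem ext_contractRight (hl : IsLocallyProjective R C) {t t' : BTensor R M C}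
    (h : ∀ f : C →ₗ[R] R, contractRight M f t = contractRight M f t') : t = t' := by
  rw [← sub_eq_zero]
  obtain ⟨n, f, e, hs⟩ := exists_expansion_right hl (t - t')
  rw [hs]
  refine Finset.sum_eq_zero fun i _ => ?_
  rw [map_sub, h, sub_self, zero_tmul]

omit [Module Rᵐᵒᵖ C] [SMulCommClass R Rᵐᵒᵖ C] in
theorem mem_range_map_of_contractRight (hl : IsLocallyProjective R C) (V : Submodule Rᵐᵒᵖ M)
    {t : BTensor R M C} (h : ∀ f : C →ₗ[R] R, contractRight M f t ∈ V) :
    t ∈ (map V.subtype (LinearMap.id : C →ₗ[R] C)).range := by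
  obtain ⟨n, f, e, hs⟩ := exists_expansion_right hl t
  refine ⟨∑ i, tmul R (⟨contractRight M (f i) t, h (f i)⟩ : V) (e i), ?_⟩
  exact (map_sum _ _ _).trans hs.symm

/-- The tensors in `M ⊗_R (C ⊗_R C)` are determined by their contractions with functionals on the
last factor. -/
theorem ext_contractRight_last (hl : IsLocallyProjective R C)
    {t t' : BTensor R M (BTensor R C C)}
    (h : ∀ f : C →ₗ[R] R, map (LinearMap.id : M →ₗ[Rᵐᵒᵖ] M) (contractRightLinear C f) t =
      map LinearMap.id (contractRightLinear C f) t') : t = t' := by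
  classical
  have key : ∀ t : BTensor R M (BTensor R C C), ∃ s : Finset C,
      ∀ (n : ℕ) (h : Fin n → C →ₗ[R] R) (e : Fin n → C), (∀ c ∈ s, c = ∑ i, h i c • e i) →
        t = ∑ i, map (LinearMap.id : M →ₗ[Rᵐᵒᵖ] M) (insertRight C (e i))
          (map (LinearMap.id : M →ₗ[Rᵐᵒᵖ] M) (contractRightLinear C (h i)) t) := by
    intro t
    induction t using BTensor.induction_on with
    | zero => exact ⟨∅, fun n h e _ => by simp⟩
    | tmul m d =>
      obtain ⟨s, hs⟩ := exists_finset_expansion_right d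
      refine ⟨s, fun n h e hc => ?_⟩
      conv_lhs => rw [hs n h e hc, tmul_sum]
      rfl
    | add a b ha hb =>
      obtain ⟨s, hs⟩ := ha
      obtain ⟨s', hs'⟩ := hb
      refine ⟨s ∪ s', fun n h e hc => ?_⟩
      conv_lhs => rw [hs n h e fun c hc' => hc c (Finset.mem_union_left _ hc'),
        hs' n h e fun c hc' => hc c (Finset.mem_union_right _ hc')]
      simp [Finset.sum_add_distrib]
  rw [← sub_eq_zero]
  obtain ⟨s, hs⟩ := key (t - t')
  obtain ⟨n, f, e, hc⟩ := hl s
  rw [hs n f e hc]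
  refine Finset.sum_eq_zero fun i _ => ?_
  rw [map_sub (map LinearMap.id (contractRightLinear C (f i))), h, sub_self, map_zero]

omit [Module R C] [SMulCommClass R Rᵐᵒᵖ C] in
theorem exists_expansion_left (hr : IsLocallyProjective Rᵐᵒᵖ C) (t : BTensor R C N) :
    ∃ (n : ℕ) (φ : Fin n → C →ₗ[Rᵐᵒᵖ] R) (d : Fin n → C),
      t = ∑ i, tmul R (d i) (contractLeft N (φ i) t) := by
  classical
  have key : ∃ s : Finset C, ∀ (n : ℕ) (φ : Fin n → C →ₗ[Rᵐᵒᵖ] R) (d : Fin n → C),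
      (∀ c ∈ s, c = ∑ i, op (φ i c) • d i) →
        t = ∑ i, tmul R (d i) (contractLeft N (φ i) t) := by
    induction t using BTensor.induction_on with
    | zero => exact ⟨∅, fun n φ d _ => by simp [tmul_zero]⟩
    | tmul c m =>
      refine ⟨{c}, fun n φ d hc => ?_⟩
      conv_lhs => rw [hc c (by simp), sum_tmul]
      simp [smul_tmul]
    | add a b ha hb =>
      obtain ⟨s, hs⟩ := ha
      obtain ⟨s', hs'⟩ := hb
      refine ⟨s ∪ s', fun n φ d hc => ?_⟩
      conv_lhs => rw [hs n φ d fun c hc' => hc c (Finset.mem_union_left _ hc'),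
        hs' n φ d fun c hc' => hc c (Finset.mem_union_right _ hc')]
      simp [tmul_add, Finset.sum_add_distrib]
  obtain ⟨s, hs⟩ := key
  obtain ⟨n, f, d, hc⟩ := hr s
  exact ⟨n, fun i => (QuasiFrobenius.opEquiv R).symm.toLinearMap ∘ₗ f i, d, hs n _ d hc⟩

omit [Module R C] [SMulCommClass R Rᵐᵒᵖ C] in
/-- The tensors in `C ⊗_R N` are determined by their contractions with functionals on `C`. -/
theorem ext_contractLeft (hr : IsLocallyProjective Rᵐᵒᵖ C) {t t' : BTensor R C N}
    (h : ∀ φ : C →ₗ[Rᵐᵒᵖ] R, contractLeft N φ t = contractLeft N φ t') : t = t' := by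
  rw [← sub_eq_zero]
  obtain ⟨n, f, e, hs⟩ := exists_expansion_left hr (t - t')
  rw [hs]
  refine Finset.sum_eq_zero fun i _ => ?_
  rw [map_sub, h, sub_self, tmul_zero]

omit [Module R C] [SMulCommClass R Rᵐᵒᵖ C] in
theorem mem_range_map_of_contractLeft (hr : IsLocallyProjective Rᵐᵒᵖ C) (V : Submodule R N)
    {t : BTensor R C N} (h : ∀ φ : C →ₗ[Rᵐᵒᵖ] R, contractLeft N φ t ∈ V) :
    t ∈ (map (LinearMap.id : C →ₗ[Rᵐᵒᵖ] C) V.subtype).range := by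
  obtain ⟨n, f, e, hs⟩ := exists_expansion_left hr t
  refine ⟨∑ i, tmul R (e i) (⟨contractLeft N (f i) t, h (f i)⟩ : V), ?_⟩
  exact (map_sum _ _ _).trans hs.symm

/-- A locally projective right module is flat. -/
theorem mapLinear_injective (hr : IsLocallyProjective Rᵐᵒᵖ C) {g : N →ₗ[R] N'}
    (hg : Function.Injective g) : Function.Injective (mapLinear C g) := by
  intro t t' h
  refine ext_contractLeft hr fun φ => hg ?_
  rw [← contractLeft_map, ← contractLeft_map, ← mapLinear_apply, ← mapLinear_apply, h]

end Bimodule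

end BTensor

/-! ### Left comodules -/

namespace Coring

variable {R C : Type u} [Ring R] [AddCommGroup C] [Module R C] [Module Rᵐᵒᵖ C]
  [SMulCommClass R Rᵐᵒᵖ C] [Coring R C]

/-- The product of the right dual of a coring: `c ↦ φ (ψ c₍₁₎ · c₍₂₎)`. -/
def rightConv (φ ψ : C →ₗ[Rᵐᵒᵖ] R) : C →ₗ[Rᵐᵒᵖ] R where
  toFun c := φ (BTensor.contractLeft C ψ (Coring.comulR (R := R) c))
  map_add' c c' := by simp
  map_smul' r c := by
    rw [map_smul, BTensor.contractLeft_op_smul, map_smul, RingHom.id_apply]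

theorem rightConv_apply (φ ψ : C →ₗ[Rᵐᵒᵖ] R) (c : C) :
    rightConv φ ψ c = φ (BTensor.contractLeft C ψ (Coring.comul (R := R) c)) := by
  rw [← Coring.comulR_apply]
  rfl

end Coring

namespace LeftComodule

variable {R C : Type u} [Ring R] [AddCommGroup C] [Module R C] [Module Rᵐᵒᵖ C]
  [SMulCommClass R Rᵐᵒᵖ C] [Coring R C]

/-- The action `m ↦ φ m₍₋₁₎ · m₍₀₎` of the right dual of the coring on a left comodule. -/
def act (M : LeftComodule R C) (φ : C →ₗ[Rᵐᵒᵖ] R) : M →+ M :=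
  (BTensor.contractLeft M φ).comp M.coact.toAddMonoidHom

theorem act_apply (M : LeftComodule R C) (φ : C →ₗ[Rᵐᵒᵖ] R) (m : M) :
    M.act φ m = BTensor.contractLeft M φ (M.coact m) := rfl

theorem act_counit (M : LeftComodule R C) (m : M) : M.act Coring.counitR m = m := M.counit m

theorem act_act (M : LeftComodule R C) (φ ψ : C →ₗ[Rᵐᵒᵖ] R) (m : M) :
    M.act φ (M.act ψ m) = M.act (Coring.rightConv φ ψ) m := by
  have h := congrArg (fun t => BTensor.contractLeft M φ
    (BTensor.contractLeft (BTensor R C M) ψ t)) (M.coassoc m)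
  simp only [BTensor.contractLeft_map] at h
  simp only [act_apply]
  rw [← h]
  induction M.coact m using BTensor.induction_on with
  | zero => simp
  | tmul c m =>
    rw [BTensor.map_tmul, Coring.comulR_apply, BTensor.contractLeft_tmul, Coring.rightConv_apply,
      LinearMap.id_apply]
    induction Coring.comul (R := R) c using BTensor.induction_on with
    | zero => simp [BTensor.zero_tmul]
    | tmul a b => simp
    | add s t hs ht => simp [BTensor.add_tmul, hs, ht, add_smul]
  | add s t hs ht => simp [hs, ht]

theorem act_smul (M : LeftComodule R C) (φ : C →ₗ[Rᵐᵒᵖ] R) (r : R) (m : M) :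
    M.act φ (r • m) = M.act (φ ∘ₗ DistribSMul.toLinearMap Rᵐᵒᵖ C r) m := by
  rw [act_apply, map_smul, BTensor.contractLeft_smul, act_apply]

/-- Subcomodules are the submodules that are stable under the right dual of the coring. -/
theorem isSubcomodule_iff (hr : IsLocallyProjective Rᵐᵒᵖ C) {M : LeftComodule R C}
    {N : Submodule R M} : M.IsSubcomodule N ↔ ∀ φ, ∀ n ∈ N, M.act φ n ∈ N := by
  refine ⟨fun h φ n hn => ?_, fun h n hn =>
    BTensor.mem_range_map_of_contractLeft hr N fun φ => h φ n hn⟩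
  obtain ⟨t, ht⟩ := h n hn
  rw [act_apply, ← ht, BTensor.contractLeft_map]
  exact (BTensor.contractLeft N φ t).2

theorem IsColinear.act {M N : LeftComodule R C} {f : M →ₗ[R] N} (hf : IsColinear f)
    (φ : C →ₗ[Rᵐᵒᵖ] R) (m : M) : f (M.act φ m) = N.act φ (f m) := by
  rw [act_apply, act_apply, hf, BTensor.contractLeft_map]

theorem isColinear_of_act (hr : IsLocallyProjective Rᵐᵒᵖ C) {M N : LeftComodule R C}
    {f : M →ₗ[R] N} (hf : ∀ φ m, f (M.act φ m) = N.act φ (f m)) : IsColinear f := by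
  intro m
  refine BTensor.ext_contractLeft hr fun φ => ?_
  rw [BTensor.contractLeft_map]
  exact (hf φ m).symm

theorem isColinear_id (M : LeftComodule R C) : IsColinear (LinearMap.id : M →ₗ[R] M) :=
  fun _ => (BTensor.map_id_id _).symm

theorem IsColinear.comp {L M N : LeftComodule R C} {f : L →ₗ[R] M} {g : M →ₗ[R] N}
    (hg : IsColinear g) (hf : IsColinear f) : IsColinear (g ∘ₗ f) := by
  intro m
  rw [LinearMap.comp_apply, hg, hf, BTensor.map_map]
  rfl

section Lattice

variable {M N : LeftComodule R C}

theorem isSubcomodule_top (hr : IsLocallyProjective Rᵐᵒᵖ C) : M.IsSubcomodule ⊤ :=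
  (isSubcomodule_iff hr).2 fun _ _ _ => trivial

theorem isSubcomodule_bot (hr : IsLocallyProjective Rᵐᵒᵖ C) : M.IsSubcomodule ⊥ :=
  (isSubcomodule_iff hr).2 fun φ n hn => by
    rw [(Submodule.mem_bot R).1 hn, map_zero]
    exact zero_mem _

theorem IsSubcomodule.inf (hr : IsLocallyProjective Rᵐᵒᵖ C) {K L : Submodule R M}
    (hK : M.IsSubcomodule K) (hL : M.IsSubcomodule L) : M.IsSubcomodule (K ⊓ L) :=
  (isSubcomodule_iff hr).2 fun φ n hn =>
    ⟨(isSubcomodule_iff hr).1 hK φ n hn.1, (isSubcomodule_iff hr).1 hL φ n hn.2⟩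

theorem IsSubcomodule.sup (hr : IsLocallyProjective Rᵐᵒᵖ C) {K L : Submodule R M}
    (hK : M.IsSubcomodule K) (hL : M.IsSubcomodule L) : M.IsSubcomodule (K ⊔ L) := by
  refine (isSubcomodule_iff hr).2 fun φ n hn => ?_
  obtain ⟨k, hk, l, hl, rfl⟩ := Submodule.mem_sup.1 hn
  rw [map_add]
  exact Submodule.add_mem_sup ((isSubcomodule_iff hr).1 hK φ k hk)
    ((isSubcomodule_iff hr).1 hL φ l hl)

theorem isSubcomodule_sSup_of_isChain (hr : IsLocallyProjective Rᵐᵒᵖ C)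
    {S : Set (Submodule R M)} (hne : S.Nonempty) (hS : IsChain (· ≤ ·) S)
    (h : ∀ K ∈ S, M.IsSubcomodule K) : M.IsSubcomodule (sSup S) := by
  refine (isSubcomodule_iff hr).2 fun φ n hn => ?_
  obtain ⟨K, hK, hnK⟩ := (Submodule.mem_sSup_of_directed hne hS.directedOn).1 hn
  exact le_sSup hK ((isSubcomodule_iff hr).1 (h K hK) φ n hnK)

theorem IsColinear.isSubcomodule_map (hr : IsLocallyProjective Rᵐᵒᵖ C) {f : M →ₗ[R] N}
    (hf : IsColinear f) {K : Submodule R M} (hK : M.IsSubcomodule K) :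
    N.IsSubcomodule (K.map f) := by
  refine (isSubcomodule_iff hr).2 ?_
  rintro φ _ ⟨k, hk, rfl⟩
  exact ⟨_, (isSubcomodule_iff hr).1 hK φ k hk, hf.act φ k⟩

theorem IsColinear.isSubcomodule_comap (hr : IsLocallyProjective Rᵐᵒᵖ C) {f : M →ₗ[R] N}
    (hf : IsColinear f) {K : Submodule R N} (hK : N.IsSubcomodule K) :
    M.IsSubcomodule (K.comap f) := by
  refine (isSubcomodule_iff hr).2 fun φ m hm => ?_
  rw [Submodule.mem_comap, hf.act]
  exact (isSubcomodule_iff hr).1 hK φ _ hm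

theorem IsColinear.isSubcomodule_ker (hr : IsLocallyProjective Rᵐᵒᵖ C) {f : M →ₗ[R] N}
    (hf : IsColinear f) : M.IsSubcomodule (LinearMap.ker f) :=
  hf.isSubcomodule_comap hr (isSubcomodule_bot hr)

theorem IsColinear.isSubcomodule_range (hr : IsLocallyProjective Rᵐᵒᵖ C) {f : M →ₗ[R] N}
    (hf : IsColinear f) : N.IsSubcomodule (LinearMap.range f) := by
  rw [← Submodule.map_top]
  exact hf.isSubcomodule_map hr (isSubcomodule_top hr)

end Lattice

section Constructions

/-- A subcomodule as a comodule. Its coaction is the restricted one, which takes values in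
`C ⊗_R N ⊆ C ⊗_R M` by flatness of `C`. -/
noncomputable def sub (hr : IsLocallyProjective Rᵐᵒᵖ C) (M : LeftComodule R C)
    (N : Submodule R M) (hN : M.IsSubcomodule N) : LeftComodule R C :=
  let ι := BTensor.mapLinear C N.subtype
  have hι : Function.Injective ι := BTensor.mapLinear_injective hr N.injective_subtype
  let ρ : N →ₗ[R] BTensor R C N := (LinearEquiv.ofInjective ι hι).symm.toLinearMap ∘ₗ
    (M.coact ∘ₗ N.subtype).codRestrict (LinearMap.range ι) (fun n => hN n n.2)
  have hρ : ∀ n : N, BTensor.map LinearMap.id N.subtype (ρ n) = M.coact n := fun n =>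
    congrArg Subtype.val ((LinearEquiv.ofInjective ι hι).apply_symm_apply
      ((M.coact ∘ₗ N.subtype).codRestrict (LinearMap.range ι) (fun n => hN n n.2) n))
  { carrier := N
    coact := ρ
    coassoc := fun n => by
      refine BTensor.mapLinear_injective hr hι ?_
      have h1 : ∀ t : BTensor R (BTensor R C C) N,
          BTensor.mapLinear C ι (BTensor.assoc R C C N t) =
            BTensor.assoc R C C M (BTensor.map LinearMap.id N.subtype t) := by
        intro t
        induction t using BTensor.induction_on with
        | zero => simp
        | tmul s n =>
          induction s using BTensor.induction_on with
          | zero => simp [BTensor.zero_tmul]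
          | tmul a b => rfl
          | add s t hs ht => simp only [BTensor.add_tmul, map_add, hs, ht]
        | add s t hs ht => simp only [map_add, hs, ht]
      have h2 : ι ∘ₗ ρ = M.coact ∘ₗ N.subtype := LinearMap.ext hρ
      rw [h1, BTensor.mapLinear_apply, BTensor.map_map, BTensor.map_map, h2]
      have h3 := M.coassoc n
      rw [← hρ, BTensor.map_map, BTensor.map_map] at h3
      exact h3
    counit := fun n => Subtype.ext <| by
      have := M.counit n
      rw [← hρ, BTensor.contractLeft_map] at this
      exact this }

theorem isColinear_subtype (hr : IsLocallyProjective Rᵐᵒᵖ C) (M : LeftComodule R C)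
    (N : Submodule R M) (hN : M.IsSubcomodule N) :
    IsColinear (M := M.sub hr N hN) (N := M) N.subtype := by
  intro n
  have hι : Function.Injective (BTensor.mapLinear C N.subtype) :=
    BTensor.mapLinear_injective hr N.injective_subtype
  exact (congrArg Subtype.val ((LinearEquiv.ofInjective _ hι).apply_symm_apply
      ((M.coact ∘ₗ N.subtype).codRestrict
        (LinearMap.range (BTensor.mapLinear C N.subtype)) (fun n => hN n n.2) n))).symm

/-- The quotient of a comodule by a subcomodule. -/
def quot (M : LeftComodule R C) (N : Submodule R M) (hN : M.IsSubcomodule N) :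
    LeftComodule R C :=
  let ρ : (M ⧸ N) →ₗ[R] BTensor R C (M ⧸ N) :=
    N.liftQ (BTensor.mapLinear C N.mkQ ∘ₗ M.coact) (fun n hn => by
      obtain ⟨t, ht⟩ := hN n hn
      have h0 : N.mkQ ∘ₗ N.subtype = 0 := by ext; simp
      rw [LinearMap.mem_ker, LinearMap.comp_apply, ← ht, BTensor.mapLinear_apply,
        BTensor.map_map, h0]
      exact BTensor.map_zero_right t)
  have hρ : ∀ m, ρ (N.mkQ m) = BTensor.map LinearMap.id N.mkQ (M.coact m) := fun _ => rfl
  { carrier := M ⧸ N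
    coact := ρ
    coassoc := fun n => by
      obtain ⟨m, rfl⟩ := N.mkQ_surjective n
      have h1 : ∀ t : BTensor R (BTensor R C C) M,
          BTensor.mapLinear C (BTensor.mapLinear C N.mkQ) (BTensor.assoc R C C M t) =
            BTensor.assoc R C C _ (BTensor.map LinearMap.id N.mkQ t) := by
        intro t
        induction t using BTensor.induction_on with
        | zero => simp
        | tmul s n =>
          induction s using BTensor.induction_on with
          | zero => simp [BTensor.zero_tmul]
          | tmul a b => rfl
          | add s t hs ht => simp only [BTensor.add_tmul, map_add, hs, ht]
        | add s t hs ht => simp only [map_add, hs, ht]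
      have h2 : ρ ∘ₗ N.mkQ = BTensor.mapLinear C N.mkQ ∘ₗ M.coact := LinearMap.ext hρ
      have h3 := congrArg (BTensor.mapLinear C (BTensor.mapLinear C N.mkQ)) (M.coassoc m)
      rw [h1, BTensor.map_map, BTensor.mapLinear_apply, BTensor.map_map, ← h2] at h3
      rw [hρ, BTensor.map_map, BTensor.map_map]
      exact h3
    counit := fun n => by
      obtain ⟨m, rfl⟩ := N.mkQ_surjective n
      rw [hρ, BTensor.contractLeft_map, M.counit] }

theorem isColinear_mkQ (M : LeftComodule R C) (N : Submodule R M) (hN : M.IsSubcomodule N) :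
    IsColinear (M := M) (N := M.quot N hN) N.mkQ := fun _ => rfl

variable (R C) in
/-- The coring as a left comodule over itself. -/
def regular : LeftComodule R C where
  carrier := C
  coact := Coring.comul
  coassoc := Coring.coassoc
  counit := Coring.counit_left

/-- The map `m ↦ m₍₋₁₎ · f m₍₀₎` from a left comodule to the coring. -/
def toCoring (M : LeftComodule R C) (f : M →ₗ[R] R) : M →ₗ[R] C :=
  BTensor.contractRightLinear C f ∘ₗ M.coact

theorem toCoring_apply (M : LeftComodule R C) (f : M →ₗ[R] R) (m : M) :
    M.toCoring f m = BTensor.contractRight C f (M.coact m) := rfl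

theorem isColinear_toCoring (M : LeftComodule R C) (f : M →ₗ[R] R) :
    IsColinear (M := M) (N := regular R C) (M.toCoring f) := by
  intro m
  have h1 : ∀ t : BTensor R (BTensor R C C) M,
      BTensor.map LinearMap.id (BTensor.contractRightLinear C f) (BTensor.assoc R C C M t) =
        BTensor.contractRight (BTensor R C C) f t := by
    intro t
    induction t using BTensor.induction_on with
    | zero => simp
    | tmul s n =>
      induction s using BTensor.induction_on with
      | zero => simp [BTensor.zero_tmul]
      | tmul a b => rfl
      | add s t hs ht => simp only [BTensor.add_tmul, map_add, hs, ht]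
    | add s t hs ht => simp only [map_add, hs, ht]
  have h := congrArg (BTensor.map (LinearMap.id : C →ₗ[Rᵐᵒᵖ] C)
    (BTensor.contractRightLinear C f)) (M.coassoc m)
  rw [h1, BTensor.map_map, BTensor.contractRight_map, Coring.comulR_apply] at h
  exact h

theorem apply_act (M : LeftComodule R C) (f : M →ₗ[R] R) (φ : C →ₗ[Rᵐᵒᵖ] R) (m : M) :
    f (M.act φ m) = φ (M.toCoring f m) :=
  BTensor.apply_contractLeft φ f _

theorem counit_toCoring (M : LeftComodule R C) (f : M →ₗ[R] R) (m : M) :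
    Coring.counit (R := R) (M.toCoring f m) = f m := by
  rw [← Coring.counitR_apply, ← apply_act, act_counit]

theorem toCoring_counit_comp {M : LeftComodule R C} {g : M →ₗ[R] C}
    (hg : IsColinear (M := M) (N := regular R C) g) :
    M.toCoring (Coring.counit ∘ₗ g) = g := by
  ext m
  have h : BTensor.contractRight C (Coring.counit (R := R) (C := C))
      (Coring.comul (R := R) (C := C) (g m)) = BTensor.contractRight C Coring.counit
        (BTensor.map LinearMap.id g (M.coact m)) :=
    congrArg (BTensor.contractRight C (Coring.counit (R := R) (C := C))) (hg m)
  rw [BTensor.contractRight_map_right] at h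
  exact h.symm.trans (Coring.counit_right (R := R) (C := C) (g m))

theorem toCoring_comp {M N : LeftComodule R C} {i : M →ₗ[R] N} (hi : IsColinear i)
    (f : N →ₗ[R] R) (m : M) : N.toCoring f (i m) = M.toCoring (f ∘ₗ i) m := by
  rw [toCoring_apply, hi, BTensor.contractRight_map_right, toCoring_apply]

/-- Over a left self-injective ring, the coring is an injective left comodule: colinear maps to it
are the same as functionals. -/
theorem isInjective_regular [Module.Injective R R] : (regular R C).IsInjective := by
  intro X Y i g hi hinj hg
  obtain ⟨F, hF⟩ := Module.Injective.out i hinj ((Coring.counit (R := R) (C := C)) ∘ₗ g)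
  refine ⟨Y.toCoring F, isColinear_toCoring Y F, LinearMap.ext fun x => ?_⟩
  have : F ∘ₗ i = (Coring.counit (R := R) (C := C)) ∘ₗ g := LinearMap.ext hF
  change Y.toCoring F (i x) = g x
  rw [toCoring_comp hi, this]
  exact LinearMap.congr_fun (toCoring_counit_comp (g := g) hg) x

end Constructions

end LeftComodule

/-! ### Finiteness and injective hulls of left comodules -/

namespace LeftComodule

variable {R C : Type u} [Ring R] [AddCommGroup C] [Module R C] [Module Rᵐᵒᵖ C]
  [SMulCommClass R Rᵐᵒᵖ C] [Coring R C]

section Finiteness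

/-- The subcomodule generated by an element. -/
def cyclic (M : LeftComodule R C) (m : M) : Submodule R M :=
  Submodule.span R (Set.range fun φ : C →ₗ[Rᵐᵒᵖ] R => M.act φ m)

theorem mem_cyclic_self (M : LeftComodule R C) (m : M) : m ∈ M.cyclic m :=
  Submodule.subset_span ⟨Coring.counitR, M.act_counit m⟩

theorem isSubcomodule_cyclic (hr : IsLocallyProjective Rᵐᵒᵖ C) (M : LeftComodule R C) (m : M) :
    M.IsSubcomodule (M.cyclic m) := by
  refine (isSubcomodule_iff hr).2 fun φ n hn => ?_
  induction hn using Submodule.span_induction generalizing φ with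
  | mem n hn =>
    obtain ⟨ψ, rfl⟩ := hn
    exact Submodule.subset_span ⟨_, (M.act_act φ ψ m).symm⟩
  | zero => rw [map_zero]; exact zero_mem _
  | add a b _ _ ha hb => rw [map_add]; exact add_mem (ha φ) (hb φ)
  | smul r a _ ha => rw [act_smul]; exact ha _

theorem cyclic_le (hr : IsLocallyProjective Rᵐᵒᵖ C) {M : LeftComodule R C} {N : Submodule R M}
    (hN : M.IsSubcomodule N) {m : M} (hm : m ∈ N) : M.cyclic m ≤ N := by
  refine Submodule.span_le.2 ?_
  rintro _ ⟨φ, rfl⟩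
  exact (isSubcomodule_iff hr).1 hN φ m hm

/-- The finiteness theorem for comodules over a noetherian ring. -/
theorem fg_cyclic [IsNoetherianRing R] (M : LeftComodule R C) (m : M) : (M.cyclic m).FG := by
  obtain ⟨n, c, b, h⟩ := BTensor.exists_eq_sum (M.coact m)
  have hle : M.cyclic m ≤ Submodule.span R (Set.range b) := by
    refine Submodule.span_le.2 ?_
    rintro _ ⟨φ, rfl⟩
    simp only [act_apply, h, map_sum, BTensor.contractLeft_tmul]
    exact Submodule.sum_mem _ fun i _ =>
      Submodule.smul_mem _ _ (Submodule.subset_span ⟨i, rfl⟩)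
  have := isNoetherian_of_fg_of_noetherian (Submodule.span R (Set.range b))
    (Submodule.fg_span (Set.finite_range b))
  exact Submodule.FG.of_le_of_isNoetherian hle

theorem exists_fg_isSubcomodule (hr : IsLocallyProjective Rᵐᵒᵖ C) [IsNoetherianRing R]
    (M : LeftComodule R C) (F : Finset M) :
    ∃ N : Submodule R M, M.IsSubcomodule N ∧ N.FG ∧ (F : Set M) ⊆ N := by
  classical
  induction F using Finset.induction_on with
  | empty => exact ⟨⊥, isSubcomodule_bot hr, Submodule.fg_bot, by simp⟩
  | insert m F _ ih =>
    obtain ⟨N, hN, hfg, hF⟩ := ih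
    refine ⟨M.cyclic m ⊔ N, (isSubcomodule_cyclic hr M m).sup hr hN, (M.fg_cyclic m).sup hfg, ?_⟩
    rw [Finset.coe_insert, Set.insert_subset_iff]
    exact ⟨Submodule.mem_sup_left (M.mem_cyclic_self m),
      hF.trans (SetLike.coe_subset_coe.2 le_sup_right)⟩

theorem IsFG.finite (hr : IsLocallyProjective Rᵐᵒᵖ C) [IsNoetherianRing R]
    {M : LeftComodule R C} (hM : M.IsFG) : Module.Finite R M := by
  obtain ⟨F, hF⟩ := hM
  obtain ⟨N, hN, hfg, hFN⟩ := exists_fg_isSubcomodule hr M F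
  exact ⟨hF N hN hFN ▸ hfg⟩

theorem isFG_of_finite (M : LeftComodule R C) [Module.Finite R M] : M.IsFG := by
  obtain ⟨F, hF⟩ := Module.Finite.fg_top (R := R) (M := M)
  exact ⟨F, fun N _ h => top_le_iff.1 (hF ▸ Submodule.span_le.2 h)⟩

theorem isSubcomodule_map_subtype (hr : IsLocallyProjective Rᵐᵒᵖ C) {M : LeftComodule R C}
    {N : Submodule R M} (hN : M.IsSubcomodule N) {K : Submodule R N}
    (hK : (M.sub hr N hN).IsSubcomodule K) : M.IsSubcomodule (K.map N.subtype) :=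
  (isColinear_subtype hr M N hN).isSubcomodule_map hr hK

theorem isSimple_sub (hr : IsLocallyProjective Rᵐᵒᵖ C) {M : LeftComodule R C}
    {S : Submodule R M} (hS : M.IsSubcomodule S) (hne : S ≠ ⊥)
    (hmin : ∀ K : Submodule R M, M.IsSubcomodule K → K ≤ S → K = ⊥ ∨ K = S) :
    (M.sub hr S hS).IsSimple := by
  refine ⟨(Submodule.nontrivial_iff_ne_bot).2 hne, fun L hL => ?_⟩
  have hinj := Submodule.map_injective_of_injective S.injective_subtype
  rcases hmin _ (isSubcomodule_map_subtype hr hS hL) (Submodule.map_subtype_le _ _) with h | h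
  · exact Or.inl (hinj (h.trans (Submodule.map_bot _).symm))
  · refine Or.inr (hinj (h.trans ?_))
    exact (S.range_subtype.symm.trans (Submodule.map_top _).symm)

/-- A nonzero subcomodule of a comodule over an artinian ring contains a simple subcomodule. -/
theorem exists_isSimple_sub (hr : IsLocallyProjective Rᵐᵒᵖ C) [IsNoetherianRing R]
    [IsArtinianRing R] {M : LeftComodule R C} {N : Submodule R M} (hN : M.IsSubcomodule N)
    (hne : N ≠ ⊥) :
    ∃ (S : Submodule R M) (hS : M.IsSubcomodule S), S ≤ N ∧ (M.sub hr S hS).IsSimple := by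
  obtain ⟨n, hn, hn0⟩ := N.exists_mem_ne_zero_of_ne_bot hne
  have hart : IsArtinian R (M.cyclic n) := isArtinian_of_fg_of_artinian _ (M.fg_cyclic n)
  have hwf : WellFoundedLT (Set.Iic (M.cyclic n)) :=
    (Submodule.mapIic (M.cyclic n)).symm.strictMono.wellFoundedLT
  obtain ⟨⟨S, hSn⟩, ⟨hS0, hS⟩, hmin⟩ := hwf.wf.has_min
    {K : Set.Iic (M.cyclic n) | K.1 ≠ ⊥ ∧ M.IsSubcomodule K.1}
    ⟨⟨M.cyclic n, Set.mem_Iic.2 le_rfl⟩,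
      fun h => hn0 ((Submodule.mem_bot R).1 (h ▸ M.mem_cyclic_self n)),
      isSubcomodule_cyclic hr M n⟩
  refine ⟨S, hS, le_trans hSn (cyclic_le hr hN hn), isSimple_sub hr hS hS0 fun K hK hKS => ?_⟩
  by_cases hK0 : K = ⊥
  · exact Or.inl hK0
  · exact Or.inr (hKS.eq_of_not_lt (hmin ⟨K, hKS.trans hSn⟩ ⟨hK0, hK⟩))

end Finiteness

section InjectiveHull

/-- Nonzero colinear maps from simple comodules are injective. -/
theorem IsSimple.injective (hr : IsLocallyProjective Rᵐᵒᵖ C) {S M : LeftComodule R C}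
    (hS : S.IsSimple) {f : S →ₗ[R] M} (hf : IsColinear f) {s : S} (hs : f s ≠ 0) :
    Function.Injective f := by
  rw [← LinearMap.ker_eq_bot]
  refine (hS.2 _ (hf.isSubcomodule_ker hr)).resolve_right fun h => hs ?_
  have : s ∈ LinearMap.ker f := h ▸ Submodule.mem_top
  exact this

/-- A subcomodule that meets the image of a simple comodule contains this image. -/
theorem IsSimple.range_le (hr : IsLocallyProjective Rᵐᵒᵖ C) {S M : LeftComodule R C}
    (hS : S.IsSimple) {f : S →ₗ[R] M} (hf : IsColinear f) {N : Submodule R M}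
    (hN : M.IsSubcomodule N) {s : S} (hs : s ≠ 0) (hsN : f s ∈ N) : LinearMap.range f ≤ N := by
  rcases hS.2 _ (hf.isSubcomodule_comap hr hN) with h | h
  · have : s ∈ N.comap f := hsN
    rw [h] at this
    exact absurd ((Submodule.mem_bot R).1 this) hs
  · rintro _ ⟨x, rfl⟩
    have : x ∈ N.comap f := h ▸ Submodule.mem_top
    exact this

/-- An essential embedding of a simple comodule: nonzero subcomodules contain its image. -/
theorem IsInjectiveHull.apply_mem (hr : IsLocallyProjective Rᵐᵒᵖ C) {S E : LeftComodule R C}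
    (hS : S.IsSimple) {i : S →ₗ[R] E} (hi : IsInjectiveHull i) {N : Submodule R E}
    (hN : E.IsSubcomodule N) (hne : N ≠ ⊥) (s : S) : i s ∈ N := by
  by_contra hs
  refine hne (hi.2.2.2 N hN (Submodule.eq_bot_iff _ |>.2 ?_))
  rintro _ ⟨hx, x, rfl⟩
  by_contra hx0
  have hx' : x ≠ 0 := fun h => hx0 (by rw [h, map_zero])
  exact hs (hS.range_le hr hi.1 hN hx' hx ⟨s, rfl⟩)

/-- The hull of a simple comodule is indecomposable. -/
theorem IsInjectiveHull.isIndecomposable (hr : IsLocallyProjective Rᵐᵒᵖ C)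
    {S E : LeftComodule R C} (hS : S.IsSimple) {i : S →ₗ[R] E} (hi : IsInjectiveHull i) :
    E.IsIndecomposable := by
  have := hS.1
  obtain ⟨s, hs⟩ := exists_ne (0 : S)
  have his : i s ≠ 0 := fun h => hs (hi.2.1 (h.trans (map_zero i).symm))
  refine ⟨⟨i s, 0, his⟩, fun N N' hN hN' hc => ?_⟩
  by_contra hcon
  push Not at hcon
  exact his ((Submodule.mem_bot R).1 (hc.inf_eq_bot ▸
    ⟨hi.apply_mem hr hS hN hcon.1 s, hi.apply_mem hr hS hN' hcon.2 s⟩))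

/-- A retract of an injective comodule is injective. -/
theorem IsInjective.of_retract {E M : LeftComodule R C} (hM : M.IsInjective) {j : E →ₗ[R] M}
    {p : M →ₗ[R] E} (hj : IsColinear j) (hp : IsColinear p) (hpj : p ∘ₗ j = LinearMap.id) :
    E.IsInjective := by
  intro X Y i g hi hinj hg
  obtain ⟨h, hh, hhi⟩ := hM X Y i (j ∘ₗ g) hi hinj (hj.comp hg)
  refine ⟨p ∘ₗ h, hp.comp hh, ?_⟩
  rw [LinearMap.comp_assoc, hhi, ← LinearMap.comp_assoc, hpj, LinearMap.id_comp]

/-- Simple subcomodules of an injective comodule have an injective hull: a maximal essential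
extension `E` of `S` is a direct summand, since the quotient by a maximal subcomodule `D` that
does not contain `S` is essential over `S`, and embeds into the injective comodule with image
`E`. -/
theorem exists_injectiveHull_of_injective (hr : IsLocallyProjective Rᵐᵒᵖ C)
    {S Q : LeftComodule R C} (hS : S.IsSimple) (hQ : Q.IsInjective) {j : S →ₗ[R] Q}
    (hj : IsColinear j) (hjinj : Function.Injective j) :
    ∃ (E : LeftComodule R C) (i : S →ₗ[R] E), IsInjectiveHull i := by
  have := hS.1
  obtain ⟨s, hs⟩ := exists_ne (0 : S)
  have hjs : j s ≠ 0 := fun h => hs (hjinj (h.trans (map_zero j).symm))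
  -- `E` is maximal among the subcomodules all of whose nonzero subcomodules contain `j s`.
  obtain ⟨E, hSE, ⟨hE, hEess⟩, hEmax⟩ := zorn_le_nonempty₀
    {E : Submodule R Q | Q.IsSubcomodule E ∧
      ∀ K, Q.IsSubcomodule K → K ≤ E → K ≠ ⊥ → j s ∈ K} (by
    intro c hc hchain y hy
    refine ⟨sSup c, ⟨isSubcomodule_sSup_of_isChain hr ⟨y, hy⟩ hchain fun K hK => (hc hK).1,
      fun K hK hle hne => ?_⟩, fun z hz => le_sSup hz⟩
    obtain ⟨k, hk, hk0⟩ := K.exists_mem_ne_zero_of_ne_bot hne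
    obtain ⟨L, hL, hkL⟩ := (Submodule.mem_sSup_of_directed ⟨y, hy⟩ hchain.directedOn).1 (hle hk)
    have hKL := (hc hL).2 (K ⊓ L) (hK.inf hr (hc hL).1) inf_le_right
      (fun h => hk0 ((Submodule.mem_bot R).1 (h ▸ ⟨hk, hkL⟩)))
    exact hKL.1) (LinearMap.range j) (by
    refine ⟨hj.isSubcomodule_range hr, fun K hK hle hne => ?_⟩
    obtain ⟨k, hk, hk0⟩ := K.exists_mem_ne_zero_of_ne_bot hne
    obtain ⟨x, rfl⟩ := hle hk
    exact hS.range_le hr hj hK (fun h => hk0 (by rw [h, map_zero])) hk ⟨s, rfl⟩)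
  -- `D` is maximal among the subcomodules that do not contain `j s`.
  obtain ⟨D, -, ⟨hD, hDs⟩, hDmax⟩ := zorn_le_nonempty₀
    {D : Submodule R Q | Q.IsSubcomodule D ∧ j s ∉ D} (by
    intro c hc hchain y hy
    refine ⟨sSup c, ⟨isSubcomodule_sSup_of_isChain hr ⟨y, hy⟩ hchain fun K hK => (hc hK).1,
      fun h => ?_⟩, fun z hz => le_sSup hz⟩
    obtain ⟨L, hL, hkL⟩ := (Submodule.mem_sSup_of_directed ⟨y, hy⟩ hchain.directedOn).1 h
    exact (hc hL).2 hkL) ⊥ ⟨isSubcomodule_bot hr, fun h => hjs ((Submodule.mem_bot R).1 h)⟩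
  have hDess : ∀ K : Submodule R (Q.quot D hD), (Q.quot D hD).IsSubcomodule K → K ≠ ⊥ →
      D.mkQ (j s) ∈ K := by
    intro K hK hne
    by_contra hcon
    have hK' := (isColinear_mkQ Q D hD).isSubcomodule_comap hr hK
    have hDK : D ≤ K.comap D.mkQ := fun d hd => by
      have h0 : D.mkQ d = 0 := by simpa using hd
      change D.mkQ d ∈ K
      rw [h0]
      exact zero_mem _
    have heq := hDmax ⟨hK', hcon⟩ hDK
    refine hne (eq_bot_iff.2 fun x hx => ?_)
    obtain ⟨x, rfl⟩ := D.mkQ_surjective x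
    have h0 : D.mkQ x = 0 := by simpa using heq hx
    exact (Submodule.mem_bot R).2 h0
  let E' := Q.sub hr E hE
  have hE' : IsColinear (M := E') (N := Q) E.subtype := isColinear_subtype hr Q E hE
  let q : E' →ₗ[R] Q.quot D hD := D.mkQ ∘ₗ E.subtype
  have hq : IsColinear q := (isColinear_mkQ Q D hD).comp hE'
  have hqinj : Function.Injective q := by
    rw [← LinearMap.ker_eq_bot]
    by_contra hne
    have h1 := hE'.isSubcomodule_map hr (hq.isSubcomodule_ker hr)
    have h2 := hEess _ h1 (Submodule.map_subtype_le _ _) (fun h => hne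
      (Submodule.map_injective_of_injective E.injective_subtype
        (h.trans (Submodule.map_bot _).symm)))
    obtain ⟨x, hx, hxs⟩ := h2
    have h3 : D.mkQ (j s) = 0 := by
      rw [← hxs]
      exact hx
    exact hDs (by simpa using h3)
  obtain ⟨h, hh, hhq⟩ := hQ E' (Q.quot D hD) q E.subtype hq hqinj hE'
  have hhx : ∀ x : E, h (D.mkQ x) = x := fun x => LinearMap.congr_fun hhq x
  have hsE : j s ∈ E := hSE ⟨s, rfl⟩
  have hrange : LinearMap.range h ≤ E := by
    refine hEmax ⟨hh.isSubcomodule_range hr, fun K hK hle hne => ?_⟩ fun x hx => ⟨_, hhx ⟨x, hx⟩⟩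
    have h1 := hh.isSubcomodule_comap hr hK
    have h2 := hDess _ h1 (fun hbot => hne (eq_bot_iff.2 fun k hk => ?_))
    · have : h (D.mkQ (j s)) ∈ K := h2
      rwa [hhx ⟨j s, hsE⟩] at this
    · obtain ⟨x, rfl⟩ := hle hk
      have hx : x ∈ K.comap h := hk
      rw [hbot] at hx
      rw [(Submodule.mem_bot R).1 hx, map_zero]
      exact zero_mem _
  let e : Q →ₗ[R] Q := h ∘ₗ (D.mkQ : Q →ₗ[R] Q.quot D hD)
  let p : Q →ₗ[R] E := LinearMap.codRestrict E e (fun x => hrange ⟨D.mkQ x, rfl⟩)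
  have hp : IsColinear (M := Q) (N := E') p := by
    refine isColinear_of_act hr fun φ m => Subtype.ext ?_
    have h1 := (hh.comp (isColinear_mkQ Q D hD)).act φ m
    exact h1.trans (hE'.act φ (p m)).symm
  have hpE : ∀ x : E, p x = x := fun x => Subtype.ext (hhx x)
  let i : S →ₗ[R] E := j.codRestrict E (fun x => hSE ⟨x, rfl⟩)
  refine ⟨E', i, isColinear_of_act hr fun φ m => Subtype.ext ?_,
    fun x y hxy => hjinj (congrArg Subtype.val hxy), hQ.of_retract hE' hp (LinearMap.ext hpE),
    fun N hN hbot => ?_⟩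
  · exact (hj.act φ m).trans (hE'.act φ (i m)).symm
  · by_contra hne
    obtain ⟨x, hx, hxs⟩ := hEess _ (hE'.isSubcomodule_map hr hN) (Submodule.map_subtype_le _ _)
      (fun h => hne (Submodule.map_injective_of_injective E.injective_subtype
        (h.trans (Submodule.map_bot _).symm)))
    have hxi : x = i s := Subtype.ext hxs
    have : i s ∈ N ⊓ LinearMap.range i := ⟨hxi ▸ hx, s, rfl⟩
    rw [hbot] at this
    exact hjs (congrArg Subtype.val ((Submodule.mem_bot R (M := E')).1 this))

/-- A functional on the injective hull of a simple comodule that does not vanish on the simple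
comodule embeds the hull into the coring. -/
theorem IsInjectiveHull.toCoring_injective (hr : IsLocallyProjective Rᵐᵒᵖ C)
    {S E : LeftComodule R C} (hS : S.IsSimple) {i : S →ₗ[R] E} (hi : IsInjectiveHull i)
    {f : E →ₗ[R] R} {s : S} (hf : f (i s) ≠ 0) : Function.Injective (E.toCoring f) := by
  rw [← LinearMap.ker_eq_bot]
  by_contra hne
  have h := hi.apply_mem hr hS ((isColinear_toCoring E f).isSubcomodule_ker hr) hne s
  refine hf ?_
  have h0 : E.toCoring f (i s) = 0 := h
  rw [← counit_toCoring, h0, map_zero]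

theorem exists_injectiveHull [Module.Injective Rᵐᵒᵖ R] [IsArtinian Rᵐᵒᵖ R]
    (hr : IsLocallyProjective Rᵐᵒᵖ C) {S : LeftComodule R C} (hS : S.IsSimple) :
    ∃ (E : LeftComodule R C) (i : S →ₗ[R] E), IsInjectiveHull i := by
  have := QuasiFrobenius.injective_left (R := R)
  have := hS.1
  obtain ⟨s, hs⟩ := exists_ne (0 : S)
  obtain ⟨f, hf⟩ := QuasiFrobenius.exists_functional_ne_zero (R := R) (M := S) hs
  refine exists_injectiveHull_of_injective hr hS isInjective_regular (isColinear_toCoring S f) ?_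
  refine hS.injective hr (isColinear_toCoring S f) (s := s) fun h0 => hf ?_
  have h0' : S.toCoring f s = 0 := h0
  rw [← counit_toCoring, h0', map_zero]

end InjectiveHull

end LeftComodule

/-! ### Right comodules and duals of left comodules -/

namespace RightComodule

variable {R C : Type u} [Ring R] [AddCommGroup C] [Module R C] [Module Rᵐᵒᵖ C]
  [SMulCommClass R Rᵐᵒᵖ C] [Coring R C]

/-- The action `x ↦ x₍₀₎ · f x₍₁₎` of the left dual of the coring on a right comodule. -/
def act (X : RightComodule R C) (f : C →ₗ[R] R) : X →+ X :=
  (BTensor.contractRight X f).comp X.coact.toAddMonoidHom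

theorem act_apply (X : RightComodule R C) (f : C →ₗ[R] R) (x : X) :
    X.act f x = BTensor.contractRight X f (X.coact x) := rfl

theorem act_counit (X : RightComodule R C) (x : X) : X.act Coring.counit x = x := X.counit x

omit [Coring R C] in
/-- Contracting the last tensor factor of `(ρ ⊗ C) t`, for a right linear map `ρ`. -/
theorem _root_.BTensor.map_contractRight_assoc_map {X : Type u} [AddCommGroup X] [Module Rᵐᵒᵖ X]
    (ρ : X →ₗ[Rᵐᵒᵖ] BTensor R X C) (g : C →ₗ[R] R) (t : BTensor R X C) :
    BTensor.map LinearMap.id (BTensor.contractRightLinear C g)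
      (BTensor.assoc R X C C (BTensor.map ρ LinearMap.id t)) =
        ρ (BTensor.contractRight X g t) := by
  have h1 : ∀ (t : BTensor R X C) (c : C),
      BTensor.map LinearMap.id (BTensor.contractRightLinear C g)
        (BTensor.assoc R X C C (BTensor.tmul R t c)) = op (g c) • t := by
    intro t c
    induction t using BTensor.induction_on with
    | zero => simp [BTensor.zero_tmul]
    | tmul a b => rfl
    | add s t hs ht => simp only [BTensor.add_tmul, map_add, hs, ht, smul_add]
  induction t using BTensor.induction_on with
  | zero => simp
  | tmul x c => rw [BTensor.map_tmul, LinearMap.id_apply, h1, BTensor.contractRight_tmul, map_smul]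
  | add s t hs ht => simp only [map_add, hs, ht]

theorem act_act (X : RightComodule R C) (f g : C →ₗ[R] R) (x : X) :
    X.act f (X.act g x) = X.act (coactDual (Coring.comul (R := R)) g f) x := by
  rw [act_apply, act_apply, ← BTensor.map_contractRight_assoc_map, X.coassoc, BTensor.map_map,
    LinearMap.comp_id, BTensor.contractRight_map_right]
  rfl

/-- The action of the left dual of the coring on a fixed element. -/
def orbitMap (X : RightComodule R C) (x : X) : (C →ₗ[R] R) →ₗ[Rᵐᵒᵖ] X where
  toFun f := X.act f x
  map_add' f g := BTensor.contractRight_add f g _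
  map_smul' r f := BTensor.contractRight_op_smul f (unop r) _

theorem orbitMap_apply (X : RightComodule R C) (x : X) (f : C →ₗ[R] R) :
    X.orbitMap x f = X.act f x := rfl

/-- Subcomodules are the submodules that are stable under the left dual of the coring. -/
theorem isSubcomodule_iff (hl : IsLocallyProjective R C) {X : RightComodule R C}
    {V : Submodule Rᵐᵒᵖ X} : X.IsSubcomodule V ↔ ∀ f, ∀ x ∈ V, X.act f x ∈ V := by
  refine ⟨fun h f x hx => ?_, fun h x hx =>
    BTensor.mem_range_map_of_contractRight hl V fun f => h f x hx⟩
  obtain ⟨t, ht⟩ := h x hx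
  rw [act_apply, ← ht, BTensor.contractRight_map]
  exact (BTensor.contractRight V f t).2

theorem IsColinear.act {X Y : RightComodule R C} {p : X →ₗ[Rᵐᵒᵖ] Y} (hp : IsColinear p)
    (f : C →ₗ[R] R) (x : X) : p (X.act f x) = Y.act f (p x) := by
  rw [act_apply, act_apply, hp, BTensor.contractRight_map]

theorem isColinear_of_act (hl : IsLocallyProjective R C) {X Y : RightComodule R C}
    {p : X →ₗ[Rᵐᵒᵖ] Y} (hp : ∀ f x, p (X.act f x) = Y.act f (p x)) : IsColinear p := by
  intro x
  refine BTensor.ext_contractRight hl fun f => ?_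
  rw [BTensor.contractRight_map]
  exact (hp f x).symm

theorem isSubcomodule_range_orbitMap (hl : IsLocallyProjective R C) (X : RightComodule R C)
    (x : X) : X.IsSubcomodule (LinearMap.range (X.orbitMap x)) := by
  refine (isSubcomodule_iff hl).2 ?_
  rintro f _ ⟨g, rfl⟩
  exact ⟨_, (X.act_act f g x).symm⟩

theorem mem_range_orbitMap (X : RightComodule R C) (x : X) :
    x ∈ LinearMap.range (X.orbitMap x) := ⟨Coring.counit, X.act_counit x⟩

/-- The finiteness theorem for comodules over a noetherian ring. -/
theorem fg_range_orbitMap [IsNoetherian Rᵐᵒᵖ R] (X : RightComodule R C) (x : X) :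
    (LinearMap.range (X.orbitMap x)).FG := by
  have : IsNoetherianRing Rᵐᵒᵖ := isNoetherian_of_linearEquiv (QuasiFrobenius.opEquiv R)
  obtain ⟨n, a, c, h⟩ := BTensor.exists_eq_sum (X.coact x)
  have hle : LinearMap.range (X.orbitMap x) ≤ Submodule.span Rᵐᵒᵖ (Set.range a) := by
    rintro _ ⟨f, rfl⟩
    simp only [orbitMap_apply, act_apply, h, map_sum, BTensor.contractRight_tmul]
    exact Submodule.sum_mem _ fun i _ =>
      Submodule.smul_mem _ _ (Submodule.subset_span ⟨i, rfl⟩)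
  have := isNoetherian_of_fg_of_noetherian (Submodule.span Rᵐᵒᵖ (Set.range a))
    (Submodule.fg_span (Set.finite_range a))
  exact Submodule.FG.of_le_of_isNoetherian hle

theorem IsColinear.isSubcomodule_map (hl : IsLocallyProjective R C) {X Y : RightComodule R C}
    {p : X →ₗ[Rᵐᵒᵖ] Y} (hp : IsColinear p) {V : Submodule Rᵐᵒᵖ X} (hV : X.IsSubcomodule V) :
    Y.IsSubcomodule (V.map p) := by
  refine (isSubcomodule_iff hl).2 ?_
  rintro f _ ⟨x, hx, rfl⟩
  exact ⟨_, (isSubcomodule_iff hl).1 hV f x hx, hp.act f x⟩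

theorem IsColinear.isSubcomodule_range (hl : IsLocallyProjective R C) {X Y : RightComodule R C}
    {p : X →ₗ[Rᵐᵒᵖ] Y} (hp : IsColinear p) : Y.IsSubcomodule (LinearMap.range p) := by
  refine (isSubcomodule_iff hl).2 ?_
  rintro f _ ⟨x, rfl⟩
  exact ⟨_, hp.act f x⟩

theorem IsColinear.isSubcomodule_ker (hl : IsLocallyProjective R C) {X Y : RightComodule R C}
    {p : X →ₗ[Rᵐᵒᵖ] Y} (hp : IsColinear p) : X.IsSubcomodule (LinearMap.ker p) := by
  refine (isSubcomodule_iff hl).2 fun f x hx => ?_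
  rw [LinearMap.mem_ker, hp.act, LinearMap.mem_ker.1 hx, map_zero]

/-- Projective covers of simple comodules are cyclic. -/
theorem IsProjectiveCover.range_orbitMap_eq_top (hl : IsLocallyProjective R C)
    {P T : RightComodule R C} (hT : T.IsSimple) {p : P →ₗ[Rᵐᵒᵖ] T} (hp : IsProjectiveCover p)
    {x : P} (hx : p x ≠ 0) : LinearMap.range (P.orbitMap x) = ⊤ := by
  have hV := P.isSubcomodule_range_orbitMap hl x
  refine hp.2.2.2 _ hV ?_
  have htop := (hT.2 _ (hp.1.isSubcomodule_map hl hV)).resolve_left fun h => hx <| by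
    have : p x ∈ (LinearMap.range (P.orbitMap x)).map p := ⟨x, P.mem_range_orbitMap x, rfl⟩
    rw [h] at this
    exact (Submodule.mem_bot _).1 this
  refine eq_top_iff.2 fun y _ => ?_
  obtain ⟨v, hv, hvy⟩ : p y ∈ (LinearMap.range (P.orbitMap x)).map p :=
    htop ▸ Submodule.mem_top
  rw [← sub_add_cancel y v]
  exact Submodule.add_mem_sup (by rw [LinearMap.mem_ker, map_sub, hvy, sub_self]) hv

end RightComodule

namespace LeftComodule

variable {R C : Type u} [Ring R] [AddCommGroup C] [Module R C] [Module Rᵐᵒᵖ C]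
  [SMulCommClass R Rᵐᵒᵖ C] [Coring R C]

theorem _root_.IsLocallyProjective.eq_zero_of_forall {A : Type u} [Ring A] {M : Type v}
    [AddCommGroup M] [Module A M] (hM : IsLocallyProjective A M) {c : M}
    (h : ∀ a : M →ₗ[A] A, a c = 0) : c = 0 := by
  obtain ⟨n, f, m, hc⟩ := hM {c}
  rw [hc c (by simp)]
  exact Finset.sum_eq_zero fun i _ => by rw [h, zero_smul]

/-- The elements of a comodule at which all functionals of a given set vanish. -/
def polar (M : LeftComodule R C) (V : Set (M →ₗ[R] R)) : Submodule R M where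
  carrier := {m | ∀ f ∈ V, f m = 0}
  zero_mem' := by simp
  add_mem' := by
    intro a b ha hb f hf
    rw [map_add, ha f hf, hb f hf, add_zero]
  smul_mem' := by
    intro r a ha f hf
    rw [map_smul, ha f hf, smul_zero]

/-- The polar of a set of functionals that is stable under the left dual of the coring is a
subcomodule. -/
theorem isSubcomodule_polar (hl : IsLocallyProjective R C) (hr : IsLocallyProjective Rᵐᵒᵖ C)
    (M : LeftComodule R C) {V : Set (M →ₗ[R] R)}
    (hV : ∀ f ∈ V, ∀ a : C →ₗ[R] R, a ∘ₗ M.toCoring f ∈ V) : M.IsSubcomodule (M.polar V) := by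
  refine (isSubcomodule_iff hr).2 fun φ m hm f hf => ?_
  have h0 : M.toCoring f m = 0 := hl.eq_zero_of_forall fun a => hm _ (hV f hf a)
  rw [apply_act, h0, map_zero]

/-- For functionals on a finitely generated left comodule, the right action of the left dual of
the coring comes from a coaction. -/
theorem exists_dualCoact (hl : IsLocallyProjective R C) (M : LeftComodule R C)
    [Module.Finite R M] (f : M →ₗ[R] R) :
    ∃ t : BTensor R (M →ₗ[R] R) C, ∀ a : C →ₗ[R] R,
      BTensor.contractRight (M →ₗ[R] R) a t = a ∘ₗ M.toCoring f := by
  classical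
  obtain ⟨F, hF⟩ := Module.Finite.fg_top (R := R) (M := M)
  obtain ⟨n, h, e, hc⟩ := hl (F.image (M.toCoring f))
  have hall : ∀ m, M.toCoring f m = ∑ i, h i (M.toCoring f m) • e i := by
    intro m
    have hm : m ∈ Submodule.span R (F : Set M) := hF ▸ Submodule.mem_top
    induction hm using Submodule.span_induction with
    | mem m hm => exact hc _ (Finset.mem_image_of_mem _ hm)
    | zero => simp
    | add a b _ _ ha hb =>
      conv_lhs => rw [map_add, ha, hb]
      simp [add_smul, Finset.sum_add_distrib]
    | smul r a _ ha =>
      conv_lhs => rw [map_smul, ha]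
      simp [Finset.smul_sum, mul_smul]
  refine ⟨∑ i, BTensor.tmul R (h i ∘ₗ M.toCoring f) (e i), fun a => LinearMap.ext fun m => ?_⟩
  rw [LinearMap.comp_apply, hall m]
  simp [LinearMap.sum_apply]

/-- The right comodule `*M` of functionals on a finitely generated left comodule `M`. -/
noncomputable def dual (hl : IsLocallyProjective R C) (M : LeftComodule R C)
    [Module.Finite R M] : RightComodule R C :=
  have : SMulCommClass Rᵐᵒᵖ R C := SMulCommClass.symm R Rᵐᵒᵖ C
  let ρ₀ := fun f : M →ₗ[R] R => (exists_dualCoact hl M f).choose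
  have hρ₀ : ∀ (f : M →ₗ[R] R) (a : C →ₗ[R] R),
      BTensor.contractRight (M →ₗ[R] R) a (ρ₀ f) = coactDual M.coact f a :=
    fun f => (exists_dualCoact hl M f).choose_spec
  let ρ : (M →ₗ[R] R) →ₗ[Rᵐᵒᵖ] BTensor R (M →ₗ[R] R) C :=
    { toFun := ρ₀
      map_add' := fun f g => BTensor.ext_contractRight hl fun a => by
        rw [map_add, hρ₀, hρ₀, hρ₀, coactDual_add]
      map_smul' := fun r f => BTensor.ext_contractRight hl fun a => by
        have h1 : ∀ t : BTensor R (M →ₗ[R] R) C, BTensor.contractRight (M →ₗ[R] R) a (r • t) =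
            BTensor.contractRight (M →ₗ[R] R) (a ∘ₗ DistribSMul.toLinearMap R C r) t := by
          intro t
          induction t using BTensor.induction_on with
          | zero => simp
          | tmul m c => simp
          | add s t hs ht => simp [hs, ht]
        rw [RingHom.id_apply, h1, hρ₀, hρ₀]
        ext m
        rw [coactDual_apply, coactDual_apply]
        change _ = a (r • _)
        rw [← op_unop r, BTensor.contractRight_op_smul] }
  have hρ : ∀ (f : M →ₗ[R] R) (a : C →ₗ[R] R),
      BTensor.contractRight (M →ₗ[R] R) a (ρ f) = coactDual M.coact f a := hρ₀
  { carrier := M →ₗ[R] R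
    coact := ρ
    coassoc := fun f => by
      refine BTensor.ext_contractRight_last hl fun g => BTensor.ext_contractRight hl fun a => ?_
      rw [BTensor.map_contractRight_assoc_map, BTensor.map_map, LinearMap.comp_id,
        BTensor.contractRight_map_right, hρ, hρ, hρ, coactDual_coactDual M.coact M.coassoc]
      rfl
    counit := fun f => by rw [hρ, coactDual_counit M.coact M.counit] }

theorem dual_act (hl : IsLocallyProjective R C) (M : LeftComodule R C) [Module.Finite R M]
    (a : C →ₗ[R] R) (f : M →ₗ[R] R) : (M.dual hl).act a f = a ∘ₗ M.toCoring f :=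
  (exists_dualCoact hl M f).choose_spec a

/-- The restriction of functionals along a map of left modules. -/
def dualMap {M N : Type u} [AddCommGroup M] [Module R M] [AddCommGroup N] [Module R N]
    (i : M →ₗ[R] N) : (N →ₗ[R] R) →ₗ[Rᵐᵒᵖ] (M →ₗ[R] R) where
  toFun f := f ∘ₗ i
  map_add' _ _ := rfl
  map_smul' _ _ := rfl

theorem toCoring_comp' {M N : LeftComodule R C} {i : M →ₗ[R] N} (hi : IsColinear i)
    (f : N →ₗ[R] R) : M.toCoring (f ∘ₗ i) = N.toCoring f ∘ₗ i :=
  LinearMap.ext fun m => (toCoring_comp hi f m).symm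

theorem isColinear_dualMap (hl : IsLocallyProjective R C) {M N : LeftComodule R C}
    [Module.Finite R M] [Module.Finite R N] {i : M →ₗ[R] N} (hi : IsColinear i) :
    RightComodule.IsColinear (M := N.dual hl) (N := M.dual hl) (dualMap i) := by
  refine RightComodule.isColinear_of_act hl fun a (f : N →ₗ[R] R) => ?_
  refine (congrArg (dualMap i) (dual_act hl N a f)).trans ?_
  refine Eq.trans ?_ (dual_act hl M a (f ∘ₗ i)).symm
  exact congrArg (a ∘ₗ ·) (toCoring_comp' hi f).symm

theorem dualMap_surjective [Module.Injective R R] {M N : Type u} [AddCommGroup M] [Module R M]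
    [AddCommGroup N] [Module R N] {i : M →ₗ[R] N} (hi : Function.Injective i) :
    Function.Surjective (dualMap i) := by
  intro f
  obtain ⟨g, hg⟩ := Module.Injective.out i hi f
  exact ⟨g, LinearMap.ext hg⟩

theorem isSubcomodule_polar_dual (hl : IsLocallyProjective R C)
    (hr : IsLocallyProjective Rᵐᵒᵖ C) {M : LeftComodule R C} [Module.Finite R M]
    {V : Submodule Rᵐᵒᵖ (M →ₗ[R] R)} (hV : (M.dual hl).IsSubcomodule V) :
    M.IsSubcomodule (M.polar (V : Set (M →ₗ[R] R))) := by
  refine isSubcomodule_polar hl hr M fun f hf a => ?_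
  exact dual_act hl M a f ▸ (RightComodule.isSubcomodule_iff hl).1 hV a f hf

theorem IsSimple.finite (hr : IsLocallyProjective Rᵐᵒᵖ C) [IsNoetherianRing R]
    {S : LeftComodule R C} (hS : S.IsSimple) : Module.Finite R S := by
  have := hS.1
  obtain ⟨s, hs⟩ := exists_ne (0 : S)
  have h := (hS.2 _ (isSubcomodule_cyclic hr S s)).resolve_left fun h =>
    hs ((Submodule.mem_bot R).1 (h ▸ S.mem_cyclic_self s))
  exact ⟨h ▸ S.fg_cyclic s⟩

section QF

variable [Module.Injective Rᵐᵒᵖ R] [IsArtinian Rᵐᵒᵖ R]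

theorem eq_top_of_polar_eq_bot {M : LeftComodule R C} [Module.Finite R M]
    (V : Submodule Rᵐᵒᵖ (M →ₗ[R] R)) (hV : M.polar (V : Set (M →ₗ[R] R)) = ⊥) : V = ⊤ := by
  refine QuasiFrobenius.eq_top_of_separating V fun m hm => ?_
  have : m ∈ M.polar (V : Set (M →ₗ[R] R)) := hm
  rw [hV] at this
  exact (Submodule.mem_bot R).1 this

/-- The dual of a simple left comodule is a simple right comodule. -/
theorem IsSimple.dual (hl : IsLocallyProjective R C) (hr : IsLocallyProjective Rᵐᵒᵖ C)
    {S : LeftComodule R C} [Module.Finite R S] (hS : S.IsSimple) : (S.dual hl).IsSimple := by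
  have := hS.1
  obtain ⟨s, hs⟩ := exists_ne (0 : S)
  obtain ⟨f, hf⟩ := QuasiFrobenius.exists_functional_ne_zero (R := R) (M := S) hs
  refine ⟨⟨f, (0 : S →ₗ[R] R), fun h => hf ?_⟩, fun (V : Submodule Rᵐᵒᵖ (S →ₗ[R] R)) hV => ?_⟩
  · rw [show f = (0 : S →ₗ[R] R) from h, LinearMap.zero_apply]
  · rcases hS.2 _ (isSubcomodule_polar_dual hl hr hV) with h | h
    · exact Or.inr (eq_top_of_polar_eq_bot V h)
    · refine Or.inl ((Submodule.eq_bot_iff _).2 fun g hg => ?_)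
      exact LinearMap.ext fun x =>
        (show x ∈ S.polar (V : Set (S →ₗ[R] R)) from h ▸ Submodule.mem_top) g hg

end QF

end LeftComodule

/-! ### Exactness of the rational part, local units and density -/

theorem isFinitelyDense_iff {R : Type u} [Ring R] {M : Type v} [AddCommGroup M] [Module R M]
    {S : Set (M →ₗ[R] R)} :
    IsFinitelyDense S ↔ ∀ (f : M →ₗ[R] R) (F : Finset M), ∃ g ∈ S, ∀ a ∈ F, g a = f a := by
  classical
  have hb : @TopologicalSpace.IsTopologicalBasis _ (finiteTopology R M)
      {U | ∃ (f : M →ₗ[R] R) (F : Finset M), U = {g | ∀ a ∈ F, g a = f a}} := by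
    refine @TopologicalSpace.IsTopologicalBasis.mk _ (finiteTopology R M) _ ?_ ?_ rfl
    · rintro _ ⟨f, F, rfl⟩ _ ⟨f', F', rfl⟩ g ⟨hg, hg'⟩
      refine ⟨_, ⟨g, F ∪ F', rfl⟩, fun a _ => rfl, fun k hk => ⟨fun a ha => ?_, fun a ha => ?_⟩⟩
      · rw [hk a (Finset.mem_union_left _ ha), hg a ha]
      · rw [hk a (Finset.mem_union_right _ ha), hg' a ha]
    · refine Set.eq_univ_of_forall fun f => ?_
      exact ⟨_, ⟨f, ∅, rfl⟩, fun a _ => rfl⟩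
  unfold IsFinitelyDense
  rw [@TopologicalSpace.IsTopologicalBasis.dense_iff _ (finiteTopology R M) _ hb]
  constructor
  · intro h f F
    obtain ⟨g, hg, hgS⟩ := h _ ⟨f, F, rfl⟩ ⟨f, fun a _ => rfl⟩
    exact ⟨g, hgS, hg⟩
  · rintro h _ ⟨f, F, rfl⟩ -
    obtain ⟨g, hgS, hg⟩ := h f F
    exact ⟨g, hg, hgS⟩

section

variable {R C : Type u} [Ring R] [AddCommGroup C] [Module R C] [Module Rᵐᵒᵖ C]
  [SMulCommClass R Rᵐᵒᵖ C] [Coring R C]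

/-- The identification of linear functionals on `C` with elements of `*C`. -/
def LeftDual.of (f : C →ₗ[R] R) : LeftDual R C := f

/-- The identification of elements of `*C` with linear functionals on `C`. -/
def LeftDual.toLinear : LeftDual R C →+ (C →ₗ[R] R) := AddMonoidHom.id (C →ₗ[R] R)

/-- The identification of linear functionals on `M` with elements of `*M`. -/
def LeftComodule.Dual.of (M : LeftComodule R C) (f : M →ₗ[R] R) : M.Dual := f

/-- The identification of elements of `*M` with linear functionals on `M`. -/
def LeftComodule.Dual.toLinear (M : LeftComodule R C) : M.Dual →+ (M →ₗ[R] R) :=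
  AddMonoidHom.id (M →ₗ[R] R)

theorem LeftDual.one_apply (c : C) : (1 : LeftDual R C) c = Coring.counit (R := R) c := rfl

/-- The base ring acts on the dual of a comodule by right multiplication of the values. -/
theorem LeftComodule.Dual.ofBase_smul (M : LeftComodule R C) (r : R) (f : M →ₗ[R] R) :
    op (LeftDual.ofBase R C r) • LeftComodule.Dual.of M f =
      LeftComodule.Dual.of M (op r • f) :=
  LinearMap.ext fun m => congrArg (· * r) (M.counit_toCoring f m)

theorem LeftDual.ofBase_smul (r : R) (f : C →ₗ[R] R) :
    op (LeftDual.ofBase R C r) • LeftDual.of f = LeftDual.of (op r • f) :=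
  LeftComodule.Dual.ofBase_smul (LeftComodule.regular R C) r f

/-- The orbit map `*C → X`, `a ↦ x · a`, of an element of a right module. -/
def LeftDual.orbit {X : Type u} [AddCommGroup X] [Module (LeftDual R C)ᵐᵒᵖ X] (x : X) :
    LeftDual R C →ₗ[(LeftDual R C)ᵐᵒᵖ] X where
  toFun a := op a • x
  map_add' a b := by rw [op_add, add_smul]
  map_smul' b a := by
    rw [RingHom.id_apply, smul_smul, ← op_unop b, op_smul_eq_mul, op_mul]

theorem map_mem_ratPart {X Y : Type u} [AddCommGroup X] [Module (LeftDual R C)ᵐᵒᵖ X]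
    [AddCommGroup Y] [Module (LeftDual R C)ᵐᵒᵖ Y] (g : X →ₗ[(LeftDual R C)ᵐᵒᵖ] Y) {x : X}
    (hx : x ∈ ratPart R C X) : g x ∈ ratPart R C Y :=
  (ratMap g ⟨x, hx⟩).2

theorem op_smul_mem_ratPart {X : Type u} [AddCommGroup X] [Module (LeftDual R C)ᵐᵒᵖ X] (x : X)
    {a : LeftDual R C} (ha : a ∈ ratPart R C (LeftDual R C)) : op a • x ∈ ratPart R C X :=
  map_mem_ratPart (LeftDual.orbit x) ha

variable (R C) in
/-- The rational part of `*C` contains local units: it has elements that agree with the counit on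
any given finite set. -/
def HasRationalLocalUnits : Prop :=
  ∀ F : Finset C, ∃ a ∈ ratPart R C (LeftDual R C), ∀ c ∈ F, a c = Coring.counit (R := R) c

theorem HasRationalLocalUnits.exists_smul_eq (h : HasRationalLocalUnits R C) {X : Type u}
    [AddCommGroup X] [Module (LeftDual R C)ᵐᵒᵖ X] {x : X} (hx : x ∈ ratPart R C X) :
    ∃ a ∈ ratPart R C (LeftDual R C), op a • x = x := by
  classical
  obtain ⟨n, y, c, hc⟩ := hx
  obtain ⟨a, ha, hac⟩ := h (Finset.univ.image c)
  refine ⟨a, ha, ?_⟩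
  have h1 := hc 1
  rw [op_one, one_smul] at h1
  rw [hc a, h1]
  refine Finset.sum_congr rfl fun i _ => ?_
  rw [hac _ (Finset.mem_image_of_mem _ (Finset.mem_univ i)), LeftDual.one_apply]

theorem HasRationalLocalUnits.ratIsExact (h : HasRationalLocalUnits R C) : RatIsExact R C := by
  intro X Y Z _ _ _ _ _ _ f g hf hfg hg
  refine ⟨fun a b hab => Subtype.ext (hf (congrArg Subtype.val hab)), fun y => ?_, fun z => ?_⟩
  · constructor
    · intro hy
      obtain ⟨x, hx⟩ := (hfg y.1).1 (congrArg Subtype.val hy)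
      -- A rational local unit for the image of `x` is one for `x`, since `f` is injective.
      obtain ⟨a, ha, hay⟩ := h.exists_smul_eq y.2
      have hax : op a • x = x := hf (by rw [map_smul, hx, hay])
      exact ⟨⟨x, hax ▸ op_smul_mem_ratPart x ha⟩, Subtype.ext hx⟩
    · rintro ⟨x, rfl⟩
      exact Subtype.ext ((hfg _).2 ⟨x.1, rfl⟩)
  · obtain ⟨a, ha, haz⟩ := h.exists_smul_eq z.2
    obtain ⟨y, hy⟩ := hg z.1
    refine ⟨⟨op a • y, op_smul_mem_ratPart y ha⟩, Subtype.ext ?_⟩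
    change g (op a • y) = z.1
    rw [map_smul, hy, haz]

theorem HasRationalLocalUnits.isFinitelyDense (h : HasRationalLocalUnits R C)
    (M : LeftComodule R C) :
    IsFinitelyDense (R := R) (M := M) (ratPart R C M.Dual : Set M.Dual) := by
  classical
  refine isFinitelyDense_iff.2 fun f F => ?_
  obtain ⟨a, ha, hac⟩ := h (F.image (M.toCoring f))
  refine ⟨_, op_smul_mem_ratPart (X := M.Dual) f ha, fun m hm => ?_⟩
  exact (hac _ (Finset.mem_image_of_mem _ hm)).trans (M.counit_toCoring f m)

theorem HasRationalLocalUnits.isFinitelyDense_leftDual (h : HasRationalLocalUnits R C) :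
    IsFinitelyDense (R := R) (M := C) (ratPart R C (LeftDual R C) : Set (LeftDual R C)) :=
  h.isFinitelyDense (LeftComodule.regular R C)

theorem hasRationalLocalUnits_of_isFinitelyDense
    (h : IsFinitelyDense (R := R) (M := C) (ratPart R C (LeftDual R C) : Set (LeftDual R C))) :
    HasRationalLocalUnits R C :=
  fun F => isFinitelyDense_iff.1 h Coring.counit F

variable (R C) in
/-- The coring as a right comodule over itself. -/
def RightComodule.regular : RightComodule R C where
  carrier := C
  coact := Coring.comulR
  coassoc c := by
    rw [Coring.comulR_apply]
    exact Coring.coassoc (R := R) (C := C) c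
  counit c := by
    rw [Coring.comulR_apply]
    exact Coring.counit_right (R := R) (C := C) c

theorem RightComodule.regular_act (f : C →ₗ[R] R) (c : C) :
    (RightComodule.regular R C).act f c = BTensor.contractRight C f (Coring.comul (R := R) c) :=
  congrArg (BTensor.contractRight C f) (Coring.comulR_apply (R := R) (C := C) c)

/-- If `Rat` is exact, then for finitely many `c` in `C` the cyclic module generated by the
family of all these `c` is a rational quotient of `*C`, and a rational preimage of its generator
is a local unit. -/
theorem RatIsExact.hasRationalLocalUnits (hl : IsLocallyProjective R C) (h : RatIsExact R C) :
    HasRationalLocalUnits R C := by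
  classical
  intro F
  let X := RightComodule.regular R C
  let I : Submodule (LeftDual R C)ᵐᵒᵖ (LeftDual R C) :=
    { carrier := {a | ∀ c ∈ F, X.orbitMap c a.toLinear = 0}
      zero_mem' := fun c _ => map_zero (X.orbitMap c)
      add_mem' := fun {a b} ha hb c hc => by
        rw [map_add, map_add, ha c hc, hb c hc, add_zero]
      smul_mem' := fun b a ha c hc =>
        (X.act_act (unop b).toLinear a.toLinear c).symm.trans
          ((congrArg (X.act (unop b).toLinear) (ha c hc)).trans (map_zero _)) }
  choose s hs using fun c : C =>
    BTensor.exists_finset_expansion_right (R := R) (Coring.comul (R := R) c)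
  obtain ⟨n, f, e, hfe⟩ := hl (F.biUnion s)
  have hrat : I.mkQ 1 ∈ ratPart R C (LeftDual R C ⧸ I) := by
    refine ⟨n, fun i => I.mkQ (LeftDual.of (f i)), e, fun a => ?_⟩
    have hmem : op a • (1 : LeftDual R C) -
        ∑ i, op (LeftDual.ofBase R C (a (e i))) • LeftDual.of (f i) ∈ I := by
      intro c hc
      have h2 : X.orbitMap c a.toLinear = ∑ i, op (a (e i)) • X.orbitMap c (f i) := by
        have h3 := hs c n f e fun d hd => hfe d (Finset.mem_biUnion.2 ⟨c, hc, hd⟩)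
        have h4 := congrArg (BTensor.contractRight C a.toLinear) h3
        rw [map_sum] at h4
        refine (RightComodule.regular_act a.toLinear c).trans (h4.trans ?_)
        refine Finset.sum_congr rfl fun i _ => ?_
        rw [BTensor.contractRight_tmul]
        exact congrArg (op (a (e i)) • ·) (RightComodule.regular_act (f i) c).symm
      have h5 : LeftDual.toLinear (op a • (1 : LeftDual R C) -
          ∑ i, op (LeftDual.ofBase R C (a (e i))) • LeftDual.of (f i)) =
            a.toLinear - ∑ i, op (a (e i)) • f i := by
        rw [map_sub, map_sum, op_smul_eq_mul, one_mul]
        exact congrArg (a.toLinear - ·) (Finset.sum_congr rfl fun i _ =>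
          congrArg LeftDual.toLinear (LeftDual.ofBase_smul (a (e i)) (f i)))
      rw [h5, map_sub, h2, map_sum]
      simp only [map_smul, sub_self]
    have h0 := (Submodule.Quotient.mk_eq_zero I).2 hmem
    rw [← Submodule.mkQ_apply, map_sub, map_sum, sub_eq_zero] at h0
    simp only [map_smul] at h0
    exact h0
  obtain ⟨⟨a, ha⟩, haq⟩ := (h I (LeftDual R C) (LeftDual R C ⧸ I) I.subtype I.mkQ
    I.injective_subtype (LinearMap.exact_subtype_mkQ I) I.mkQ_surjective).2.2 ⟨_, hrat⟩
  refine ⟨a, ha, fun c hc => ?_⟩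
  have h1 : a - 1 ∈ I := (Submodule.Quotient.eq I).1 (congrArg Subtype.val haq)
  have h2 : X.act a.toLinear c = c := by
    have h1c := h1 c hc
    rw [map_sub, map_sub, sub_eq_zero] at h1c
    exact h1c.trans (X.act_counit c)
  have h3 := BTensor.apply_contractLeft (Coring.counitR (R := R) (C := C)) a.toLinear
    (Coring.comul c)
  rw [Coring.counit_left, Coring.counitR_apply, ← RightComodule.regular_act] at h3
  exact h3.trans (congrArg (Coring.counit (R := R) (C := C)) h2)

/-- Duals of finitely generated comodules are rational. -/
theorem isRational_dual_of_finite (hl : IsLocallyProjective R C) (M : LeftComodule R C)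
    [Module.Finite R M] : IsRational R C M.Dual := by
  refine eq_top_iff.2 fun f _ => ?_
  obtain ⟨t, ht⟩ := LeftComodule.exists_dualCoact hl M f
  obtain ⟨n, x, c, rfl⟩ := BTensor.exists_eq_sum t
  refine ⟨n, x, c, fun a => ?_⟩
  refine (ht a).symm.trans ?_
  rw [map_sum]
  exact Finset.sum_congr rfl fun i _ => (LeftComodule.Dual.ofBase_smul M (a (c i)) (x i)).symm

theorem isFinitelyDense_of_isRational (M : LeftComodule R C) (h : IsRational R C M.Dual) :
    IsFinitelyDense (R := R) (M := M) (ratPart R C M.Dual : Set M.Dual) := by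
  refine isFinitelyDense_iff.2 fun f F => ⟨f, ?_, fun _ _ => rfl⟩
  have : LeftComodule.Dual.of M f ∈ ratPart R C M.Dual := h ▸ Submodule.mem_top
  exact this

/-- A comodule that embeds into the coring by means of a rational functional is finitely
generated: the functional is given by finitely many functionals, which embed the comodule into a
finitely generated free module. -/
theorem finite_of_mem_ratPart [IsNoetherianRing R] (hl : IsLocallyProjective R C)
    {M : LeftComodule R C} {f : M →ₗ[R] R}
    (hf : LeftComodule.Dual.of M f ∈ ratPart R C M.Dual)
    (hinj : Function.Injective (M.toCoring f)) : Module.Finite R M := by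
  obtain ⟨n, x, c, h⟩ := hf
  let e : M →ₗ[R] (Fin n → R) := LinearMap.pi fun i => LeftComodule.Dual.toLinear M (x i)
  have he : Function.Injective e := by
    rw [injective_iff_map_eq_zero]
    intro m hm
    refine (injective_iff_map_eq_zero _).1 hinj m (hl.eq_zero_of_forall fun a => ?_)
    have h1 : a ∘ₗ M.toCoring f = ∑ i, op (a (c i)) • LeftComodule.Dual.toLinear M (x i) :=
      (h a).trans (Finset.sum_congr rfl fun i _ =>
        LeftComodule.Dual.ofBase_smul M (a (c i)) (x i))
    have h2 := LinearMap.congr_fun h1 m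
    rw [LinearMap.sum_apply] at h2
    refine h2.trans (Finset.sum_eq_zero fun i _ => ?_)
    have h3 : LeftComodule.Dual.toLinear M (x i) m = 0 := congrFun hm i
    rw [LinearMap.smul_apply, h3, smul_zero]
  have := isNoetherian_of_injective e he
  infer_instance

end

/-! ### Finitely generated hulls of simple comodules -/

section

variable {R C : Type u} [Ring R] [AddCommGroup C] [Module R C] [Module Rᵐᵒᵖ C]
  [SMulCommClass R Rᵐᵒᵖ C] [Coring R C]

namespace LeftComodule

/-- Restriction along a colinear map, as a map of right `*C`-modules. -/
def Dual.comap {M N : LeftComodule R C} {k : M →ₗ[R] N} (hk : IsColinear k) :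
    N.Dual →ₗ[(LeftDual R C)ᵐᵒᵖ] M.Dual where
  toFun f := Dual.of M (Dual.toLinear N f ∘ₗ k)
  map_add' _ _ := rfl
  map_smul' a f := congrArg (fun g : M →ₗ[R] C => Dual.of M ((unop a).toLinear ∘ₗ g))
    (toCoring_comp' hk (Dual.toLinear N f)).symm

variable (R C) in
/-- The functionals on the coring that factor through a colinear map to a finitely generated
injective hull of a simple comodule. -/
def hullFunctionals : Set (C →ₗ[R] R) :=
  {a | ∃ (S E : LeftComodule R C) (i : S →ₗ[R] E) (k : C →ₗ[R] E) (b : E →ₗ[R] R),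
    S.IsSimple ∧ IsInjectiveHull i ∧ E.IsFG ∧ IsColinear (M := regular R C) (N := E) k ∧
      a = b ∘ₗ k}

variable (R C) in
/-- Every simple left comodule has a finitely generated injective hull. -/
def HasFGHulls : Prop :=
  ∀ S : LeftComodule R C, S.IsSimple → ∃ (E : LeftComodule R C) (i : S →ₗ[R] E),
    IsInjectiveHull i ∧ E.IsFG

theorem comp_toCoring_mem_hullFunctionals {a : C →ₗ[R] R} (ha : a ∈ hullFunctionals R C)
    (b : C →ₗ[R] R) : b ∘ₗ (regular R C).toCoring a ∈ hullFunctionals R C := by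
  obtain ⟨S, E, i, k, f, hS, hi, hE, hk, rfl⟩ := ha
  refine ⟨S, E, i, k, b ∘ₗ E.toCoring f, hS, hi, hE, hk, ?_⟩
  exact congrArg (b ∘ₗ ·) (toCoring_comp' (M := regular R C) hk f)

theorem hullFunctionals_subset_ratPart (hl : IsLocallyProjective R C)
    (hr : IsLocallyProjective Rᵐᵒᵖ C) [IsNoetherianRing R] {a : C →ₗ[R] R}
    (ha : a ∈ hullFunctionals R C) : LeftDual.of a ∈ ratPart R C (LeftDual R C) := by
  obtain ⟨S, E, i, k, f, hS, hi, hE, hk, rfl⟩ := ha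
  have := hE.finite hr
  have h : Dual.of E f ∈ ratPart R C E.Dual :=
    isRational_dual_of_finite hl E ▸ Submodule.mem_top
  exact map_mem_ratPart (Dual.comap hk) h

theorem coactDual_comul_comp {E : LeftComodule R C} {k : C →ₗ[R] E}
    (hk : IsColinear (M := regular R C) (N := E) k) (f : E →ₗ[R] R) (a : C →ₗ[R] R) :
    coactDual (Coring.comul (R := R)) (f ∘ₗ k) a = (a ∘ₗ E.toCoring f) ∘ₗ k :=
  LinearMap.ext fun c => congrArg a (toCoring_comp (M := regular R C) hk f c).symm

/-- For an element `x` of a right comodule `X` and a colinear map `k : C → E`, the map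
`f ↦ x · (f ∘ k)` from the dual of `E` to `X`. -/
def dualOrbit (E : LeftComodule R C) (X : RightComodule R C) (x : X) (k : C →ₗ[R] E) :
    (E →ₗ[R] R) →ₗ[Rᵐᵒᵖ] X :=
  X.orbitMap x ∘ₗ dualMap k

theorem dualOrbit_apply (E : LeftComodule R C) (X : RightComodule R C) (x : X) (k : C →ₗ[R] E)
    (f : E →ₗ[R] R) : dualOrbit E X x k f = X.act (f ∘ₗ k) x := rfl

theorem isColinear_dualOrbit (hl : IsLocallyProjective R C) (E : LeftComodule R C)
    [Module.Finite R E] (X : RightComodule R C) (x : X) {k : C →ₗ[R] E}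
    (hk : IsColinear (M := regular R C) (N := E) k) :
    RightComodule.IsColinear (M := E.dual hl) (N := X) (dualOrbit E X x k) := by
  refine RightComodule.isColinear_of_act hl fun a (f : E →ₗ[R] R) => ?_
  refine (congrArg (dualOrbit E X x k) (dual_act hl E a f)).trans ?_
  rw [dualOrbit_apply, ← coactDual_comul_comp hk, ← X.act_act]
  rfl

section QF

variable [Module.Injective Rᵐᵒᵖ R] [IsArtinian Rᵐᵒᵖ R]

/-- The functionals that factor through finitely generated hulls span a dense submodule: on a
finitely generated subcomodule `N`, their common zeros form a subcomodule, which is zero since a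
simple subcomodule `S` of it would be detected by an extension `C → E(S)` of `S ⊆ E(S)`; now the
double annihilator property applies. -/
theorem HasFGHulls.exists_mem_span (hl : IsLocallyProjective R C)
    (hr : IsLocallyProjective Rᵐᵒᵖ C) (h : HasFGHulls R C) (f : C →ₗ[R] R) (F : Finset C) :
    ∃ g ∈ Submodule.span Rᵐᵒᵖ (hullFunctionals R C), ∀ c ∈ F, g c = f c := by
  have := QuasiFrobenius.isNoetherianRing_left (R := R)
  have := QuasiFrobenius.isArtinianRing_left (R := R)
  let X := regular R C
  obtain ⟨N, hN, hfg, hFN⟩ : ∃ N : Submodule R C, X.IsSubcomodule N ∧ N.FG ∧ (F : Set C) ⊆ N :=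
    exists_fg_isSubcomodule hr X F
  have hfin : Module.Finite R N := Module.Finite.iff_fg.2 hfg
  let V : Submodule Rᵐᵒᵖ (N →ₗ[R] R) :=
    (Submodule.span Rᵐᵒᵖ (hullFunctionals R C)).map (dualMap (N.subtype : N →ₗ[R] C))
  have hV : V = ⊤ := by
    refine QuasiFrobenius.eq_top_of_separating V fun m hm => ?_
    have hZ : X.IsSubcomodule (X.polar (hullFunctionals R C)) :=
      isSubcomodule_polar hl hr X fun a ha b => comp_toCoring_mem_hullFunctionals ha b
    by_contra hm0
    have hmZ : (m : C) ∈ N ⊓ X.polar (hullFunctionals R C) :=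
      ⟨m.2, fun (a : C →ₗ[R] R) ha => hm _ ⟨a, Submodule.subset_span ha, rfl⟩⟩
    obtain ⟨S, hS, hSZ, hSs⟩ := exists_isSimple_sub hr (hN.inf hr hZ) (fun hbot => hm0
      (Subtype.ext ((Submodule.mem_bot R).1 (hbot ▸ hmZ))))
    obtain ⟨E, i, hi, hE⟩ := h _ hSs
    obtain ⟨k, hk, hki⟩ := hi.2.2.1 _ X S.subtype i (isColinear_subtype hr X S hS)
      S.injective_subtype hi.1
    have := hSs.1
    obtain ⟨s, hs⟩ := exists_ne (0 : X.sub hr S hS)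
    have his : i s ≠ 0 := fun h0 => hs (hi.2.1 (h0.trans (map_zero i).symm))
    obtain ⟨b, hb⟩ := QuasiFrobenius.exists_functional_ne_zero (R := R) (M := E) his
    have hks : k (S.subtype s) = i s := LinearMap.congr_fun hki s
    refine hb ?_
    rw [← hks]
    exact (hSZ s.2).2 (b ∘ₗ k) ⟨_, E, i, k, b, hSs, hi, hE, hk, rfl⟩
  obtain ⟨g, hg, hgf⟩ : dualMap (N.subtype : N →ₗ[R] C) f ∈ V := hV ▸ Submodule.mem_top
  exact ⟨g, hg, fun c hc => LinearMap.congr_fun hgf ⟨c, hFN hc⟩⟩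

theorem HasFGHulls.hasRationalLocalUnits (hl : IsLocallyProjective R C)
    (hr : IsLocallyProjective Rᵐᵒᵖ C) (h : HasFGHulls R C) : HasRationalLocalUnits R C := by
  have := QuasiFrobenius.isNoetherianRing_left (R := R)
  intro F
  obtain ⟨g, hg, hgF⟩ := h.exists_mem_span hl hr Coring.counit F
  refine ⟨LeftDual.of g, ?_, hgF⟩
  clear hgF
  induction hg using Submodule.span_induction with
  | mem a ha => exact hullFunctionals_subset_ratPart hl hr ha
  | zero => exact zero_mem (ratPart R C (LeftDual R C))
  | add a b _ _ ha hb => exact add_mem ha hb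
  | smul r a _ ha =>
    have := (ratPart R C (LeftDual R C)).smul_mem (op (LeftDual.ofBase R C (unop r))) ha
    rwa [LeftDual.ofBase_smul] at this

/-- Density in the duals of the injective indecomposable comodules makes the hulls of simple
comodules finitely generated. -/
theorem hasFGHulls_of_isFinitelyDense (hl : IsLocallyProjective R C)
    (hr : IsLocallyProjective Rᵐᵒᵖ C)
    (h : ∀ Q : LeftComodule R C, Q.IsInjective → Q.IsIndecomposable →
      IsFinitelyDense (R := R) (M := Q) (ratPart R C Q.Dual : Set Q.Dual)) :
    HasFGHulls R C := by
  have := QuasiFrobenius.isNoetherianRing_left (R := R)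
  intro S hS
  obtain ⟨E, i, hi⟩ := exists_injectiveHull hr hS
  refine ⟨E, i, hi, ?_⟩
  have := hS.1
  obtain ⟨s, hs⟩ := exists_ne (0 : S)
  have his : i s ≠ 0 := fun h0 => hs (hi.2.1 (h0.trans (map_zero i).symm))
  obtain ⟨f, hf⟩ := QuasiFrobenius.exists_functional_ne_zero (R := R) (M := E) his
  obtain ⟨g, hg, hgf⟩ := isFinitelyDense_iff.1
    (h E hi.2.2.1 (hi.isIndecomposable hr hS)) f {i s}
  have hgs : g (i s) ≠ 0 := by rwa [hgf _ (Finset.mem_singleton_self _)]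
  have := finite_of_mem_ratPart hl hg (hi.toCoring_injective hr hS hgs)
  exact isFG_of_finite E

/-- An injective indecomposable comodule is the hull of any of its simple subcomodules. -/
theorem HasFGHulls.finite (hr : IsLocallyProjective Rᵐᵒᵖ C) (h : HasFGHulls R C)
    {Q : LeftComodule R C} (hQ : Q.IsInjective) (hQi : Q.IsIndecomposable) :
    Module.Finite R Q := by
  have := QuasiFrobenius.isNoetherianRing_left (R := R)
  have := QuasiFrobenius.isArtinianRing_left (R := R)
  have := hQi.1
  obtain ⟨S, hS, -, hSs⟩ := exists_isSimple_sub hr (isSubcomodule_top (M := Q) hr) top_ne_bot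
  obtain ⟨E, i, hi, hE⟩ := h _ hSs
  have := hE.finite hr
  have hS' := isColinear_subtype hr Q S hS
  obtain ⟨e, he, hei⟩ := hQ _ E i S.subtype hi.1 hi.2.1 hS'
  have := hSs.1
  obtain ⟨s, hs⟩ := exists_ne (0 : Q.sub hr S hS)
  have hes : e (i s) ≠ 0 := fun h0 => hs (S.injective_subtype
    (((LinearMap.congr_fun hei s).symm.trans h0).trans (map_zero S.subtype).symm))
  have heinj : Function.Injective e := by
    rw [← LinearMap.ker_eq_bot]
    by_contra hne
    exact hes (hi.apply_mem hr hSs (he.isSubcomodule_ker hr) hne s)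
  obtain ⟨p, hp, hpe⟩ := hi.2.2.1 E Q e LinearMap.id he heinj (isColinear_id E)
  have hpe' : ∀ x, p (e x) = x := LinearMap.congr_fun hpe
  have hc : IsCompl (LinearMap.range e) (LinearMap.ker p) := by
    refine IsCompl.of_eq ((Submodule.eq_bot_iff _).2 ?_) (eq_top_iff.2 fun y _ => ?_)
    · rintro _ ⟨⟨x, rfl⟩, hx⟩
      have hx0 : x = 0 := (hpe' x).symm.trans hx
      rw [hx0, map_zero]
    · rw [← add_sub_cancel (e (p y)) y]
      refine Submodule.add_mem_sup ⟨_, rfl⟩ ?_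
      rw [LinearMap.mem_ker, map_sub, hpe', sub_self]
  have hker := (hQi.2 _ _ (he.isSubcomodule_range hr) (hp.isSubcomodule_ker hr) hc).resolve_left
    fun h0 => hes ((Submodule.mem_bot R).1 (h0 ▸ ⟨i s, rfl⟩))
  have htop : LinearMap.range e = ⊤ := by
    have := hc.sup_eq_top
    rwa [hker, sup_bot_eq] at this
  exact Module.Finite.of_surjective e (LinearMap.range_eq_top.1 htop)

/-- The dual of a finitely generated hull `E` of a simple comodule is projective: it is cyclic and
a direct summand of `*C`, as `E` is a direct summand of `C`. -/
theorem IsInjectiveHull.isProjective_dual (hl : IsLocallyProjective R C)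
    (hr : IsLocallyProjective Rᵐᵒᵖ C) {S E : LeftComodule R C} (hS : S.IsSimple)
    {i : S →ₗ[R] E} (hi : IsInjectiveHull i) [Module.Finite R E] :
    (E.dual hl).IsProjective ∧ (E.dual hl).IsFG := by
  have := hS.1
  obtain ⟨s, hs⟩ := exists_ne (0 : S)
  have his : i s ≠ 0 := fun h0 => hs (hi.2.1 (h0.trans (map_zero i).symm))
  obtain ⟨f, hf⟩ := QuasiFrobenius.exists_functional_ne_zero (R := R) (M := E) his
  obtain ⟨p, hp, hpf⟩ := hi.2.2.1 E (regular R C) (E.toCoring f) LinearMap.id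
    (isColinear_toCoring E f) (hi.toCoring_injective hr hS hf) (isColinear_id E)
  let p' : C →ₗ[R] E := p
  have hgen : ∀ b : E →ₗ[R] R, (E.dual hl).act (b ∘ₗ p') f = b := fun b =>
    (dual_act hl E (b ∘ₗ p') f).trans (congrArg (b ∘ₗ ·) hpf)
  refine ⟨fun X Y q g hq hqs hg => ?_, ⟨({f} : Finset (E →ₗ[R] R)),
    fun (V : Submodule Rᵐᵒᵖ (E →ₗ[R] R)) hV hfV => ?_⟩⟩
  · obtain ⟨x, hx⟩ := hqs (g f)
    refine ⟨dualOrbit E X x p', isColinear_dualOrbit hl E X x hp,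
      LinearMap.ext fun (b : E →ₗ[R] R) => ?_⟩
    refine (hq.act (b ∘ₗ p') x).trans ?_
    rw [hx]
    exact (hg.act (b ∘ₗ p') f).symm.trans (congrArg g (hgen b))
  · refine eq_top_iff.2 fun (b : E →ₗ[R] R) _ => ?_
    have := (RightComodule.isSubcomodule_iff hl).1 hV (b ∘ₗ p') f
      (hfV (Finset.mem_coe.2 (Finset.mem_singleton_self f)))
    exact (hgen b) ▸ this

/-- Proper subcomodules of the dual of a finitely generated hull `E` of a simple comodule `S`
vanish on `S`. -/
theorem IsInjectiveHull.apply_eq_zero (hl : IsLocallyProjective R C)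
    (hr : IsLocallyProjective Rᵐᵒᵖ C) {S E : LeftComodule R C} (hS : S.IsSimple)
    {i : S →ₗ[R] E} (hi : IsInjectiveHull i) [Module.Finite R E]
    {V : Submodule Rᵐᵒᵖ (E →ₗ[R] R)} (hV : (E.dual hl).IsSubcomodule V) (hne : V ≠ ⊤)
    {f : E →ₗ[R] R} (hf : f ∈ V) (s : S) : f (i s) = 0 :=
  hi.apply_mem hr hS (isSubcomodule_polar_dual hl hr hV)
    (fun h => hne (eq_top_of_polar_eq_bot V h)) s f hf

/-- The projective cover of a simple right comodule `T` is the dual of the hull of a simple left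
comodule: some functional that factors through a map `k` to a finitely generated hull `E` acts
nontrivially on `T`, so some `t` in `T` gives a nonzero map `f ↦ t · (f ∘ k)` from the dual of `E`
to `T`. -/
theorem HasFGHulls.exists_projectiveCover (hl : IsLocallyProjective R C)
    (hr : IsLocallyProjective Rᵐᵒᵖ C) (h : HasFGHulls R C) {T : RightComodule R C}
    (hT : T.IsSimple) : ∃ (P : RightComodule R C) (f : P →ₗ[Rᵐᵒᵖ] T),
      RightComodule.IsProjectiveCover f ∧ P.IsFG := by
  classical
  have := QuasiFrobenius.isNoetherianRing_left (R := R)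
  have := hT.1
  obtain ⟨t, ht⟩ := exists_ne (0 : T)
  obtain ⟨a, ha, hat⟩ : ∃ a ∈ hullFunctionals R C, T.act a t ≠ 0 := by
    by_contra hcon
    push Not at hcon
    obtain ⟨n, x, c, hx⟩ := BTensor.exists_eq_sum (T.coact t)
    obtain ⟨g, hg, hgc⟩ := h.exists_mem_span hl hr Coring.counit (Finset.univ.image c)
    have h1 : T.orbitMap t g = t := by
      refine Eq.trans ?_ (T.act_counit t)
      rw [RightComodule.orbitMap_apply, RightComodule.act_apply, RightComodule.act_apply, hx,
        map_sum, map_sum]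
      refine Finset.sum_congr rfl fun i _ => ?_
      rw [BTensor.contractRight_tmul, BTensor.contractRight_tmul,
        hgc _ (Finset.mem_image_of_mem _ (Finset.mem_univ i))]
    have h2 : Submodule.span Rᵐᵒᵖ (hullFunctionals R C) ≤ LinearMap.ker (T.orbitMap t) :=
      Submodule.span_le.2 fun b hb => hcon b hb
    exact ht (h1.symm.trans (h2 hg))
  obtain ⟨S, E, i, k, b, hS, hi, hE, hk, rfl⟩ := ha
  have := hE.finite hr
  have hPr := hi.isProjective_dual hl hr hS
  let d : (E →ₗ[R] R) →ₗ[Rᵐᵒᵖ] T := dualOrbit E T t k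
  have hd : RightComodule.IsColinear (M := E.dual hl) (N := T) d :=
    isColinear_dualOrbit hl E T t hk
  have hdb : d b ≠ 0 := hat
  refine ⟨E.dual hl, d, ⟨hd, ?_, hPr.1, fun (V : Submodule Rᵐᵒᵖ (E →ₗ[R] R)) hV hsup => ?_⟩, hPr.2⟩
  · have hrange : LinearMap.range d = ⊤ :=
      (hT.2 _ (hd.isSubcomodule_range hl)).resolve_left fun h0 => hdb <| by
        have hmem : d b ∈ LinearMap.range d := ⟨b, rfl⟩
        have h1 : LinearMap.range d = ⊥ := h0
        rw [h1] at hmem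
        exact (Submodule.mem_bot _).1 hmem
    have hsurj : Function.Surjective d := LinearMap.range_eq_top.1 hrange
    exact hsurj
  · by_contra hne
    have := hS.1
    obtain ⟨s, hs⟩ := exists_ne (0 : S)
    have his : i s ≠ 0 := fun h0 => hs (hi.2.1 (h0.trans (map_zero i).symm))
    obtain ⟨f, hf⟩ := QuasiFrobenius.exists_functional_ne_zero (R := R) (M := E) his
    have hker : LinearMap.ker d ≠ ⊤ := fun h0 => hdb (by
      have : b ∈ LinearMap.ker d := h0 ▸ Submodule.mem_top
      exact this)
    have hsup' : LinearMap.ker d ⊔ V = (⊤ : Submodule Rᵐᵒᵖ (E →ₗ[R] R)) := hsup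
    have hmem : f ∈ LinearMap.ker d ⊔ V := hsup' ▸ Submodule.mem_top
    obtain ⟨u, hu, v, hv, huv⟩ := Submodule.mem_sup.1 hmem
    have h1 : u (i s) + v (i s) = f (i s) := LinearMap.congr_fun huv (i s)
    have h2 : u (i s) = 0 := hi.apply_eq_zero hl hr hS (hd.isSubcomodule_ker hl) hker hu s
    have h3 : v (i s) = 0 := hi.apply_eq_zero hl hr hS hV hne hv s
    exact hf (by rw [← h1, h2, h3, add_zero])

end QF

end LeftComodule

end

/-! ### From projective covers to finitely generated hulls -/

namespace LeftComodule

variable {R C : Type u} [Ring R] [AddCommGroup C] [Module R C] [Module Rᵐᵒᵖ C]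
  [SMulCommClass R Rᵐᵒᵖ C] [Coring R C] [Module.Injective Rᵐᵒᵖ R] [IsArtinian Rᵐᵒᵖ R]

/-- A projective comodule that maps nontrivially to the dual of a simple comodule `S` maps onto the
dual of every finitely generated subcomodule `N` between `S` and `E(S)`: the map lifts to the dual
of `N`, and the polar of the image of the lift does not contain `S`, so it is zero. -/
theorem IsInjectiveHull.exists_surjective_dual (hl : IsLocallyProjective R C)
    (hr : IsLocallyProjective Rᵐᵒᵖ C) {S E : LeftComodule R C} [Module.Finite R S]
    (hS : S.IsSimple) {i : S →ₗ[R] E} (hi : IsInjectiveHull i) {P : RightComodule R C}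
    (hP : P.IsProjective) {f : P →ₗ[Rᵐᵒᵖ] (S →ₗ[R] R)}
    (hf : RightComodule.IsColinear (M := P) (N := S.dual hl) f) {p : P} (hp : f p ≠ 0)
    {N : Submodule R E} (hN : E.IsSubcomodule N) (hfg : N.FG) (hiN : LinearMap.range i ≤ N) :
    ∃ h : P →ₗ[Rᵐᵒᵖ] (N →ₗ[R] R), Function.Surjective h := by
  have := QuasiFrobenius.injective_left (R := R)
  let D := E.sub hr N hN
  have hD : Module.Finite R D := Module.Finite.iff_fg.2 hfg
  let j : S →ₗ[R] D := i.codRestrict N fun s => hiN ⟨s, rfl⟩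
  have hsub : IsColinear (M := D) (N := E) N.subtype := isColinear_subtype hr E N hN
  have hj : IsColinear j := isColinear_of_act hr fun φ s => Subtype.ext <|
    (hi.1.act φ s).trans (hsub.act φ (j s)).symm
  have hjinj : Function.Injective j := fun a b hab => hi.2.1 (congrArg Subtype.val hab)
  obtain ⟨h, hh, hhf⟩ := hP (D.dual hl) (S.dual hl) (dualMap j) f (isColinear_dualMap hl hj)
    (dualMap_surjective hjinj) hf
  let h' : P →ₗ[Rᵐᵒᵖ] (D →ₗ[R] R) := h
  have hV := hh.isSubcomodule_range hl
  have hpolar := isSubcomodule_polar_dual hl hr (M := D) (V := LinearMap.range h') hV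
  have htop : LinearMap.range h' = ⊤ := by
    refine eq_top_of_polar_eq_bot _ ?_
    by_contra hne
    refine hp (LinearMap.ext fun s => ?_)
    have hmem := hi.apply_mem hr hS (hsub.isSubcomodule_map hr hpolar) (fun h0 => hne
      (Submodule.map_injective_of_injective N.injective_subtype
        (h0.trans (Submodule.map_bot _).symm))) s
    obtain ⟨d, hd, hds⟩ := hmem
    have hdj : d = j s := Subtype.ext hds
    have h1 : h' p (j s) = f p s := LinearMap.congr_fun (LinearMap.congr_fun hhf p) s
    have h2 : h' p (j s) = 0 := hdj ▸ hd (h' p) ⟨p, rfl⟩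
    exact h1.symm.trans h2
  have hsurj : Function.Surjective h' := LinearMap.range_eq_top.1 htop
  exact ⟨h', hsurj⟩

/-- The dual of a proper submodule is shorter than the dual of the module. -/
theorem length_dual_add_one_le {M : Type u} [AddCommGroup M] [Module R M] {N N' : Submodule R M}
    (hlt : N < N') :
    Module.length Rᵐᵒᵖ (N →ₗ[R] R) + 1 ≤ Module.length Rᵐᵒᵖ (N' →ₗ[R] R) := by
  have := QuasiFrobenius.injective_left (R := R)
  let ι := Submodule.inclusion hlt.le
  have hsurj : Function.Surjective (dualMap ι) :=
    dualMap_surjective (Submodule.inclusion_injective hlt.le)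
  have hex : Function.Exact (LinearMap.ker (dualMap ι)).subtype (dualMap ι) :=
    LinearMap.exact_subtype_ker_map (dualMap ι)
  rw [Module.length_eq_add_of_exact _ _ (Submodule.injective_subtype _) hsurj hex, add_comm]
  refine add_le_add_left (Order.one_le_iff_pos.2 (Module.length_pos_iff.2 ?_)) _
  obtain ⟨x, hx', hx⟩ := SetLike.exists_of_lt hlt
  have hx0 : (LinearMap.range ι).mkQ ⟨x, hx'⟩ ≠ 0 := fun h0 => hx <| by
    obtain ⟨y, hy⟩ := (Submodule.Quotient.mk_eq_zero _).1 h0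
    have hyx : (y : M) = x := congrArg Subtype.val hy
    exact hyx ▸ y.2
  obtain ⟨g, hg⟩ := QuasiFrobenius.exists_functional_ne_zero (R := R) hx0
  refine ⟨⟨⟨g ∘ₗ (LinearMap.range ι).mkQ, LinearMap.mem_ker.2 (LinearMap.ext fun y => ?_)⟩, 0,
    fun h0 => hg ?_⟩⟩
  · have : (LinearMap.range ι).mkQ (ι y) = 0 := (Submodule.Quotient.mk_eq_zero _).2 ⟨y, rfl⟩
    exact (congrArg g this).trans (map_zero g)
  · exact LinearMap.congr_fun (congrArg Subtype.val h0) ⟨x, hx'⟩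

/-- If the dual of a simple comodule `S` has a projective cover `P`, then the finite length of `P`
bounds the lengths of the duals of all finitely generated comodules between `S` and `E(S)`, which
would grow without bound if `E(S)` were not finitely generated. -/
theorem hasFGHulls_of_forall_exists_isProjectiveCover (hl : IsLocallyProjective R C)
    (hr : IsLocallyProjective Rᵐᵒᵖ C)
    (h : ∀ T : RightComodule R C, T.IsSimple →
      ∃ (P : RightComodule R C) (f : P →ₗ[Rᵐᵒᵖ] T), RightComodule.IsProjectiveCover f) :
    HasFGHulls R C := by
  have := QuasiFrobenius.isNoetherianRing_left (R := R)
  have := QuasiFrobenius.isNoetherian_right (R := R)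
  have : IsNoetherianRing Rᵐᵒᵖ := isNoetherian_of_linearEquiv (QuasiFrobenius.opEquiv R)
  have : IsArtinianRing Rᵐᵒᵖ := isArtinian_of_linearEquiv (QuasiFrobenius.opEquiv R)
  intro S hS
  obtain ⟨E, i, hi⟩ := exists_injectiveHull hr hS
  refine ⟨E, i, hi, ?_⟩
  have hSfin := hS.finite hr
  obtain ⟨P, f, hf⟩ := h _ (hS.dual hl hr)
  let f' : P →ₗ[Rᵐᵒᵖ] (S →ₗ[R] R) := f
  obtain ⟨g, hg⟩ : ∃ g : S →ₗ[R] R, g ≠ 0 := by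
    have := (hS.dual hl hr).1
    exact exists_ne (0 : S.dual hl)
  obtain ⟨p, hp⟩ := hf.2.1 g
  have hp0 : f' p ≠ 0 := fun h0 => hg (hp.symm.trans h0)
  have : Module.Finite Rᵐᵒᵖ P :=
    ⟨hf.range_orbitMap_eq_top hl (hS.dual hl hr) hp0 ▸ P.fg_range_orbitMap p⟩
  have : IsNoetherian Rᵐᵒᵖ P := isNoetherian_of_isNoetherianRing_of_finite Rᵐᵒᵖ P
  have : IsArtinian Rᵐᵒᵖ P := isArtinian_of_fg_of_artinian'
  suffices Module.Finite R E from isFG_of_finite E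
  by_contra hE
  have key : ∀ k : ℕ, ∃ N : Submodule R E, E.IsSubcomodule N ∧ N.FG ∧ LinearMap.range i ≤ N ∧
      (k : ℕ∞) ≤ Module.length Rᵐᵒᵖ (N →ₗ[R] R) := by
    intro k
    induction k with
    | zero =>
      exact ⟨_, hi.1.isSubcomodule_range hr, (LinearMap.range_eq_map i) ▸
        (Module.Finite.fg_top (R := R) (M := S)).map i, le_rfl, by simp⟩
    | succ k ih =>
      obtain ⟨N, hN, hfg, hiN, hk⟩ := ih
      obtain ⟨x, hx⟩ : ∃ x, x ∉ N := by
        by_contra hcon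
        push Not at hcon
        exact hE ⟨(eq_top_iff.2 fun x _ => hcon x : N = ⊤) ▸ hfg⟩
      have hlt : N < E.cyclic x ⊔ N := lt_of_le_of_ne le_sup_right fun h0 => hx <| by
        rw [h0]
        exact Submodule.mem_sup_left (E.mem_cyclic_self x)
      refine ⟨_, (isSubcomodule_cyclic hr E x).sup hr hN, (E.fg_cyclic x).sup hfg,
        hiN.trans hlt.le, le_trans ?_ (length_dual_add_one_le hlt)⟩
      push_cast
      exact add_le_add_left hk 1
  obtain ⟨n, hn⟩ := ENat.ne_top_iff_exists.1 (Module.length_ne_top (R := Rᵐᵒᵖ) (M := P))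
  obtain ⟨N, hN, hfg, hiN, hk⟩ := key (n + 1)
  obtain ⟨q, hq⟩ := hi.exists_surjective_dual hl hr hS hf.2.2.1 (f := f') hf.1 hp0 hN hfg hiN
  have hle := hk.trans (Module.length_le_of_surjective q hq)
  rw [← hn] at hle
  exact absurd (Nat.cast_le.1 hle) (Nat.not_succ_le_self n)

end LeftComodule

theorem theorem4p3 (R C : Type u) [Ring R] [AddCommGroup C] [Module R C] [Module Rᵐᵒᵖ C]
    [SMulCommClass R Rᵐᵒᵖ C] [Coring R C] (hR : IsQuasiFrobenius R)
    (hl : IsLocallyProjective R C) (hr : IsLocallyProjective Rᵐᵒᵖ C) :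
    List.TFAE [
      RatIsExact R C,
      IsFinitelyDense (R := R) (M := C) (ratPart R C (LeftDual R C) : Set (LeftDual R C)),
      ∀ M : LeftComodule R C,
        IsFinitelyDense (R := R) (M := M) (ratPart R C M.Dual : Set M.Dual),
      ∀ Q : LeftComodule R C, Q.IsInjective →
        IsFinitelyDense (R := R) (M := Q) (ratPart R C Q.Dual : Set Q.Dual),
      ∀ Q : LeftComodule R C, Q.IsInjective → Q.IsIndecomposable →
        IsFinitelyDense (R := R) (M := Q) (ratPart R C Q.Dual : Set Q.Dual),
      ∀ Q : LeftComodule R C, Q.IsInjective → Q.IsIndecomposable → IsRational R C Q.Dual,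
      ∀ S : LeftComodule R C, S.IsSimple → ∃ (E : LeftComodule R C) (i : S →ₗ[R] E),
        LeftComodule.IsInjectiveHull i ∧ E.IsFG,
      ∀ T : RightComodule R C, T.IsSimple → ∃ (P : RightComodule R C) (f : P →ₗ[Rᵐᵒᵖ] T),
        RightComodule.IsProjectiveCover f ∧ P.IsFG,
      IsRightSemiperfect R C] := by
  have : IsArtinian Rᵐᵒᵖ R := hR.1
  have : Module.Injective Rᵐᵒᵖ R := hR.2
  tfae_have 1 → 2 := fun h => (h.hasRationalLocalUnits hl).isFinitelyDense_leftDual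
  tfae_have 2 → 1 := fun h => (hasRationalLocalUnits_of_isFinitelyDense h).ratIsExact
  tfae_have 2 → 3 := fun h => (hasRationalLocalUnits_of_isFinitelyDense h).isFinitelyDense
  tfae_have 3 → 4 := fun h Q _ => h Q
  tfae_have 4 → 5 := fun h Q hQ _ => h Q hQ
  tfae_have 5 → 7 := LeftComodule.hasFGHulls_of_isFinitelyDense hl hr
  tfae_have 7 → 6 := fun h Q hQ hQi => by
    have : Module.Finite R Q := LeftComodule.HasFGHulls.finite hr h hQ hQi
    exact isRational_dual_of_finite hl Q
  tfae_have 6 → 5 := fun h Q hQ hQi => isFinitelyDense_of_isRational Q (h Q hQ hQi)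
  tfae_have 7 → 2 := fun h =>
    (LeftComodule.HasFGHulls.hasRationalLocalUnits hl hr h).isFinitelyDense_leftDual
  tfae_have 7 → 8 := fun h _ hT => LeftComodule.HasFGHulls.exists_projectiveCover hl hr h hT
  tfae_have 8 → 9 := fun h => ⟨hl, fun T hT =>
    have ⟨P, f, hf, _⟩ := h T hT
    ⟨P, f, hf⟩⟩
  tfae_have 9 → 7 := fun h =>
    LeftComodule.hasFGHulls_of_forall_exists_isProjectiveCover hl hr h.2
  tfae_finish
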